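/- **Setting.** Let $J\in\mathbb N$ be the number of sunlight/eclipse periods. Let $a>0$, $B_{\max}>0$, $P_c>0$, $E^d_{e,j}\ge 0$ and $B_0,T_c,E^h_{s,j},E^d_{s,j}\in\mathbb R$ ($1\le j\le J$), and let $t_{s,1},t_{e,1},\dots,t_{s,J},t_{e,J},t_{s,J+1}\in\mathbb R$ be the period boundaries. Collect the variables $\tau_{s,j},\tau_{e,j},b_{e,j},b_{s,j+1},d_{e,j},\hat d_{e,j}$ ($1\le j\le J$) in a vector $\boldsymbol x\in\mathbb R^{6J}$, put $b_{s,1}=B_0$ and $\boldsymbol d=(d_{e,1},\dots,d_{e,J})$, and let $\mathcal X$ be the set of all $\boldsymbol x$ such that $\sum_{j=1}^J(\tau_{s,j}+\tau_{e,j})=T_c$ and, for all $j$, $$b_{s,j+1}=b_{e,j}-E^d_{e,j}-P_c\tau_{e,j},\qquad b_{e,j}\le\min\{b_{s,j}+E^h_{s,j}-E^d_{s,j}-P_c\tau_{s,j},\,B_{\max}\},\qquad E^h_{s,j}-E^d_{s,j}-P_c\tau_{s,j}\ge0,$$ $$d_{e,j}=\frac{B_{\max}-b_{e,j}}{B_{\max}},\qquad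 \hat d_{e,j}=\frac{B_{\max}-b_{s,j+1}}{B_{\max}},\qquad 0\le\tau_{s,j}\le t_{e,j}-t_{s,j},\qquad 0\le\tau_{e,j}\le t_{s,j+1}-t_{e,j},$$ $$0\le b_{s,j+1}\le B_{\max},\qquad 0\le b_{e,j}\le B_{\max}.$$ With $u(\boldsymbol x)=\sum_{j}10^{a(\hat d_{e,j}-1)}\hat d_{e,j}$ and $v(\boldsymbol d)=\sum_j 10^{a(d_{e,j}-1)}d_{e,j}$, consider the problem $$(\mathrm P)\qquad \min_{\boldsymbol x\in\mathcal X} f(\boldsymbol x)=u(\boldsymbol x)-v(\boldsymbol d).$$ A point $\boldsymbol x\in\mathcal X$ is a *stationary point* of $(\mathrm P)$ if $\nabla f(\boldsymbol x)^T(\boldsymbol y-\boldsymbol x)\ge0$ for all $\boldsymbol y\in\mathcal X$. Norms are Euclidean. **Algorithm (concave-convex procedure) with tolerance $\varepsilon\ge0$.** Start with any $\boldsymbol x^{(0)}\in\mathcal X$ and $l=0$. Repeat: let $\boldsymbol x^{(l+1)}$ be any element of $$\operatorname*{arg\,min}_{\boldsymbol x\in\mathcal X}\; u(\boldsymbol x)-\boldsymbol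 d^T\nabla v(\boldsymbol d^{(l)}),\qquad \boldsymbol d^T\nabla v(\boldsymbol d^{(l)})=\sum_{j}d_{e,j}\,10^{a(d^{(l)}_{e,j}-1)}\bigl(1+a\,d^{(l)}_{e,j}\ln 10\bigr),$$ and increase $l$ by one; until $\Vert\boldsymbol d^{(l)}-\boldsymbol d^{(l-1)}\Vert\le\varepsilon$. The generated sequence is finite if the stopping test is met at some point, in which case its limit is understood to be its last member, and infinite otherwise. **Theorem.** There is a function $\delta:\mathbb R\to\mathbb R$, depending only on the data of $(\mathrm P)$, with $\delta(\varepsilon)>\varepsilon$ for all $\varepsilon>0$ and $\delta(\varepsilon)\to0$ as $\varepsilon\downarrow0$, such that for every $\varepsilon\ge0$ and every sequence $\{\boldsymbol x^{(l)}\}_l$ generated by the algorithm with tolerance $\varepsilon$: 1. the sequence converges to a point $\bar{\boldsymbol x}$; 2. if $\varepsilon=0$, then $\bar{\boldsymbol x}$ is a stationary point of $(\mathrm P)$; 3. if $\varepsilon>0$, then the algorithm terminates after finitely many iterations and $\Vert\boldsymbol x^\star-\bar{\boldsymbol x}\Vert\le\delta(\varepsilon)$ for some stationary point $\boldsymbol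 x^\star$ of $(\mathrm P)$. -/

import Mathlib

open Filter Topology

noncomputable section

/-- Data of the scheduling problem with `J` sunlight/eclipse periods.  Index `j : Fin J` is the
`(j+1)`-st period. Only the sign conditions that are not already forced by feasibility are kept. -/
structure SatData (J : ℕ) where
  /-- battery constant of the cycle life model -/
  a : ℝ
  /-- battery capacity -/
  Bmax : ℝ
  /-- initial battery charge -/
  B0 : ℝ
  /-- power needed for training -/
  Pc : ℝ
  /-- total training time -/
  Tc : ℝ
  /-- starts of the sunlight periods; the last entry is the end of the last eclipse -/
  tS : Fin (J + 1) → ℝ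
  /-- starts of the eclipse periods -/
  tE : Fin J → ℝ
  /-- harvested energy in the sunlight periods -/
  EhS : Fin J → ℝ
  /-- non-training energy demand in the sunlight periods -/
  EdS : Fin J → ℝ
  /-- non-training energy demand in the eclipse periods -/
  EdE : Fin J → ℝ
  a_pos : 0 < a
  Bmax_pos : 0 < Bmax
  Pc_pos : 0 < Pc
  EdE_nonneg : ∀ j, 0 ≤ EdE j

/-- All optimization variables: six real vectors of length `J`, with the Euclidean norm. -/
abbrev SatVar (J : ℕ) : Type := EuclideanSpace ℝ (Fin 6 × Fin J)

namespace SatVar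

variable {J : ℕ}

/-- Training time in sunlight period `j`. -/
def tauS (x : SatVar J) (j : Fin J) : ℝ := x (0, j)

/-- Training time in eclipse period `j`. -/
def tauE (x : SatVar J) (j : Fin J) : ℝ := x (1, j)

/-- Battery level at the beginning of eclipse `j`. -/
def bE (x : SatVar J) (j : Fin J) : ℝ := x (2, j)

/-- Battery level at the end of eclipse `j` (`b_{s,j+1}`). -/
def bSnext (x : SatVar J) (j : Fin J) : ℝ := x (3, j)

/-- Depth of discharge at the beginning of eclipse `j`. -/
def dE (x : SatVar J) (j : Fin J) : ℝ := x (4, j)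

/-- Depth of discharge at the end of eclipse `j`. -/
def dHat (x : SatVar J) (j : Fin J) : ℝ := x (5, j)

/-- The vector of depths of discharge at the beginnings of the eclipses. -/
def dVec (x : SatVar J) : EuclideanSpace ℝ (Fin J) := WithLp.toLp 2 (fun j => x.dE j)

end SatVar

/-- `10^{a(d-1)} d`, the cycle life consumed by a discharge from depth `0` to depth `d`. -/
def cycleLife (a d : ℝ) : ℝ := (10 : ℝ) ^ (a * (d - 1)) * d

/-- The derivative of `cycleLife a` at `d` (see `hasDerivAt_cycleLife`). -/
def cycleLifeSlope (a d : ℝ) : ℝ := (10 : ℝ) ^ (a * (d - 1)) * (1 + a * d * Real.log 10)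

theorem hasDerivAt_cycleLife (a d : ℝ) :
    HasDerivAt (cycleLife a) (cycleLifeSlope a d) d := by
  have h1 : HasDerivAt (fun y : ℝ => a * (y - 1)) a d := by
    simpa using ((hasDerivAt_id d).sub_const 1).const_mul a
  have h2 := (h1.const_rpow (a := (10 : ℝ)) (by norm_num)).mul (hasDerivAt_id d)
  refine h2.congr_deriv ?_
  simp only [cycleLifeSlope, id]
  ring

namespace SatData

variable {J : ℕ}

/-- Battery level `b_{s,j}` at the beginning of sunlight period `j`: the initial charge for the
first period, the level at the end of the preceding eclipse otherwise. -/
def bS (p : SatData J) (x : SatVar J) (j : Fin J) : ℝ :=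
  if j.val = 0 then p.B0 else x.bSnext ⟨j.val - 1, lt_of_le_of_lt (Nat.sub_le _ _) j.isLt⟩

/-- The constraints of the relaxed problem. -/
structure IsFeasible (p : SatData J) (x : SatVar J) : Prop where
  eclipse : ∀ j, x.bSnext j = x.bE j - p.EdE j - p.Pc * x.tauE j
  sunlight : ∀ j, x.bE j ≤ min (p.bS x j + p.EhS j - p.EdS j - p.Pc * x.tauS j) p.Bmax
  no_discharge : ∀ j, 0 ≤ p.EhS j - p.EdS j - p.Pc * x.tauS j
  dod_start : ∀ j, x.dE j = (p.Bmax - x.bE j) / p.Bmax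
  dod_end : ∀ j, x.dHat j = (p.Bmax - x.bSnext j) / p.Bmax
  total_time : ∑ j, (x.tauS j + x.tauE j) = p.Tc
  time_sun : ∀ j, 0 ≤ x.tauS j ∧ x.tauS j ≤ p.tE j - p.tS j.castSucc
  time_ecl : ∀ j, 0 ≤ x.tauE j ∧ x.tauE j ≤ p.tS j.succ - p.tE j
  level_end : ∀ j, 0 ≤ x.bSnext j ∧ x.bSnext j ≤ p.Bmax
  level_start : ∀ j, 0 ≤ x.bE j ∧ x.bE j ≤ p.Bmax

/-- The feasible set of the relaxed problem. -/
def feasibleSet (p : SatData J) : Set (SatVar J) := {x | p.IsFeasible x}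

/-- The convex part of the objective. -/
def u (p : SatData J) (x : SatVar J) : ℝ := ∑ j, cycleLife p.a (x.dHat j)

/-- The convex function that is subtracted in the objective. -/
def v (p : SatData J) (x : SatVar J) : ℝ := ∑ j, cycleLife p.a (x.dE j)

/-- The objective of the relaxed problem, a difference of convex functions. -/
def objective (p : SatData J) (x : SatVar J) : ℝ := p.u x - p.v x

/-- The surrogate objective obtained from the iterate `z`: `u(x) - dᵀ ∇v(d_z)`. -/
def surrogate (p : SatData J) (z x : SatVar J) : ℝ :=
  p.u x - ∑ j, x.dE j * cycleLifeSlope p.a (z.dE j)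

/-- `x` is an optimal point of the surrogate problem built at `z`. -/
def IsSurrogateOptimal (p : SatData J) (z x : SatVar J) : Prop :=
  x ∈ p.feasibleSet ∧ ∀ y ∈ p.feasibleSet, p.surrogate z x ≤ p.surrogate z y

/-- First-order stationarity for minimizing the objective over the (convex) feasible set. -/
def IsStationary (p : SatData J) (x : SatVar J) : Prop :=
  x ∈ p.feasibleSet ∧ ∀ y ∈ p.feasibleSet, 0 ≤ fderiv ℝ p.objective x (y - x)

/-- `x 0, x 1, …` is a run of the concave-convex procedure with tolerance `ε` that performs exactly
`N` iterations (`N = ⊤` if it never stops): each iteration replaces the iterate by some optimal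
point of the surrogate problem, and an iteration is the last one exactly when the stopping test
holds after it. The entries `x l` with `l > N` play no role. -/
structure IsRun (p : SatData J) (ε : ℝ) (x : ℕ → SatVar J) (N : ℕ∞) : Prop where
  init : x 0 ∈ p.feasibleSet
  one_le : 1 ≤ N
  step : ∀ l : ℕ, (l : ℕ∞) < N → p.IsSurrogateOptimal (x l) (x (l + 1))
  stop_iff : ∀ l : ℕ, (l : ℕ∞) < N →
    (‖(x (l + 1)).dVec - (x l).dVec‖ ≤ ε ↔ N = ((l + 1 : ℕ) : ℕ∞))

end SatData

/-- Convergence of the sequence `x 0, …, x N`: to its last member if it is finite, in the usual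
sense if it is infinite. -/
def RunConvergesTo {J : ℕ} (x : ℕ → SatVar J) (N : ℕ∞) (xbar : SatVar J) : Prop :=
  (∃ L : ℕ, N = (L : ℕ∞) ∧ xbar = x L) ∨ (N = ⊤ ∧ Tendsto x atTop (𝓝 xbar))

end

/-! Battery levels and depths of discharge determine each other, so a schedule can be read as a
chain of depths in temporal order. An eclipse increment fixes the training time of that eclipse. A
sunlight increment only bounds its training time through `min (inc y i) (hi i)`, because surplus
energy may be wasted. The problem becomes one of choosing depths that buy at least the time `T`
(`Chain`, `exists_isFeasible_depths`, `IsSurrogateOptimal.isSurrogateCrit`).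

The crux is convergence of the whole sequence. `cycleLife` is strongly convex on the unit interval,
so each step lowers the objective by a multiple of the squared step length
(`IsSurrogateCrit.decrease`). Finite length then follows (`tendsto_zero_of_descent`) from a
Łojasiewicz inequality with exponent 1/2 at a cluster point `ys`: almost critical points near `ys`
exceed its value by at most a constant times the squared criticality error
(`IsAdm.exists_obj_sub_le`).

For that inequality, note that a bound active at a nearby `y` is active at `ys`, so tight steps
transmit the displacement `y - ys` unchanged. The displacement is therefore constant on groups that
start at a hinge, a step whose increment is strictly between its bounds. Between two hinges a shift
is neutral in time, so the gradient sum vanishes, and along the shift the objective has derivative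
exponential times affine, whence exponent 1/2 (`eventually_mul_sum_le_sq`). From a hinge to a cut (a
step that wastes energy) or to the end of the chain, the gradient sum is a common price `t` of time
and the objective is strongly convex along the shift. Behind a cut the depths can be lowered for
free, so eclipse increments almost vanish there. Up to quadratic errors the total is `t` times the
difference of the times bought, which is zero because both points buy exactly `T`.

The exceptional case is a very small price of time. Then the point is a global minimizer
(`exists_isGlobalMin_of_cheapTime`), which is impossible while the sequence keeps moving. Otherwise
the time constraint is active; this also makes the training times functions of the depths
(`IsFeasible.tauS_eq`), so the schedules converge too.

Stationarity holds because surrogate optimality is a closed relation and a fixed point in the depths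
is stationary. By compactness approximate fixed points are near stationary points
(`exists_infDist_lt`), and `accuracy` is the worst such distance plus `2 * ε`. -/

/-! ### Calculus of the cycle life function on the unit interval. -/

/-- The second derivative of `cycleLife a`. -/
noncomputable def cycleLifeCurv (a d : ℝ) : ℝ :=
  (10 : ℝ) ^ (a * (d - 1)) * (2 * (a * Real.log 10) + (a * Real.log 10) ^ 2 * d)

theorem log_ten_pos : 0 < Real.log 10 := Real.log_pos (by norm_num)

theorem hasDerivAt_ten_rpow (a d : ℝ) :
    HasDerivAt (fun y : ℝ => (10 : ℝ) ^ (a * (y - 1)))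
      ((10 : ℝ) ^ (a * (d - 1)) * (a * Real.log 10)) d := by
  have h1 : HasDerivAt (fun y : ℝ => a * (y - 1)) a d := by
    simpa using ((hasDerivAt_id d).sub_const 1).const_mul a
  refine (h1.const_rpow (a := (10 : ℝ)) (by norm_num)).congr_deriv ?_
  ring

theorem hasDerivAt_cycleLifeSlope (a d : ℝ) :
    HasDerivAt (cycleLifeSlope a) (cycleLifeCurv a d) d := by
  have h1 : HasDerivAt (fun y : ℝ => 1 + a * y * Real.log 10) (a * Real.log 10) d := by
    simpa using (((hasDerivAt_id d).const_mul a).mul_const (Real.log 10)).const_add 1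
  refine ((hasDerivAt_ten_rpow a d).mul h1).congr_deriv ?_
  simp only [cycleLifeCurv]
  ring

theorem hasDerivAt_cycleLifeCurv (a d : ℝ) :
    HasDerivAt (cycleLifeCurv a) ((10 : ℝ) ^ (a * (d - 1)) *
      (3 * (a * Real.log 10) ^ 2 + (a * Real.log 10) ^ 3 * d)) d := by
  have h1 : HasDerivAt (fun y : ℝ => 2 * (a * Real.log 10) + (a * Real.log 10) ^ 2 * y)
      ((a * Real.log 10) ^ 2) d := by
    simpa using ((hasDerivAt_id d).const_mul ((a * Real.log 10) ^ 2)).const_add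
      (2 * (a * Real.log 10))
  refine ((hasDerivAt_ten_rpow a d).mul h1).congr_deriv ?_
  ring

theorem ten_rpow_le_one {a d : ℝ} (ha : 0 < a) (hd : d ≤ 1) : (10 : ℝ) ^ (a * (d - 1)) ≤ 1 :=
  Real.rpow_le_one_of_one_le_of_nonpos (by norm_num)
    (mul_nonpos_of_nonneg_of_nonpos ha.le (by linarith))

theorem le_ten_rpow {a d : ℝ} (ha : 0 < a) (hd : 0 ≤ d) :
    (10 : ℝ) ^ (-a) ≤ (10 : ℝ) ^ (a * (d - 1)) :=
  Real.rpow_le_rpow_of_exponent_le (by norm_num) (by nlinarith)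

/-- A function whose derivative is dominated by `c` on an interval grows at most linearly. -/
theorem sub_le_of_deriv_le {f f' : ℝ → ℝ} {l u c : ℝ} (hf : ∀ x, HasDerivAt f (f' x) x)
    (h : ∀ x, l ≤ x → x ≤ u → f' x ≤ c) {x y : ℝ} (hx : l ≤ x) (hxy : x ≤ y) (hy : y ≤ u) :
    f y - f x ≤ c * (y - x) := by
  refine (convex_Icc l u).image_sub_le_mul_sub_of_deriv_le
    (fun z _ => (hf z).continuousAt.continuousWithinAt)
    (fun z _ => (hf z).differentiableAt.differentiableWithinAt) ?_ x ⟨hx, hxy.trans hy⟩ y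
    ⟨hx.trans hxy, hy⟩ hxy
  intro z hz
  have hz' := interior_subset hz
  rw [(hf z).deriv]
  exact h z hz'.1 hz'.2

theorem le_sub_of_le_deriv {f f' : ℝ → ℝ} {l u c : ℝ} (hf : ∀ x, HasDerivAt f (f' x) x)
    (h : ∀ x, l ≤ x → x ≤ u → c ≤ f' x) {x y : ℝ} (hx : l ≤ x) (hxy : x ≤ y) (hy : y ≤ u) :
    c * (y - x) ≤ f y - f x := by
  have := sub_le_of_deriv_le (f := fun z => -f z) (f' := fun z => -f' z) (c := -c)
    (fun z => (hf z).neg) (fun z h1 h2 => neg_le_neg (h z h1 h2)) hx hxy hy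
  beta_reduce at this
  linarith

/-- Quadratic growth above the tangent for functions with a strongly increasing derivative. -/
theorem tangent_add_sq_le {f f' : ℝ → ℝ} {l u c : ℝ} (hf : ∀ x, HasDerivAt f (f' x) x)
    (h : ∀ x y, l ≤ x → x ≤ y → y ≤ u → c * (y - x) ≤ f' y - f' x) {x y : ℝ}
    (hlx : l ≤ x) (hxu : x ≤ u) (hly : l ≤ y) (hyu : y ≤ u) :
    f x + f' x * (y - x) + c / 2 * (y - x) ^ 2 ≤ f y := by
  -- The remainder after subtracting the tangent line and the quadratic is antitone to the left of
  -- `x` and monotone to its right.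
  have hd : ∀ s, HasDerivAt (fun s => f s - f' x * s - c / 2 * (s - x) ^ 2)
      (f' s - f' x - c * (s - x)) s := by
    intro s
    have h1 : HasDerivAt (fun s : ℝ => f' x * s) (f' x) s := by
      simpa using (hasDerivAt_id s).const_mul (f' x)
    have h2 : HasDerivAt (fun s : ℝ => c / 2 * (s - x) ^ 2) (c * (s - x)) s := by
      refine ((((hasDerivAt_id s).sub_const x).pow 2).const_mul (c / 2)).congr_deriv ?_
      simp
      ring
    exact ((hf s).sub h1).sub h2
  rcases le_total x y with hxy | hxy
  · have := le_sub_of_le_deriv (l := x) (u := y) (c := 0) hd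
      (fun s h1 h2 => by linarith [h x s hlx h1 (h2.trans hyu)]) le_rfl hxy le_rfl
    simp only [sub_self] at this
    nlinarith
  · have := sub_le_of_deriv_le (l := y) (u := x) (c := 0) hd
      (fun s h1 h2 => by linarith [h s x (hly.trans h1) h2 hxu]) le_rfl hxy le_rfl
    simp only [sub_self] at this
    nlinarith

section bounds

variable {a : ℝ}

/-- A lower bound for the second derivative of `cycleLife a` on the unit interval. -/
noncomputable def curvLower (a : ℝ) : ℝ := (10 : ℝ) ^ (-a) * (2 * (a * Real.log 10))

/-- An upper bound for the second derivative of `cycleLife a` on the unit interval. -/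
noncomputable def curvUpper (a : ℝ) : ℝ := 2 * (a * Real.log 10) + (a * Real.log 10) ^ 2

/-- A lower bound for the third derivative of `cycleLife a` on the unit interval. -/
noncomputable def jerkLower (a : ℝ) : ℝ := (10 : ℝ) ^ (-a) * (3 * (a * Real.log 10) ^ 2)

theorem curvLower_pos (ha : 0 < a) : 0 < curvLower a := by
  have := log_ten_pos
  unfold curvLower
  positivity

theorem curvUpper_pos (ha : 0 < a) : 0 < curvUpper a := by
  have := log_ten_pos
  unfold curvUpper
  positivity

theorem jerkLower_pos (ha : 0 < a) : 0 < jerkLower a := by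
  have := log_ten_pos
  unfold jerkLower
  positivity

theorem le_slope_sub (ha : 0 < a) {x y : ℝ} (hx : 0 ≤ x) (hxy : x ≤ y) (hy : y ≤ 1) :
    curvLower a * (y - x) ≤ cycleLifeSlope a y - cycleLifeSlope a x := by
  have hk : 0 < a * Real.log 10 := mul_pos ha log_ten_pos
  refine le_sub_of_le_deriv (hasDerivAt_cycleLifeSlope a) (l := 0) (u := 1) ?_ hx hxy hy
  intro z h0 _
  refine mul_le_mul (le_ten_rpow ha h0) ?_ (by positivity) (by positivity)
  have : 0 ≤ (a * Real.log 10) ^ 2 * z := by positivity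
  linarith

theorem slope_sub_le (ha : 0 < a) {x y : ℝ} (hx : 0 ≤ x) (hxy : x ≤ y) (hy : y ≤ 1) :
    cycleLifeSlope a y - cycleLifeSlope a x ≤ curvUpper a * (y - x) := by
  have hk : 0 < a * Real.log 10 := mul_pos ha log_ten_pos
  refine sub_le_of_deriv_le (hasDerivAt_cycleLifeSlope a) (l := 0) (u := 1) ?_ hx hxy hy
  intro z h0 h1
  unfold cycleLifeCurv curvUpper
  have h2 : 0 ≤ (a * Real.log 10) ^ 2 * z := by positivity
  have h3 : (a * Real.log 10) ^ 2 * z ≤ (a * Real.log 10) ^ 2 := by nlinarith [sq_nonneg (a * Real.log 10)]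
  calc _ ≤ 1 * (2 * (a * Real.log 10) + (a * Real.log 10) ^ 2 * z) :=
        mul_le_mul_of_nonneg_right (ten_rpow_le_one ha h1) (by linarith)
    _ ≤ _ := by linarith

theorem abs_slope_sub_le (ha : 0 < a) {x y : ℝ} (hx0 : 0 ≤ x) (hx1 : x ≤ 1) (hy0 : 0 ≤ y)
    (hy1 : y ≤ 1) :
    |cycleLifeSlope a y - cycleLifeSlope a x| ≤ curvUpper a * |y - x| := by
  rcases le_total x y with h | h
  · rw [abs_of_nonneg (sub_nonneg.2 h), abs_of_nonneg]
    · exact slope_sub_le ha hx0 h hy1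
    · exact le_trans (mul_nonneg (curvLower_pos ha).le (sub_nonneg.2 h)) (le_slope_sub ha hx0 h hy1)
  · rw [abs_sub_comm, abs_sub_comm y, abs_of_nonneg (sub_nonneg.2 h), abs_of_nonneg]
    · exact slope_sub_le ha hy0 h hx1
    · exact le_trans (mul_nonneg (curvLower_pos ha).le (sub_nonneg.2 h)) (le_slope_sub ha hy0 h hx1)

theorem slope_mono (ha : 0 < a) {x y : ℝ} (hx : 0 ≤ x) (hxy : x ≤ y) (hy : y ≤ 1) :
    cycleLifeSlope a x ≤ cycleLifeSlope a y := by
  have := le_slope_sub ha hx hxy hy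
  have := mul_nonneg (curvLower_pos ha).le (sub_nonneg.2 hxy)
  linarith

theorem slope_pos (ha : 0 < a) {x : ℝ} (hx : 0 ≤ x) : 0 < cycleLifeSlope a x := by
  have := log_ten_pos
  unfold cycleLifeSlope
  positivity

theorem tangent_add_sq_le_cycleLife (ha : 0 < a) {x y : ℝ} (hx0 : 0 ≤ x) (hx1 : x ≤ 1)
    (hy0 : 0 ≤ y) (hy1 : y ≤ 1) :
    cycleLife a x + cycleLifeSlope a x * (y - x) + curvLower a / 2 * (y - x) ^ 2
      ≤ cycleLife a y :=
  tangent_add_sq_le (hasDerivAt_cycleLife a) (fun _ _ h1 h2 h3 => le_slope_sub ha h1 h2 h3)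
    hx0 hx1 hy0 hy1

theorem le_curv_sub (ha : 0 < a) {x y : ℝ} (hx : 0 ≤ x) (hxy : x ≤ y) (hy : y ≤ 1) :
    jerkLower a * (y - x) ≤ cycleLifeCurv a y - cycleLifeCurv a x := by
  have hk : 0 < a * Real.log 10 := mul_pos ha log_ten_pos
  refine le_sub_of_le_deriv (hasDerivAt_cycleLifeCurv a) (l := 0) (u := 1) ?_ hx hxy hy
  intro z h0 _
  refine mul_le_mul (le_ten_rpow ha h0) ?_ (by positivity) (by positivity)
  have : 0 ≤ (a * Real.log 10) ^ 3 * z := by positivity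
  linarith

/-- The life consumed between two depths at fixed distance is a strongly convex function of
the depth. -/
theorem tangent_add_sq_le_cycleLife_sub (ha : 0 < a) {x y η : ℝ} (hη : 0 ≤ η) (hx0 : 0 ≤ x)
    (hx1 : x + η ≤ 1) (hy0 : 0 ≤ y) (hy1 : y + η ≤ 1) :
    cycleLife a (x + η) - cycleLife a x
      + (cycleLifeSlope a (x + η) - cycleLifeSlope a x) * (y - x)
      + jerkLower a * η / 2 * (y - x) ^ 2 ≤ cycleLife a (y + η) - cycleLife a y := by
  refine tangent_add_sq_le (f := fun s => cycleLife a (s + η) - cycleLife a s)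
    (f' := fun s => cycleLifeSlope a (s + η) - cycleLifeSlope a s) (l := 0) (u := 1 - η)
    (fun s => ((hasDerivAt_cycleLife a (s + η)).comp_add_const s η).sub
      (hasDerivAt_cycleLife a s)) ?_ hx0 (by linarith) hy0 (by linarith)
  intro s t hs hst ht
  -- The growth of the second derivative over a distance `η` bounds the derivative of the slope
  -- difference below by `jerkLower a * η`.
  have := le_sub_of_le_deriv (f := fun s => cycleLifeSlope a (s + η) - cycleLifeSlope a s)
    (l := 0) (u := 1 - η) (c := jerkLower a * η)
    (fun s => ((hasDerivAt_cycleLifeSlope a (s + η)).comp_add_const s η).sub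
      (hasDerivAt_cycleLifeSlope a s))
    (fun z h1 h2 => by
      have := le_curv_sub ha h1 (show z ≤ z + η by linarith) (by linarith)
      simpa using this) hs hst ht
  exact this

theorem cycleLife_sub_mono (ha : 0 < a) {x y η : ℝ} (hη : 0 ≤ η) (hx0 : 0 ≤ x)
    (hxy : x ≤ y) (hy1 : y + η ≤ 1) :
    cycleLife a (x + η) - cycleLife a x ≤ cycleLife a (y + η) - cycleLife a y := by
  have h1 := tangent_add_sq_le_cycleLife_sub ha hη hx0 (by linarith) (hx0.trans hxy) hy1
  have h2 := slope_mono ha hx0 (show x ≤ x + η by linarith) (by linarith)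
  have h3 : 0 ≤ jerkLower a * η / 2 * (y - x) ^ 2 := by have := jerkLower_pos ha; positivity
  have h4 := mul_nonneg (sub_nonneg.2 h2) (sub_nonneg.2 hxy)
  linarith

theorem cycleLife_mono (ha : 0 < a) {x y : ℝ} (hx : 0 ≤ x) (hxy : x ≤ y) (hy : y ≤ 1) :
    cycleLife a x ≤ cycleLife a y := by
  have h1 := tangent_add_sq_le_cycleLife ha hx (hxy.trans hy) (hx.trans hxy) hy
  have h2 := mul_nonneg (slope_pos ha hx).le (sub_nonneg.2 hxy)
  have h3 : 0 ≤ curvLower a / 2 * (y - x) ^ 2 := by have := curvLower_pos ha; positivity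
  linarith

theorem cycleLife_sub_le (ha : 0 < a) {x y : ℝ} (hx : 0 ≤ x) (hx1 : x ≤ 1) (hy0 : 0 ≤ y)
    (hy : y ≤ 1) :
    cycleLife a y - cycleLife a x ≤ cycleLifeSlope a y * (y - x) := by
  have h1 := tangent_add_sq_le_cycleLife ha hy0 hy hx hx1
  have h3 : 0 ≤ curvLower a / 2 * (x - y) ^ 2 := by have := curvLower_pos ha; positivity
  linarith

theorem continuous_cycleLife (a : ℝ) : Continuous (cycleLife a) :=
  continuous_iff_continuousAt.2 fun x => (hasDerivAt_cycleLife a x).continuousAt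

theorem continuous_cycleLifeSlope (a : ℝ) : Continuous (cycleLifeSlope a) :=
  continuous_iff_continuousAt.2 fun x => (hasDerivAt_cycleLifeSlope a x).continuousAt

end bounds

/-! ### The one-variable Łojasiewicz inequality. -/

/-- A translation by `q` multiplies every exponential by the same factor, so the derivative of a
signed sum is an exponential times an affine function. Its zeros are simple unless it vanishes
identically, which is why the exponent is 1/2. -/
theorem sum_slope_add_eq {ι : Type*} (a : ℝ) (s : Finset ι) (ε b : ι → ℝ) (q : ℝ) :
    ∑ i ∈ s, ε i * cycleLifeSlope a (b i + q) = (10 : ℝ) ^ (a * q) *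
      ((∑ i ∈ s, ε i * cycleLifeSlope a (b i)) +
        (a * Real.log 10 * ∑ i ∈ s, ε i * (10 : ℝ) ^ (a * (b i - 1))) * q) := by
  rw [Finset.mul_sum, Finset.sum_mul, ← Finset.sum_add_distrib, Finset.mul_sum]
  refine Finset.sum_congr rfl fun i _ => ?_
  unfold cycleLifeSlope
  have : (10 : ℝ) ^ (a * (b i + q - 1)) = (10 : ℝ) ^ (a * q) * (10 : ℝ) ^ (a * (b i - 1)) := by
    rw [← Real.rpow_add (by norm_num)]
    congr 1
    ring
  rw [this]
  ring

/-- Łojasiewicz inequality with exponent `1/2` for signed sums of translates of `cycleLife a`. -/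
theorem eventually_mul_sum_le_sq {ι : Type*} (a : ℝ) (s : Finset ι) (ε b : ι → ℝ) :
    ∀ᶠ γ in 𝓝[>] (0 : ℝ), ∀ q : ℝ, |q| ≤ γ →
      γ * ∑ i ∈ s, ε i * (cycleLife a (b i + q) - cycleLife a (b i))
        ≤ (∑ i ∈ s, ε i * cycleLifeSlope a (b i + q)) ^ 2 := by
  set S : ℝ → ℝ := fun q => ∑ i ∈ s, ε i * (cycleLife a (b i + q) - cycleLife a (b i)) with hS
  set S' : ℝ → ℝ := fun q => ∑ i ∈ s, ε i * cycleLifeSlope a (b i + q) with hS'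
  have hd : ∀ q, HasDerivAt S (S' q) q := by
    intro q
    refine HasDerivAt.fun_sum fun i _ => ?_
    exact (((hasDerivAt_cycleLife a (b i + q)).comp_const_add (b i) q).sub_const _).const_mul _
  have hS0 : S 0 = 0 := by simp [hS]
  set A := ∑ i ∈ s, ε i * cycleLifeSlope a (b i) with hA
  set B := a * Real.log 10 * ∑ i ∈ s, ε i * (10 : ℝ) ^ (a * (b i - 1)) with hB
  have hform : ∀ q, S' q = (10 : ℝ) ^ (a * q) * (A + B * q) := fun q => sum_slope_add_eq a s ε b q
  have hball : ∀ P : ℝ → Prop, (∀ᶠ q in 𝓝 (0 : ℝ), P q) →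
      ∀ᶠ γ in 𝓝[>] (0 : ℝ), ∀ q, |q| ≤ γ → P q := by
    intro P hP
    obtain ⟨r, hr, h⟩ := Metric.eventually_nhds_iff.1 hP
    filter_upwards [Ioo_mem_nhdsGT hr] with γ hγ q hq
    exact h (by rw [Real.dist_eq, sub_zero]; exact hq.trans_lt hγ.2)
  have hcS : Continuous S := continuous_iff_continuousAt.2 fun q => (hd q).continuousAt
  have hcS' : Continuous S' := by
    refine continuous_finsetSum _ fun i _ => continuous_const.mul ?_
    exact (continuous_cycleLifeSlope a).comp (continuous_const.add continuous_id)
  -- If `A ≠ 0`, the slope stays away from zero while the sum is small. If only `A` vanishes, the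
  -- sum is `O(q ^ 2)` and the slope is comparable to `|B| * |q|`. If both vanish, the sum is
  -- constant.
  by_cases hA0 : A = 0
  · by_cases hB0 : B = 0
    · have hz : ∀ q, S' q = 0 := fun q => by rw [hform, hA0, hB0]; ring
      have hz2 : ∀ q, S q = 0 := by
        intro q
        have := is_const_of_deriv_eq_zero (f := S) (fun q => (hd q).differentiableAt)
          (fun q => by rw [(hd q).deriv, hz]) q 0
        rw [this, hS0]
      filter_upwards with γ q _
      show γ * S q ≤ S' q ^ 2
      rw [hz, hz2]
      simp
    · have hBpos : 0 < |B| := abs_pos.2 hB0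
      have hev : ∀ᶠ q in 𝓝 (0 : ℝ), (10 : ℝ) ^ (a * q) < 2 ∧ (1 / 2 : ℝ) < (10 : ℝ) ^ (a * q) := by
        have hc : Continuous fun q : ℝ => (10 : ℝ) ^ (a * q) :=
          Continuous.rpow continuous_const (continuous_const.mul continuous_id) (fun _ => by norm_num)
        refine (hc.continuousAt.eventually (gt_mem_nhds ?_)).and
          (hc.continuousAt.eventually (lt_mem_nhds ?_)) <;> norm_num
      filter_upwards [hball _ hev, Ioo_mem_nhdsGT (show (0 : ℝ) < |B| / 8 by positivity)] with γ h hγ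
      intro q hq
      have hlip : |S q| ≤ 2 * |B| * |q| * |q| := by
        have := (convex_Icc (-|q|) |q|).norm_image_sub_le_of_norm_hasDerivWithin_le
          (f := S) (f' := S') (C := 2 * |B| * |q|) (fun x _ => (hd x).hasDerivWithinAt) ?_
          (x := 0) (y := q) (by simp) (by simp [neg_abs_le, le_abs_self])
        · simpa [hS0] using this
        · intro x hx
          have hx' : |x| ≤ |q| := abs_le.2 hx
          rw [hform, hA0, zero_add, Real.norm_eq_abs, abs_mul, abs_mul,
            abs_of_pos (by positivity : (0 : ℝ) < (10 : ℝ) ^ (a * x))]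
          have := (h x (hx'.trans hq)).1.le
          calc _ ≤ 2 * (|B| * |q|) := by gcongr
            _ = _ := by ring
      show γ * S q ≤ S' q ^ 2
      have h2 : S' q ^ 2 = ((10 : ℝ) ^ (a * q)) ^ 2 * (|B| ^ 2 * |q| ^ 2) := by
        rw [hform, hA0, sq_abs, sq_abs]
        ring
      rw [h2]
      have h3 : (1 / 4 : ℝ) ≤ ((10 : ℝ) ^ (a * q)) ^ 2 := by
        nlinarith [(h q hq).2]
      calc γ * S q ≤ γ * |S q| := mul_le_mul_of_nonneg_left (le_abs_self _) hγ.1.le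
        _ ≤ |B| / 8 * (2 * |B| * |q| * |q|) :=
            mul_le_mul hγ.2.le hlip (abs_nonneg _) (by positivity)
        _ = 1 / 4 * (|B| ^ 2 * |q| ^ 2) := by ring
        _ ≤ _ := mul_le_mul_of_nonneg_right h3 (by positivity)
  · have hA2 : 0 < A ^ 2 / 2 := by positivity
    have h0 : S' 0 ^ 2 = A ^ 2 := by rw [hform]; simp
    have e1 : ∀ᶠ q in 𝓝 (0 : ℝ), A ^ 2 / 2 < S' q ^ 2 :=
      ((hcS'.pow 2).continuousAt (x := (0 : ℝ))).eventually (lt_mem_nhds (by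
        simp only [Pi.pow_apply]; rw [h0]; linarith))
    have e2 : ∀ᶠ q in 𝓝 (0 : ℝ), S q < A ^ 2 / 2 :=
      (hcS.continuousAt (x := (0 : ℝ))).eventually (gt_mem_nhds (by rw [hS0]; exact hA2))
    filter_upwards [hball _ (e1.and e2), Ioo_mem_nhdsGT (zero_lt_one' ℝ)] with γ h hγ q hq
    obtain ⟨h1, h2⟩ := h q hq
    show γ * S q ≤ S' q ^ 2
    rcases le_total (S q) 0 with h3 | h3
    · exact (mul_nonpos_of_nonneg_of_nonpos hγ.1.le h3).trans (sq_nonneg _)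
    · nlinarith [hγ.1, hγ.2]

/-! ### Chains of depths: the problem without schedules. -/

/-- A chain of depths `y 0, y 1, …, y n` with `n = 2 * J`, whose increments buy time. Steps with
even index are the sunlight periods, steps with odd index the eclipses. -/
structure Chain where
  /-- number of periods -/
  J : ℕ
  /-- battery constant -/
  a : ℝ
  /-- initial depth -/
  base : ℝ
  /-- least increments -/
  lo : ℕ → ℝ
  /-- increments from which on no more time is gained -/
  hi : ℕ → ℝ
  /-- the time needed -/
  T : ℝ
  a_pos : 0 < a
  lo_nonneg : ∀ i < 2 * J, i % 2 = 1 → 0 ≤ lo i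
  lo_le_hi : ∀ i < 2 * J, lo i ≤ hi i

/-- The increment of a sequence. -/
def inc (y : ℕ → ℝ) (i : ℕ) : ℝ := y (i + 1) - y i

/-- Add `τ` to the entries with index in `(p, r]`. -/
noncomputable def bump (y : ℕ → ℝ) (p r : ℕ) (τ : ℝ) (i : ℕ) : ℝ :=
  y i + if p < i ∧ i ≤ r then τ else 0

theorem sum_Ico_two_mul {M : Type*} [AddCommMonoid M] (h : ℕ → M) {α β : ℕ} (hab : α ≤ β) :
    ∑ i ∈ Finset.Ico (2 * α) (2 * β), h i = ∑ j ∈ Finset.Ico α β, (h (2 * j) + h (2 * j + 1)) := by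
  induction β, hab using Nat.le_induction with
  | base => simp
  | succ β hb ih =>
    rw [Finset.sum_Ico_succ_top hb, ← ih, show 2 * (β + 1) = 2 * β + 1 + 1 by ring,
      Finset.sum_Ico_succ_top (by omega), Finset.sum_Ico_succ_top (by omega), add_assoc]

theorem sum_range_two_mul {M : Type*} [AddCommMonoid M] (h : ℕ → M) (β : ℕ) :
    ∑ i ∈ Finset.range (2 * β), h i = ∑ j ∈ Finset.range β, (h (2 * j) + h (2 * j + 1)) := by
  have := sum_Ico_two_mul h (Nat.zero_le β)
  simpa using this

namespace Chain

variable (c : Chain)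

/-- The time bought by a sequence. -/
noncomputable def time (y : ℕ → ℝ) : ℝ :=
  ∑ i ∈ Finset.range (2 * c.J), (min (inc y i) (c.hi i) - c.lo i)

/-- All constraints but the one on the total time. -/
structure IsAdm (y : ℕ → ℝ) : Prop where
  base : y 0 = c.base
  lo : ∀ i < 2 * c.J, c.lo i ≤ inc y i
  hi : ∀ i < 2 * c.J, i % 2 = 1 → inc y i ≤ c.hi i
  nonneg : ∀ i < 2 * c.J, 0 ≤ y (i + 1)
  le_one : ∀ i < 2 * c.J, y (i + 1) ≤ 1

/-- The value of a linear form at the displacement from `y` to `y'`. -/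
noncomputable def lin (g y y' : ℕ → ℝ) : ℝ :=
  ∑ i ∈ Finset.range (2 * c.J), g (i + 1) * (y' (i + 1) - y (i + 1))

/-- The objective: life consumed at the ends minus life consumed at the starts of eclipses. -/
noncomputable def obj (y : ℕ → ℝ) : ℝ :=
  ∑ i ∈ Finset.range (2 * c.J), (-1) ^ (i + 1) * cycleLife c.a (y (i + 1))

/-- `y` is a critical point up to an error `ω`, with `g` the perturbed gradient. -/
structure NearCrit (y g : ℕ → ℝ) (ω : ℝ) : Prop where
  adm : c.IsAdm y
  time_ge : c.T ≤ c.time y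
  vi : ∀ y', c.IsAdm y' → c.T ≤ c.time y' → 0 ≤ c.lin g y y'
  ω_nonneg : 0 ≤ ω
  odd_step : ∀ i < 2 * c.J, i % 2 = 1 → g (i + 1) = cycleLifeSlope c.a (y (i + 1))
  even_step : ∀ i < 2 * c.J, i % 2 = 0 → |g (i + 1) + cycleLifeSlope c.a (y (i + 1))| ≤ ω

/-- `y` minimizes the objective. -/
def IsGlobalMin (y : ℕ → ℝ) : Prop := ∀ y', c.IsAdm y' → c.obj y ≤ c.obj y'

/-- Time costs at most `p` per unit. -/
def CheapTime (y g : ℕ → ℝ) (p : ℝ) : Prop :=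
  ∀ y' ε, 0 ≤ ε → c.IsAdm y' → c.T - ε ≤ c.time y' → -(p * ε) ≤ c.lin g y y'

/-- All positive slacks of `y` are at least `γ`. -/
structure Gap (y : ℕ → ℝ) (γ : ℝ) : Prop where
  pos : 0 < γ
  nonneg : ∀ i < 2 * c.J, 0 < y (i + 1) → γ ≤ y (i + 1)
  le_one : ∀ i < 2 * c.J, y (i + 1) < 1 → γ ≤ 1 - y (i + 1)
  lo : ∀ i < 2 * c.J, c.lo i < inc y i → γ ≤ inc y i - c.lo i
  hi : ∀ i < 2 * c.J, inc y i < c.hi i → γ ≤ c.hi i - inc y i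
  hi' : ∀ i < 2 * c.J, c.hi i < inc y i → γ ≤ inc y i - c.hi i

theorem eventually_le_of_pos (n : ℕ) (v : ℕ → ℝ) :
    ∀ᶠ γ in 𝓝[>] (0 : ℝ), ∀ i < n, 0 < v i → γ ≤ v i := by
  have : ∀ i ∈ Finset.range n, ∀ᶠ γ in 𝓝[>] (0 : ℝ), 0 < v i → γ ≤ v i := by
    intro i _
    by_cases h : 0 < v i
    · filter_upwards [Ioo_mem_nhdsGT h] with γ hγ _ using hγ.2.le
    · exact Eventually.of_forall fun γ h' => absurd h' h
  filter_upwards [(Filter.eventually_all_finset _).2 this] with γ h i hi using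
    h i (Finset.mem_range.2 hi)

theorem eventually_gap (y : ℕ → ℝ) : ∀ᶠ γ in 𝓝[>] (0 : ℝ), c.Gap y γ := by
  filter_upwards [self_mem_nhdsWithin, eventually_le_of_pos (2 * c.J) (fun i => y (i + 1)),
    eventually_le_of_pos (2 * c.J) (fun i => 1 - y (i + 1)),
    eventually_le_of_pos (2 * c.J) (fun i => inc y i - c.lo i),
    eventually_le_of_pos (2 * c.J) (fun i => c.hi i - inc y i),
    eventually_le_of_pos (2 * c.J) (fun i => inc y i - c.hi i)] with γ h0 h1 h2 h3 h4 h5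
  exact ⟨h0, h1, fun i hi h => h2 i hi (by linarith), fun i hi h => h3 i hi (by linarith),
    fun i hi h => h4 i hi (by linarith), fun i hi h => h5 i hi (by linarith)⟩

theorem exists_gap (y : ℕ → ℝ) : ∃ γ, c.Gap y γ := (c.eventually_gap y).exists

variable {c}

/-! ### Convex combinations, shifts of groups of depths and the price of time. -/

section mix

variable {y y₁ y₂ g : ℕ → ℝ}

theorem inc_combo (s t : ℝ) (i : ℕ) :
    inc (fun i => s * y₁ i + t * y₂ i) i = s * inc y₁ i + t * inc y₂ i := by
  simp only [inc]; ring

theorem IsAdm.combo {s t : ℝ} (h₁ : c.IsAdm y₁) (h₂ : c.IsAdm y₂) (hs : 0 ≤ s) (ht : 0 ≤ t)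
    (hst : s + t = 1) : c.IsAdm fun i => s * y₁ i + t * y₂ i where
  base := by
    rw [h₁.base, h₂.base, ← add_mul, hst, one_mul]
  lo i hi := by
    rw [inc_combo]
    have := mul_le_mul_of_nonneg_left (h₁.lo i hi) hs
    have := mul_le_mul_of_nonneg_left (h₂.lo i hi) ht
    calc c.lo i = s * c.lo i + t * c.lo i := by rw [← add_mul, hst, one_mul]
      _ ≤ _ := by linarith
  hi i hi h := by
    rw [inc_combo]
    have := mul_le_mul_of_nonneg_left (h₁.hi i hi h) hs
    have := mul_le_mul_of_nonneg_left (h₂.hi i hi h) ht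
    calc _ ≤ s * c.hi i + t * c.hi i := by linarith
      _ = c.hi i := by rw [← add_mul, hst, one_mul]
  nonneg i hi := add_nonneg (mul_nonneg hs (h₁.nonneg i hi)) (mul_nonneg ht (h₂.nonneg i hi))
  le_one i hi := by
    have := mul_le_mul_of_nonneg_left (h₁.le_one i hi) hs
    have := mul_le_mul_of_nonneg_left (h₂.le_one i hi) ht
    linarith

theorem le_time_combo {s t : ℝ} (hs : 0 ≤ s) (ht : 0 ≤ t) (hst : s + t = 1) :
    s * c.time y₁ + t * c.time y₂ ≤ c.time fun i => s * y₁ i + t * y₂ i := by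
  unfold time
  rw [Finset.mul_sum, Finset.mul_sum, ← Finset.sum_add_distrib]
  refine Finset.sum_le_sum fun i _ => ?_
  rw [inc_combo]
  have e : c.lo i = s * c.lo i + t * c.lo i := by rw [← add_mul, hst, one_mul]
  have e' : c.hi i = s * c.hi i + t * c.hi i := by rw [← add_mul, hst, one_mul]
  have h1 : s * min (inc y₁ i) (c.hi i) + t * min (inc y₂ i) (c.hi i)
      ≤ min (s * inc y₁ i + t * inc y₂ i) (c.hi i) := by
    refine le_min ?_ ?_
    · exact add_le_add (mul_le_mul_of_nonneg_left (min_le_left _ _) hs)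
        (mul_le_mul_of_nonneg_left (min_le_left _ _) ht)
    · rw [e']
      nth_rewrite 1 [← e']
      nth_rewrite 1 [← e']
      exact add_le_add (mul_le_mul_of_nonneg_left (min_le_right _ _) hs)
        (mul_le_mul_of_nonneg_left (min_le_right _ _) ht)
  linarith

theorem lin_combo {s t : ℝ} (hst : s + t = 1) :
    (c.lin g y fun i => s * y₁ i + t * y₂ i) = s * c.lin g y y₁ + t * c.lin g y y₂ := by
  unfold lin
  rw [Finset.mul_sum, Finset.mul_sum, ← Finset.sum_add_distrib]
  refine Finset.sum_congr rfl fun i _ => ?_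
  obtain rfl : t = 1 - s := by linarith
  ring

/-- Selling time along one displacement pays for buying it along another one. -/
theorem NearCrit.mix {ω ε₁ ε₂ : ℝ} (h : c.NearCrit y g ω) (h₁ : c.IsAdm y₁) (h₂ : c.IsAdm y₂)
    (hε₁ : 0 < ε₁) (hε₂ : 0 ≤ ε₂) (ht₁ : c.T + ε₁ ≤ c.time y₁) (ht₂ : c.T - ε₂ ≤ c.time y₂) :
    0 ≤ ε₂ * c.lin g y y₁ + ε₁ * c.lin g y y₂ := by
  have hpos : 0 < ε₂ + ε₁ := by linarith
  -- With these weights the surplus `ε₁` and the deficit `ε₂` of time cancel.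
  have hs : 0 ≤ ε₂ / (ε₂ + ε₁) := by positivity
  have ht : 0 ≤ ε₁ / (ε₂ + ε₁) := by positivity
  have hst : ε₂ / (ε₂ + ε₁) + ε₁ / (ε₂ + ε₁) = 1 := by field_simp
  have key := h.vi _ (h₁.combo h₂ hs ht hst) (le_trans ?_ (le_time_combo hs ht hst))
  · rw [lin_combo hst] at key
    have e : ε₂ * c.lin g y y₁ + ε₁ * c.lin g y y₂ = (ε₂ + ε₁) *
      (ε₂ / (ε₂ + ε₁) * c.lin g y y₁ + ε₁ / (ε₂ + ε₁) * c.lin g y y₂) := by field_simp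
    rw [e]
    exact mul_nonneg hpos.le key
  · have h1 := mul_le_mul_of_nonneg_left ht₁ hs
    have h2 := mul_le_mul_of_nonneg_left ht₂ ht
    refine le_trans (le_of_eq ?_) (add_le_add h1 h2)
    field_simp
    ring

/-- One displacement that buys `ε` units at cost at most `p * ε` bounds the price everywhere: by
`mix`, any saving obtained by giving up time is at most what buying it back costs. -/
theorem NearCrit.cheapTime {ω p ε : ℝ} (h : c.NearCrit y g ω) (h₁ : c.IsAdm y₁)
    (hε : 0 < ε) (ht₁ : c.T + ε ≤ c.time y₁) (hp : c.lin g y y₁ ≤ p * ε) :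
    c.CheapTime y g p := by
  intro y' ε' hε' h' ht'
  have h1 := h.mix h₁ h' hε hε' ht₁ ht'
  have h2 := mul_le_mul_of_nonneg_left hp hε'
  have h3 : 0 ≤ ε * (p * ε' + c.lin g y y') := by linarith
  have := nonneg_of_mul_nonneg_right h3 hε
  linarith

end mix

section bump

variable {y g : ℕ → ℝ} {p r : ℕ} {τ : ℝ}

theorem inc_bump_left (hpr : p < r) : inc (bump y p r τ) p = inc y p + τ := by
  simp only [inc, bump]
  rw [if_pos ⟨by omega, by omega⟩, if_neg (by omega)]
  ring

theorem inc_bump_right (hpr : p < r) : inc (bump y p r τ) r = inc y r - τ := by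
  simp only [inc, bump]
  rw [if_neg (by omega), if_pos ⟨by omega, by omega⟩]
  ring

theorem inc_bump_of_ne {i : ℕ} (h1 : i ≠ p) (h2 : i ≠ r) : inc (bump y p r τ) i = inc y i := by
  simp only [inc, bump]
  by_cases h : p < i ∧ i ≤ r
  · rw [if_pos h, if_pos ⟨by omega, by omega⟩]
    ring
  · rw [if_neg h, if_neg (by omega)]
    ring

theorem IsAdm.bump (h : c.IsAdm y) (hpr : p < r) (h1 : c.lo p ≤ inc y p + τ)
    (h2 : p % 2 = 1 → inc y p + τ ≤ c.hi p) (h3 : r < 2 * c.J → c.lo r ≤ inc y r - τ)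
    (h4 : r < 2 * c.J → r % 2 = 1 → inc y r - τ ≤ c.hi r)
    (h5 : ∀ i, p ≤ i → i < r → 0 ≤ y (i + 1) + τ) (h6 : ∀ i, p ≤ i → i < r → y (i + 1) + τ ≤ 1) :
    c.IsAdm (bump y p r τ) where
  base := by simp [_root_.bump, h.base]
  lo i hi := by
    by_cases hp : i = p
    · subst hp; rwa [inc_bump_left hpr]
    by_cases hr : i = r
    · subst hr; rw [inc_bump_right hpr]; exact h3 hi
    rw [inc_bump_of_ne hp hr]
    exact h.lo i hi
  hi i hi ho := by
    by_cases hp : i = p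
    · subst hp; rw [inc_bump_left hpr]; exact h2 ho
    by_cases hr : i = r
    · subst hr; rw [inc_bump_right hpr]; exact h4 hi ho
    rw [inc_bump_of_ne hp hr]
    exact h.hi i hi ho
  nonneg i hi := by
    unfold _root_.bump
    split_ifs with hc
    · exact h5 i (by omega) (by omega)
    · simpa using h.nonneg i hi
  le_one i hi := by
    unfold _root_.bump
    split_ifs with hc
    · exact h6 i (by omega) (by omega)
    · simpa using h.le_one i hi

theorem lin_bump (hr : r ≤ 2 * c.J) :
    c.lin g y (bump y p r τ) = τ * ∑ i ∈ Finset.Ico p r, g (i + 1) := by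
  unfold lin
  have : Finset.Ico p r = (Finset.range (2 * c.J)).filter fun i => p ≤ i ∧ i < r := by
    ext i
    simp only [Finset.mem_Ico, Finset.mem_filter, Finset.mem_range]
    omega
  rw [this, Finset.sum_filter, Finset.mul_sum]
  refine Finset.sum_congr rfl fun i _ => ?_
  unfold bump
  by_cases h : p ≤ i ∧ i < r
  · rw [if_pos h, if_pos (by omega)]; ring
  · rw [if_neg h, if_neg (by omega)]; ring

/-- Only the increments at `p` and `r` change. For `r = 2 * c.J` there is no step `r`, so nothing
may be credited there. -/
theorem add_le_time_bump (hpr : p < r) (hr : r ≤ 2 * c.J) {A B : ℝ}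
    (hA : min (inc y p) (c.hi p) + A ≤ min (inc y p + τ) (c.hi p))
    (hB : r < 2 * c.J → min (inc y r) (c.hi r) + B ≤ min (inc y r - τ) (c.hi r))
    (hB' : r = 2 * c.J → B ≤ 0) :
    c.time y + A + B ≤ c.time (bump y p r τ) := by
  have e1 : A = ∑ i ∈ Finset.range (2 * c.J), if i = p then A else 0 := by
    rw [Finset.sum_ite_eq', if_pos (Finset.mem_range.2 (by omega))]
  have e2 : B ≤ ∑ i ∈ Finset.range (2 * c.J), if i = r then B else 0 := by
    rw [Finset.sum_ite_eq']
    split_ifs with h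
    · exact le_rfl
    · exact hB' (by rw [Finset.mem_range] at h; omega)
  have : c.time y + (∑ i ∈ Finset.range (2 * c.J), if i = p then A else 0)
      + (∑ i ∈ Finset.range (2 * c.J), if i = r then B else 0) ≤ c.time (bump y p r τ) := by
    unfold time
    rw [← Finset.sum_add_distrib, ← Finset.sum_add_distrib]
    refine Finset.sum_le_sum fun i hi => ?_
    by_cases hp : i = p
    · subst hp
      rw [if_pos rfl, if_neg (by omega), inc_bump_left hpr]
      linarith
    by_cases hr : i = r
    · subst hr
      rw [if_pos rfl, if_neg hp, inc_bump_right hpr]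
      linarith [hB (Finset.mem_range.1 hi)]
    rw [inc_bump_of_ne hp hr, if_neg hp, if_neg hr]
    linarith
  linarith

end bump

section adm

variable {y g : ℕ → ℝ} {ω : ℝ}

theorem IsAdm.le_succ (h : c.IsAdm y) {i : ℕ} (hi : i < 2 * c.J) (ho : i % 2 = 1) :
    y i ≤ y (i + 1) := by
  have h1 := h.lo i hi
  have h2 := c.lo_nonneg i hi ho
  simp only [inc] at h1
  linarith

theorem IsAdm.nonneg' (h : c.IsAdm y) {i : ℕ} (hi : i ≤ 2 * c.J) (h0 : i ≠ 0) : 0 ≤ y i := by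
  obtain ⟨k, rfl⟩ := Nat.exists_eq_succ_of_ne_zero h0
  exact h.nonneg k (by omega)

theorem IsAdm.le_one' (h : c.IsAdm y) {i : ℕ} (hi : i ≤ 2 * c.J) (h0 : i ≠ 0) : y i ≤ 1 := by
  obtain ⟨k, rfl⟩ := Nat.exists_eq_succ_of_ne_zero h0
  exact h.le_one k (by omega)

/-- The sum of the perturbed gradient over complete eclipses. -/
theorem NearCrit.sum_pairs_le (h : c.NearCrit y g ω) {α β j : ℕ} (hβ : β ≤ c.J) (hj : α ≤ j)
    (hj' : j < β) :
    cycleLifeSlope c.a (y (2 * j + 2)) - cycleLifeSlope c.a (y (2 * j + 1)) - 2 * c.J * ω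
      ≤ ∑ i ∈ Finset.Ico (2 * α) (2 * β), g (i + 1) := by
  rw [sum_Ico_two_mul _ (by omega : α ≤ β)]
  -- Depth does not decrease during an eclipse, so each pair contributes at least `-ω`; only the
  -- pair `j` keeps its slope difference.
  have key : ∀ k ∈ Finset.Ico α β, (if k = j then
      (cycleLifeSlope c.a (y (2 * j + 2)) - cycleLifeSlope c.a (y (2 * j + 1))) else 0) - ω
      ≤ g (2 * k + 1) + g (2 * k + 1 + 1) := by
    intro k hk
    rw [Finset.mem_Ico] at hk
    have h1 := h.odd_step (2 * k + 1) (by omega) (by omega)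
    have h2 := (abs_le.1 (h.even_step (2 * k) (by omega) (by omega))).1
    have h3 := slope_mono c.a_pos (h.adm.nonneg (2 * k) (by omega))
      (h.adm.le_succ (i := 2 * k + 1) (by omega) (by omega)) (h.adm.le_one (2 * k + 1) (by omega))
    rw [h1]
    split_ifs with hkj
    · subst hkj; linarith
    · linarith
  refine le_trans ?_ (Finset.sum_le_sum key)
  rw [Finset.sum_sub_distrib, Finset.sum_ite_eq', if_pos (Finset.mem_Ico.2 ⟨hj, hj'⟩)]
  simp only [Finset.sum_const, Nat.card_Ico, nsmul_eq_mul]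
  have h1 : ((β - α : ℕ) : ℝ) ≤ 2 * c.J := by
    have : β - α ≤ 2 * c.J := by omega
    exact_mod_cast this
  have := mul_le_mul_of_nonneg_right h1 h.ω_nonneg
  linarith

theorem NearCrit.neg_le_sum_pairs (h : c.NearCrit y g ω) {α β : ℕ} (hβ : β ≤ c.J) :
    -(2 * c.J * ω) ≤ ∑ i ∈ Finset.Ico (2 * α) (2 * β), g (i + 1) := by
  rcases lt_or_ge α β with hab | hab
  · have h1 := h.sum_pairs_le hβ le_rfl hab
    have h3 := slope_mono c.a_pos (h.adm.nonneg (2 * α) (by omega))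
      (h.adm.le_succ (i := 2 * α + 1) (by omega) (by omega)) (h.adm.le_one (2 * α + 1) (by omega))
    simp only [show 2 * α + 1 + 1 = 2 * α + 2 by ring] at h3
    linarith
  · rw [Finset.Ico_eq_empty (by omega)]
    simp only [Finset.sum_empty]
    have := h.ω_nonneg
    have : 0 ≤ 2 * (c.J : ℝ) * ω := by positivity
    linarith

theorem obj_eq_sum_pairs (y : ℕ → ℝ) :
    c.obj y = ∑ j ∈ Finset.range c.J,
      (cycleLife c.a (y (2 * j + 2)) - cycleLife c.a (y (2 * j + 1))) := by
  unfold obj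
  rw [sum_range_two_mul]
  refine Finset.sum_congr rfl fun j _ => ?_
  have h1 : ((-1 : ℝ)) ^ (2 * j + 1) = -1 := Odd.neg_one_pow ⟨j, rfl⟩
  have h2 : ((-1 : ℝ)) ^ (2 * j + 1 + 1) = 1 := Even.neg_one_pow ⟨j + 1, by ring⟩
  rw [h1, h2]
  ring

/-- Training in an eclipse can be given up at the marginal cost of the final depth. -/
theorem CheapTime.slope_le {q : ℝ} (hy : c.IsAdm y) (hT : c.T ≤ c.time y)
    (hc : c.CheapTime y g q) {i : ℕ} (hi : i < 2 * c.J) (ho : i % 2 = 1)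
    (hlt : c.lo i < inc y i) : g (i + 1) ≤ q := by
  set ε := inc y i - c.lo i with hε
  have hpos : 0 < ε := by linarith
  have h0 : 0 ≤ y i := hy.nonneg' (by omega) (by omega)
  -- Only the final depth of this eclipse is lowered. The next step is a sunlight step, if it
  -- exists, and it has no upper bound on its increment.
  have hadm : c.IsAdm (bump y i (i + 1) (-ε)) := by
    refine hy.bump (by omega) (by linarith) (fun _ => ?_) (fun hr => ?_) (fun _ h => by omega)
      (fun k h1 h2 => ?_) (fun k h1 h2 => ?_)
    · linarith [hy.hi i hi ho]
    · linarith [hy.lo (i + 1) hr]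
    · obtain rfl : k = i := by omega
      have := c.lo_nonneg k hi ho
      simp only [inc] at hε
      linarith
    · obtain rfl : k = i := by omega
      linarith [hy.le_one k hi]
  have htime := add_le_time_bump (c := c) (y := y) (τ := -ε) (A := -ε) (B := 0)
    (show i < i + 1 by omega) (by omega)
    (le_min (by linarith [min_le_left (inc y i) (c.hi i)])
      (by linarith [min_le_right (inc y i) (c.hi i)]))
    (fun _ => le_min (by linarith [min_le_left (inc y (i + 1)) (c.hi (i + 1))])
      (by linarith [min_le_right (inc y (i + 1)) (c.hi (i + 1))])) (fun _ => le_rfl)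
  have h1 := hc _ ε hpos.le hadm (by linarith)
  rw [lin_bump (by omega), Nat.Ico_succ_singleton, Finset.sum_singleton] at h1
  have h2 : 0 ≤ ε * (q - g (i + 1)) := by linarith
  have := nonneg_of_mul_nonneg_right h2 hpos
  linarith

end adm

/-! ### Cheap time implies global optimality. -/

/-- If time is cheap at an almost critical point, this point is a global minimizer. -/
theorem exists_isGlobalMin_of_cheapTime (c : Chain) : ∃ p > 0, ∀ y g ω, c.NearCrit y g ω →
    2 * c.J * ω ≤ p → c.CheapTime y g p → c.IsGlobalMin y := by
  -- The first bound makes eclipse training more expensive than time. The second one leaves room for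
  -- the error: `p + 2 * c.J * ω ≤ 2 * p` is at most half of `curvLower c.a * c.lo i`.
  have ev : ∀ᶠ p in 𝓝[>] (0 : ℝ), p < cycleLifeSlope c.a 0 ∧
      ∀ i < 2 * c.J, 0 < curvLower c.a * c.lo i / 4 → p ≤ curvLower c.a * c.lo i / 4 := by
    filter_upwards [Ioo_mem_nhdsGT (slope_pos c.a_pos le_rfl),
      eventually_le_of_pos (2 * c.J) (fun i => curvLower c.a * c.lo i / 4)] with p h1 h2
    exact ⟨h1.2, h2⟩
  obtain ⟨p, ⟨hp1, hp2⟩, hp0⟩ := (ev.and self_mem_nhdsWithin).exists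
  refine ⟨p, hp0, fun y g ω h hω hc y' hy' => ?_⟩
  have hp0 : 0 < p := hp0
  have hm := curvLower_pos c.a_pos
  have htight : ∀ i < 2 * c.J, i % 2 = 1 → inc y i = c.lo i := by
    intro i hi ho
    refine le_antisymm ?_ (h.adm.lo i hi)
    by_contra! hlt
    have h1 := hc.slope_le h.adm h.time_ge hi ho hlt
    rw [h.odd_step i hi ho] at h1
    have := slope_mono c.a_pos le_rfl (h.adm.nonneg i hi) (h.adm.le_one i hi)
    linarith
  -- Eclipses with positive demand start at the least depth that any admissible sequence allows.
  have hle : ∀ j < c.J, 0 < c.lo (2 * j + 1) → y (2 * j + 1) ≤ y' (2 * j + 1) := by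
    intro j hj hlo
    by_contra! hgt
    -- The least such index marks where `y` overtakes `y'`. The step before it exceeds its lower
    -- bound, hence is a sunlight step by `htight`.
    have hex : ∃ a, a ≤ 2 * j + 1 ∧ ∀ i, a ≤ i → i ≤ 2 * j + 1 → y' i < y i :=
      ⟨2 * j + 1, le_rfl, fun i h1 h2 => by obtain rfl : i = 2 * j + 1 := by omega
                                            exact hgt⟩
    classical
    obtain ⟨ha1, ha2⟩ := Nat.find_spec hex
    set a := Nat.find hex with ha
    have ha0 : a ≠ 0 := by
      intro h0
      have := ha2 0 (by omega) (by omega)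
      rw [h.adm.base, hy'.base] at this
      exact lt_irrefl _ this
    obtain ⟨q, hq⟩ := Nat.exists_eq_succ_of_ne_zero ha0
    rw [Nat.succ_eq_add_one] at hq
    have hprev : y q ≤ y' q := by
      by_contra! hlt
      refine Nat.find_min hex (m := q) (by omega) ⟨by omega, fun i h1 h2 => ?_⟩
      rcases eq_or_lt_of_le h1 with rfl | h1
      · exact hlt
      · exact ha2 i (by omega) h2
    have hinc : c.lo q < inc y q := by
      have h1 := hy'.lo q (by omega)
      have h2 := ha2 (q + 1) (by omega) (by omega)
      simp only [inc] at h1 ⊢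
      linarith
    have hqe : q % 2 = 0 := by
      by_contra ho
      exact hinc.ne' (htight q (by omega) (by omega))
    obtain ⟨γ, hγ⟩ := c.exists_gap y
    have hγ0 := hγ.pos
    have hpos : ∀ i, q ≤ i → i < 2 * j + 2 → 0 < y (i + 1) := by
      intro i h1 h2
      rcases Nat.lt_or_ge i (2 * j + 1) with h3 | h3
      · exact (hy'.nonneg i (by omega)).trans_lt (ha2 (i + 1) (by omega) (by omega))
      · obtain rfl : i = 2 * j + 1 := by omega
        have h4 := (hy'.nonneg (2 * j) (by omega)).trans_lt hgt
        exact h4.trans_le (h.adm.le_succ (by omega) (by omega))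
    -- Lowering all depths from there through eclipse `j` gives up at most `γ` units of time, but
    -- saves at a rate above `p` because eclipse `j` has a positive increment.
    have hadm : c.IsAdm (bump y q (2 * j + 2) (-γ)) := by
      refine h.adm.bump (by omega) (by linarith [hγ.lo q (by omega) hinc]) (fun _ => by omega)
        (fun hr => by linarith [h.adm.lo _ hr]) (fun _ _ => by omega) (fun k h1 h2 => ?_)
        (fun k h1 h2 => ?_)
      · linarith [hγ.nonneg k (by omega) (hpos k h1 h2)]
      · linarith [h.adm.le_one k (by omega)]
    have htime := add_le_time_bump (c := c) (y := y) (τ := -γ) (A := -γ) (B := 0)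
      (show q < 2 * j + 2 by omega) (by omega)
      (le_min (by linarith [min_le_left (inc y q) (c.hi q)])
        (by linarith [min_le_right (inc y q) (c.hi q)]))
      (fun _ => le_min (by linarith [min_le_left (inc y (2 * j + 2)) (c.hi (2 * j + 2))])
        (by linarith [min_le_right (inc y (2 * j + 2)) (c.hi (2 * j + 2))])) (fun _ => le_rfl)
    have h1 := hc _ γ hγ0.le hadm (by linarith [h.time_ge])
    rw [lin_bump (by omega)] at h1
    obtain ⟨α, hα⟩ : ∃ α, q = 2 * α := ⟨q / 2, by omega⟩
    subst hα
    have h2 := h.sum_pairs_le (α := α) (β := j + 1) (j := j) (by omega) (by omega) (by omega)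
    rw [show 2 * (j + 1) = 2 * j + 2 by ring] at h2
    have h3 : 0 ≤ γ * (p - ∑ i ∈ Finset.Ico (2 * α) (2 * j + 2), g (i + 1)) := by linarith
    have h4 := nonneg_of_mul_nonneg_right h3 hγ0
    have h5 := le_slope_sub c.a_pos (h.adm.nonneg (2 * j) (by omega))
      (h.adm.le_succ (i := 2 * j + 1) (by omega) (by omega)) (h.adm.le_one (2 * j + 1) (by omega))
    have h6 := htight (2 * j + 1) (by omega) (by omega)
    simp only [inc, show 2 * j + 1 + 1 = 2 * j + 2 by ring] at h5 h6
    rw [h6] at h5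
    have h7 := hp2 (2 * j + 1) (by omega) (by positivity)
    have h8 : 0 < curvLower c.a * c.lo (2 * j + 1) := by positivity
    linarith
  -- Eclipse by eclipse, `y` discharges by the least amount, from the least depth if that amount is
  -- positive.
  rw [obj_eq_sum_pairs, obj_eq_sum_pairs]
  refine Finset.sum_le_sum fun j hj => ?_
  rw [Finset.mem_range] at hj
  have h6 := htight (2 * j + 1) (by omega) (by omega)
  have hlo := c.lo_nonneg (2 * j + 1) (by omega) (by omega)
  have h7 := hy'.lo (2 * j + 1) (by omega)
  have h0 := hy'.nonneg (2 * j) (by omega)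
  have h1 := hy'.le_one (2 * j + 1) (by omega)
  simp only [inc, show 2 * j + 1 + 1 = 2 * j + 2 by ring] at h6 h7 h1
  rcases hlo.eq_or_lt with hz | hpos
  · have e : y (2 * j + 2) = y (2 * j + 1) := by linarith
    rw [e, sub_self]
    have := cycleLife_mono c.a_pos h0 (by linarith) h1
    linarith
  · have e : y (2 * j + 2) = y (2 * j + 1) + c.lo (2 * j + 1) := by linarith
    rw [e]
    refine (cycleLife_sub_mono c.a_pos hlo (h.adm.nonneg (2 * j) (by omega)) (hle j hj hpos)
      (by linarith)).trans ?_
    have := cycleLife_mono c.a_pos (x := y' (2 * j + 1) + c.lo (2 * j + 1))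
      (y := y' (2 * j + 2)) (by linarith) (by linarith) h1
    linarith

/-- At an almost critical point that is no global minimizer the time constraint is active. -/
theorem NearCrit.time_eq {y g : ℕ → ℝ} {ω p : ℝ} (h : c.NearCrit y g ω)
    (hp : ¬ c.CheapTime y g p) (hp0 : 0 ≤ p) : c.time y = c.T := by
  refine le_antisymm ?_ h.time_ge
  by_contra! hlt
  refine hp (h.cheapTime (y₁ := y) (ε := c.time y - c.T) h.adm (by linarith) (by linarith) ?_)
  have : c.lin g y y = 0 := by simp [lin]
  rw [this]
  exact mul_nonneg hp0 (by linarith)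

end Chain

/-! ### Hinges, cuts and first-order conditions on groups of depths. -/

namespace Chain

variable {c : Chain} {y g ys : ℕ → ℝ} {ω γ p : ℝ}

/-- The increment of step `i` can be changed in both directions, at the price of time. -/
def Hinge (c : Chain) (y : ℕ → ℝ) (i : ℕ) : Prop := c.lo i < inc y i ∧ inc y i < c.hi i

/-- The entries with index in `(a, r]` can be shifted in both directions, and the shift changes
the time bought at step `a` only. -/
structure FreeEnd (c : Chain) (y : ℕ → ℝ) (a r : ℕ) : Prop where
  lt : a < r
  le : r ≤ 2 * c.J
  even : r % 2 = 0
  hinge : c.Hinge y a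
  cut : r < 2 * c.J → c.hi r < inc y r
  pos : ∀ i, a ≤ i → i < r → 0 < y (i + 1)
  lt_one : ∀ i, a ≤ i → i < r → y (i + 1) < 1

/-- Beyond the group the chain either stops or wastes energy; a wasting step has spare increment, so
the time gained at the hinge is not lost at `r`. -/
theorem FreeEnd.up {a r : ℕ} (hf : c.FreeEnd y a r) (hy : c.IsAdm y) (hγ : c.Gap y γ) :
    c.IsAdm (bump y a r γ) ∧ c.time y + γ ≤ c.time (bump y a r γ) := by
  have := hf.lt
  have := hf.le
  have := hγ.pos
  have h1 := hγ.hi a (by omega) hf.hinge.2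
  have h2 : r < 2 * c.J → c.hi r ≤ inc y r - γ := fun hr => by
    linarith [hγ.hi' r hr (hf.cut hr)]
  constructor
  · refine hy.bump hf.lt (by linarith [hf.hinge.1]) (fun _ => by linarith)
      (fun hr => (c.lo_le_hi r hr).trans (h2 hr)) (fun _ h => by have := hf.even; omega)
      (fun i h3 h4 => by linarith [hf.pos i h3 h4])
      (fun i h3 h4 => by linarith [hγ.le_one i (by omega) (hf.lt_one i h3 h4)])
  · have := add_le_time_bump (c := c) (y := y) (τ := γ) (A := γ) (B := 0) hf.lt hf.le
      (le_min (by linarith [min_le_left (inc y a) (c.hi a)])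
        (by linarith [min_le_left (inc y a) (c.hi a)]))
      (fun hr => by rw [min_eq_right (hf.cut hr).le, min_eq_right (h2 hr)]; simp)
      (fun _ => le_rfl)
    linarith

theorem FreeEnd.down {a r : ℕ} (hf : c.FreeEnd y a r) (hy : c.IsAdm y) (hγ : c.Gap y γ) :
    c.IsAdm (bump y a r (-γ)) ∧ c.time y - γ ≤ c.time (bump y a r (-γ)) := by
  have := hf.lt
  have := hf.le
  have := hγ.pos
  have h1 := hγ.lo a (by omega) hf.hinge.1
  constructor
  · refine hy.bump hf.lt (by linarith) (fun _ => by linarith [hf.hinge.2])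
      (fun hr => by linarith [hy.lo r hr]) (fun _ h => by have := hf.even; omega)
      (fun i h3 h4 => by linarith [hγ.nonneg i (by omega) (hf.pos i h3 h4)])
      (fun i h3 h4 => by linarith [hf.lt_one i h3 h4])
  · have := add_le_time_bump (c := c) (y := y) (τ := -γ) (A := -γ) (B := 0) hf.lt hf.le
      (le_min (by linarith [min_le_left (inc y a) (c.hi a)])
        (by linarith [min_le_right (inc y a) (c.hi a)]))
      (fun hr => le_min (by linarith [min_le_left (inc y r) (c.hi r)])
        (by linarith [min_le_right (inc y r) (c.hi r)]))
      (fun _ => le_rfl)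
    linarith

/-- Time is bought by raising one free end and sold by lowering the other; criticality forbids a
profit. -/
theorem NearCrit.sum_le_sum_of_freeEnd (h : c.NearCrit y g ω) (hT : c.time y = c.T)
    {a r a' r' : ℕ} (hf : c.FreeEnd y a r) (hf' : c.FreeEnd y a' r') :
    ∑ i ∈ Finset.Ico a' r', g (i + 1) ≤ ∑ i ∈ Finset.Ico a r, g (i + 1) := by
  obtain ⟨γ, hγ⟩ := c.exists_gap y
  obtain ⟨h1, h2⟩ := hf.up h.adm hγ
  obtain ⟨h3, h4⟩ := hf'.down h.adm hγ
  have h5 := h.mix h1 h3 hγ.pos hγ.pos.le (by linarith) (by linarith)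
  rw [lin_bump hf.le, lin_bump hf'.le] at h5
  have h6 : 0 ≤ γ * γ * (∑ i ∈ Finset.Ico a r, g (i + 1) - ∑ i ∈ Finset.Ico a' r', g (i + 1)) := by
    linarith
  have := nonneg_of_mul_nonneg_right h6 (mul_pos hγ.pos hγ.pos)
  linarith

theorem NearCrit.cheapTime_of_freeEnd (h : c.NearCrit y g ω) (hT : c.time y = c.T)
    {a r : ℕ} (hf : c.FreeEnd y a r) : c.CheapTime y g (∑ i ∈ Finset.Ico a r, g (i + 1)) := by
  obtain ⟨γ, hγ⟩ := c.exists_gap y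
  obtain ⟨h1, h2⟩ := hf.up h.adm hγ
  refine h.cheapTime h1 hγ.pos (by linarith) ?_
  rw [lin_bump hf.le, mul_comm]

theorem CheapTime.mono {q : ℝ} (h : c.CheapTime y g q) (hqp : q ≤ p) : c.CheapTime y g p := by
  intro y' ε hε hy' ht
  have := h y' ε hε hy' ht
  have := mul_le_mul_of_nonneg_right hqp hε
  linarith

/-- There is a common price for time. -/
theorem NearCrit.exists_price (h : c.NearCrit y g ω) (hT : c.time y = c.T) :
    ∃ t, (∀ a r, c.FreeEnd y a r → ∑ i ∈ Finset.Ico a r, g (i + 1) = t) ∧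
      ∀ i < 2 * c.J, i % 2 = 1 → c.lo i < inc y i → cycleLifeSlope c.a (y (i + 1)) ≤ t := by
  by_cases hex : ∃ a r, c.FreeEnd y a r
  · obtain ⟨a, r, hf⟩ := hex
    refine ⟨∑ i ∈ Finset.Ico a r, g (i + 1), fun a' r' hf' =>
      le_antisymm (h.sum_le_sum_of_freeEnd hT hf hf') (h.sum_le_sum_of_freeEnd hT hf' hf),
      fun i hi ho hlt => ?_⟩
    rw [← h.odd_step i hi ho]
    exact (h.cheapTime_of_freeEnd hT hf).slope_le h.adm h.time_ge hi ho hlt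
  · push Not at hex
    -- Without free ends the price is arbitrary as far as the first claim goes; the largest possible
    -- slope serves the second one.
    refine ⟨cycleLifeSlope c.a 1, fun a r hf => absurd hf (hex a r), fun i hi _ _ => ?_⟩
    exact slope_mono c.a_pos (h.adm.nonneg i hi) (h.adm.le_one i hi) le_rfl

/-- The group can be shifted both ways, and what one hinge gains in time the other one loses. -/
theorem NearCrit.sum_eq_zero_of_hinge (h : c.NearCrit y g ω) {a r : ℕ} (har : a < r)
    (hr : r < 2 * c.J) (ha : c.Hinge y a) (hb : c.Hinge y r)
    (hpos : ∀ i, a ≤ i → i < r → 0 < y (i + 1)) (hlt : ∀ i, a ≤ i → i < r → y (i + 1) < 1) :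
    ∑ i ∈ Finset.Ico a r, g (i + 1) = 0 := by
  obtain ⟨γ, hγ⟩ := c.exists_gap y
  have hγ0 := hγ.pos
  have key : ∀ τ, |τ| = γ → 0 ≤ τ * ∑ i ∈ Finset.Ico a r, g (i + 1) := by
    intro τ hτ
    obtain ⟨t1, t2⟩ := abs_le.1 hτ.le
    have h1 := hγ.lo a (by omega) ha.1
    have h2 := hγ.hi a (by omega) ha.2
    have h3 := hγ.lo r (by omega) hb.1
    have h4 := hγ.hi r (by omega) hb.2
    rw [← lin_bump hr.le]
    refine h.vi _ ?_ ?_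
    · refine h.adm.bump har (by linarith) (fun _ => by linarith) (fun _ => by linarith)
        (fun _ _ => by linarith) (fun i h5 h6 => ?_) (fun i h5 h6 => ?_)
      · linarith [hγ.nonneg i (by omega) (hpos i h5 h6)]
      · linarith [hγ.le_one i (by omega) (hlt i h5 h6)]
    · have := add_le_time_bump (c := c) (y := y) (τ := τ) (A := τ) (B := -τ) har hr.le
        (by rw [min_eq_left ha.2.le, min_eq_left (by linarith)])
        (fun _ => by rw [min_eq_left hb.2.le, min_eq_left (by linarith)]; linarith)
        (fun _ => by omega)
      linarith [h.time_ge]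
  have h1 := key γ (abs_of_pos hγ0)
  have h2 := key (-γ) (by rw [abs_neg, abs_of_pos hγ0])
  have h3 := nonneg_of_mul_nonneg_right h1 hγ0
  have h4 : 0 ≤ γ * -∑ i ∈ Finset.Ico a r, g (i + 1) := by linarith
  have h5 := nonneg_of_mul_nonneg_right h4 hγ0
  linarith

section cut

variable {a r : ℕ}

/-- Lowering all depths after a step that wastes energy. -/
theorem bump_cut (hy : c.IsAdm y) (hγ : c.Gap y γ) (har : a < r) (hr : r ≤ 2 * c.J)
    (ha : a % 2 = 0) (hre : r % 2 = 0) (hcut : c.hi a < inc y a)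
    (hpos : ∀ i, a ≤ i → i < r → 0 < y (i + 1)) :
    c.IsAdm (bump y a r (-γ)) ∧ c.time y ≤ c.time (bump y a r (-γ)) ∧
      (r < 2 * c.J → inc y r < c.hi r → c.time y + γ ≤ c.time (bump y a r (-γ))) := by
  have hγ0 := hγ.pos
  have h1 := hγ.hi' a (by omega) hcut
  have hA : min (inc y a) (c.hi a) + 0 ≤ min (inc y a + -γ) (c.hi a) := by
    rw [min_eq_right hcut.le, min_eq_right (by linarith), add_zero]
  refine ⟨?_, ?_, fun hr' hlt => ?_⟩
  · refine hy.bump har (by linarith [c.lo_le_hi a (by omega)]) (fun _ => by omega)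
      (fun hr' => by linarith [hy.lo r hr']) (fun _ _ => by omega)
      (fun i h3 h4 => by linarith [hγ.nonneg i (by omega) (hpos i h3 h4)])
      (fun i h3 h4 => by linarith [hy.le_one i (by omega)])
  · have := add_le_time_bump (c := c) (y := y) (τ := -γ) (A := 0) (B := 0) har hr hA
      (fun _ => le_min (by linarith [min_le_left (inc y r) (c.hi r)])
        (by linarith [min_le_right (inc y r) (c.hi r)])) (fun _ => le_rfl)
    linarith
  · have h2 := hγ.hi r hr' hlt
    have := add_le_time_bump (c := c) (y := y) (τ := -γ) (A := 0) (B := γ) har hr hA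
      (fun _ => by rw [min_eq_left hlt.le, min_eq_left (by linarith)]; linarith)
      (fun _ => by omega)
    linarith

/-- Lowering the depths behind a cut merely uses wasted energy and costs no time, so at an almost
critical point it can save almost nothing. This forces all eclipse increments there to be small. -/
theorem NearCrit.slope_sub_le_of_cut (h : c.NearCrit y g ω) (hr : r ≤ 2 * c.J)
    (ha : a % 2 = 0) (hre : r % 2 = 0) (hcut : c.hi a < inc y a)
    (hpos : ∀ i, a ≤ i → i < r → 0 < y (i + 1)) {i : ℕ} (hai : a ≤ i) (hir : i < r)
    (hi : i % 2 = 1) :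
    cycleLifeSlope c.a (y (i + 1)) - cycleLifeSlope c.a (y i) ≤ 2 * c.J * ω := by
  obtain ⟨γ, hγ⟩ := c.exists_gap y
  obtain ⟨h1, h2, -⟩ := bump_cut h.adm hγ (by omega) hr ha hre hcut hpos
  have h3 := h.vi _ h1 (h.time_ge.trans h2)
  rw [lin_bump hr] at h3
  have h4 : 0 ≤ γ * -∑ i ∈ Finset.Ico a r, g (i + 1) := by linarith
  have h5 := nonneg_of_mul_nonneg_right h4 hγ.pos
  obtain ⟨α, rfl⟩ : ∃ α, a = 2 * α := ⟨a / 2, by omega⟩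
  obtain ⟨β, rfl⟩ : ∃ β, r = 2 * β := ⟨r / 2, by omega⟩
  obtain ⟨j, rfl⟩ : ∃ j, i = 2 * j + 1 := ⟨i / 2, by omega⟩
  have h6 := h.sum_pairs_le (α := α) (β := β) (j := j) (by omega) (by omega) (by omega)
  rw [show 2 * j + 1 + 1 = 2 * j + 2 by ring]
  linarith

/-- A later sunlight step with unused capacity would let the wasted energy buy time almost for free,
making time cheap. -/
theorem NearCrit.hi_le_of_cut (h : c.NearCrit y g ω) (hp : ¬ c.CheapTime y g p)
    (hωp : 2 * c.J * ω ≤ p) (har : a < r) (hr : r < 2 * c.J)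
    (ha : a % 2 = 0) (hre : r % 2 = 0) (hcut : c.hi a < inc y a)
    (hpos : ∀ i, a ≤ i → i < r → 0 < y (i + 1)) : c.hi r ≤ inc y r := by
  by_contra! hlt
  obtain ⟨γ, hγ⟩ := c.exists_gap y
  obtain ⟨h1, -, h2⟩ := bump_cut h.adm hγ har hr.le ha hre hcut hpos
  refine hp (h.cheapTime h1 hγ.pos (le_trans (by linarith [h.time_ge]) (h2 hr hlt)) ?_)
  rw [lin_bump hr.le]
  obtain ⟨α, rfl⟩ : ∃ α, a = 2 * α := ⟨a / 2, by omega⟩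
  obtain ⟨β, rfl⟩ : ∃ β, r = 2 * β := ⟨r / 2, by omega⟩
  have h6 := h.neg_le_sum_pairs (α := α) (β := β) (by omega)
  have := mul_le_mul_of_nonneg_left (show -p ≤ ∑ i ∈ Finset.Ico (2 * α) (2 * β), g (i + 1) by
    linarith) hγ.pos.le
  linarith

end cut

theorem NearCrit.abs_sum_sub_le (h : c.NearCrit y g ω) {a r : ℕ} (hr : r ≤ 2 * c.J) :
    |∑ i ∈ Finset.Ico a r, (-1) ^ (i + 1) * cycleLifeSlope c.a (y (i + 1))
      - ∑ i ∈ Finset.Ico a r, g (i + 1)| ≤ 2 * c.J * ω := by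
  rw [← Finset.sum_sub_distrib]
  have key : ∀ i ∈ Finset.Ico a r,
      |(-1) ^ (i + 1) * cycleLifeSlope c.a (y (i + 1)) - g (i + 1)| ≤ ω := by
    intro i hi
    rw [Finset.mem_Ico] at hi
    rcases Nat.mod_two_eq_zero_or_one i with he | ho
    · have h1 : ((-1 : ℝ)) ^ (i + 1) = -1 := Odd.neg_one_pow (by rw [Nat.odd_iff]; omega)
      have := h.even_step i (by omega) he
      rw [h1, ← abs_neg]
      convert this using 2
      ring
    · have h1 : ((-1 : ℝ)) ^ (i + 1) = 1 := Even.neg_one_pow (by rw [Nat.even_iff]; omega)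
      rw [h1, h.odd_step i (by omega) ho, one_mul, sub_self, abs_zero]
      exact h.ω_nonneg
  refine (Finset.abs_sum_le_sum_abs _ _).trans ((Finset.sum_le_sum key).trans ?_)
  simp only [Finset.sum_const, Nat.card_Ico, nsmul_eq_mul]
  have h1 : ((r - a : ℕ) : ℝ) ≤ 2 * c.J := by
    have : r - a ≤ 2 * c.J := by omega
    exact_mod_cast this
  exact mul_le_mul_of_nonneg_right h1 h.ω_nonneg

/-! ### Change of the objective on a single group near a cluster point. -/

/-- An almost critical point `y` close to a given point `ys`. -/
structure Nearby (c : Chain) (y g ys : ℕ → ℝ) (ω γ p : ℝ) : Prop where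
  crit : c.NearCrit y g ω
  time_eq : c.time y = c.T
  not_cheap : ¬ c.CheapTime y g p
  le_p : 2 * c.J * ω ≤ p
  adm : c.IsAdm ys
  γ_pos : 0 < γ
  small : 2 * c.J * ω < curvLower c.a * γ
  close : ∀ i < 2 * c.J, |y (i + 1) - ys (i + 1)| ≤ γ
  pos : ∀ i < 2 * c.J, y (i + 1) = 0 → ys (i + 1) = 0
  lt_one : ∀ i < 2 * c.J, y (i + 1) = 1 → ys (i + 1) = 1
  lo : ∀ i < 2 * c.J, inc y i = c.lo i → inc ys i = c.lo i
  le_hi : ∀ i < 2 * c.J, inc y i ≤ c.hi i → inc ys i ≤ c.hi i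
  hi_le : ∀ i < 2 * c.J, c.hi i ≤ inc y i → c.hi i ≤ inc ys i
  inc_pos : ∀ i < 2 * c.J, 0 < inc ys i → γ ≤ inc y i
  loj : ∀ a ≤ 2 * c.J, ∀ r ≤ 2 * c.J, ∀ q, |q| ≤ γ →
    γ * ∑ i ∈ Finset.Ico a r, (-1) ^ (i + 1) * (cycleLife c.a (ys (i + 1) + q)
      - cycleLife c.a (ys (i + 1))) ≤
    (∑ i ∈ Finset.Ico a r, (-1) ^ (i + 1) * cycleLifeSlope c.a (ys (i + 1) + q)) ^ 2

/-- The modulus of strong convexity of free groups of depths. -/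
noncomputable def convModulus (c : Chain) (γ : ℝ) : ℝ :=
  min (curvLower c.a) (jerkLower c.a * γ)

/-- The constant in the Łojasiewicz inequality of one group of depths. -/
noncomputable def groupConst (c : Chain) (γ : ℝ) : ℝ :=
  (2 * c.J) ^ 2 / γ + (2 * c.J) ^ 2 / (2 * c.convModulus γ)

theorem convModulus_pos (hγ : 0 < γ) : 0 < c.convModulus γ :=
  lt_min (curvLower_pos c.a_pos) (mul_pos (jerkLower_pos c.a_pos) hγ)

theorem groupConst_nonneg (hγ : 0 < γ) : 0 ≤ c.groupConst γ := by
  have := c.convModulus_pos hγ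
  unfold groupConst
  positivity

/-- Change of the objective on the entries with index in `(a, r]`. -/
noncomputable def objDiff (c : Chain) (y ys : ℕ → ℝ) (a r : ℕ) : ℝ :=
  ∑ i ∈ Finset.Ico a r, (-1) ^ (i + 1) * (cycleLife c.a (y (i + 1)) - cycleLife c.a (ys (i + 1)))

theorem objDiff_add {a b r : ℕ} (hab : a ≤ b) (hbr : b ≤ r) :
    c.objDiff y ys a b + c.objDiff y ys b r = c.objDiff y ys a r :=
  Finset.sum_Ico_consecutive _ hab hbr

namespace Nearby

variable {a r : ℕ} {q : ℝ}

theorem objDiff_eq_zero (hq : ∀ i, a ≤ i → i < r → y (i + 1) - ys (i + 1) = 0) :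
    c.objDiff y ys a r = 0 := by
  refine Finset.sum_eq_zero fun i hi => ?_
  rw [Finset.mem_Ico] at hi
  rw [sub_eq_zero.1 (hq i hi.1 hi.2), sub_self, mul_zero]

/-- A depth of `y` at 0 or 1 is at the same bound for `ys`, which pins the whole rigid group. -/
theorem bounds_or_eq_zero (h : c.Nearby y g ys ω γ p) (hr : r ≤ 2 * c.J)
    (hq : ∀ i, a ≤ i → i < r → y (i + 1) - ys (i + 1) = q) :
    ((∀ i, a ≤ i → i < r → 0 < y (i + 1)) ∧ (∀ i, a ≤ i → i < r → y (i + 1) < 1)) ∨ q = 0 := by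
  by_contra! hcon
  obtain ⟨h1, h2⟩ := hcon
  by_cases hpos : ∀ i, a ≤ i → i < r → 0 < y (i + 1)
  · obtain ⟨i, hi, hir, hle⟩ := h1 hpos
    have e : y (i + 1) = 1 := le_antisymm (h.crit.adm.le_one i (by omega)) hle
    exact h2 (by rw [← hq i hi hir, e, h.lt_one i (by omega) e, sub_self])
  · push Not at hpos
    obtain ⟨i, hi, hir, hle⟩ := hpos
    have e : y (i + 1) = 0 := le_antisymm hle (h.crit.adm.nonneg i (by omega))
    exact h2 (by rw [← hq i hi hir, e, h.pos i (by omega) e, sub_self])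

/-- The true gradient sum differs from the vanishing perturbed one by at most `2 * c.J * ω`, and the
one-variable Łojasiewicz inequality squares this error. -/
theorem objDiff_le_of_hinge (h : c.Nearby y g ys ω γ p) (har : a < r) (hr : r < 2 * c.J)
    (ha : c.Hinge y a) (hb : c.Hinge y r)
    (hq : ∀ i, a ≤ i → i < r → y (i + 1) - ys (i + 1) = q) :
    c.objDiff y ys a r ≤ c.groupConst γ * ω ^ 2 := by
  have hγ := h.γ_pos
  have hC := mul_nonneg (c.groupConst_nonneg hγ) (sq_nonneg ω)
  rcases h.bounds_or_eq_zero hr.le hq with ⟨hpos, hlt⟩ | rfl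
  · have h0 := h.crit.sum_eq_zero_of_hinge har hr ha hb hpos hlt
    have h1 := h.crit.abs_sum_sub_le (a := a) hr.le
    rw [h0, sub_zero] at h1
    have hqγ : |q| ≤ γ := by rw [← hq a le_rfl har]; exact h.close a (by omega)
    have h2 := h.loj a (by omega) r hr.le q hqγ
    have e1 : ∑ i ∈ Finset.Ico a r, (-1) ^ (i + 1) * (cycleLife c.a (ys (i + 1) + q)
        - cycleLife c.a (ys (i + 1))) = c.objDiff y ys a r := by
      refine Finset.sum_congr rfl fun i hi => ?_
      rw [Finset.mem_Ico] at hi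
      rw [← hq i hi.1 hi.2, add_sub_cancel]
    have e2 : ∑ i ∈ Finset.Ico a r, (-1) ^ (i + 1) * cycleLifeSlope c.a (ys (i + 1) + q)
        = ∑ i ∈ Finset.Ico a r, (-1) ^ (i + 1) * cycleLifeSlope c.a (y (i + 1)) := by
      refine Finset.sum_congr rfl fun i hi => ?_
      rw [Finset.mem_Ico] at hi
      rw [← hq i hi.1 hi.2, add_sub_cancel]
    rw [e1, e2] at h2
    have h3 : (∑ i ∈ Finset.Ico a r, (-1) ^ (i + 1) * cycleLifeSlope c.a (y (i + 1))) ^ 2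
        ≤ (2 * c.J * ω) ^ 2 := by
      rw [← sq_abs]
      exact pow_le_pow_left₀ (abs_nonneg _) h1 2
    have h4 : c.objDiff y ys a r ≤ (2 * c.J) ^ 2 / γ * ω ^ 2 := by
      rw [div_mul_eq_mul_div, le_div_iff₀ hγ]
      nlinarith
    refine h4.trans (mul_le_mul_of_nonneg_right ?_ (sq_nonneg ω))
    have := c.convModulus_pos hγ
    exact le_add_of_nonneg_right (by positivity)
  · rw [objDiff_eq_zero hq]
    exact hC

/-- A rigid shift keeps the eclipse increment, and the life consumed over a fixed increment is
strongly convex in the starting depth, with modulus proportional to the increment. -/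
theorem pairs_le (h : c.Nearby y g ys ω γ p) {α β : ℕ} (hβ : β ≤ c.J)
    (hq : ∀ i, 2 * α ≤ i → i < 2 * β → y (i + 1) - ys (i + 1) = q) {j : ℕ} (hj : α ≤ j)
    (hj' : j < β) :
    (-1) ^ (2 * j + 1) * (cycleLife c.a (y (2 * j + 1)) - cycleLife c.a (ys (2 * j + 1))) +
      (-1) ^ (2 * j + 1 + 1) * (cycleLife c.a (y (2 * j + 1 + 1)) -
        cycleLife c.a (ys (2 * j + 1 + 1))) ≤
    ((-1) ^ (2 * j + 1) * cycleLifeSlope c.a (y (2 * j + 1)) +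
      (-1) ^ (2 * j + 1 + 1) * cycleLifeSlope c.a (y (2 * j + 1 + 1))) * q -
      jerkLower c.a * inc y (2 * j + 1) / 2 * q ^ 2 := by
  have h1 : ((-1 : ℝ)) ^ (2 * j + 1) = -1 := Odd.neg_one_pow ⟨j, rfl⟩
  have h2 : ((-1 : ℝ)) ^ (2 * j + 1 + 1) = 1 := Even.neg_one_pow ⟨j + 1, by ring⟩
  have q1 := hq (2 * j) (by omega) (by omega)
  have q2 := hq (2 * j + 1) (by omega) (by omega)
  have i1 : y (2 * j + 1 + 1) = y (2 * j + 1) + inc y (2 * j + 1) := by simp only [inc]; ring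
  have i2 : ys (2 * j + 1 + 1) = ys (2 * j + 1) + inc y (2 * j + 1) := by
    simp only [inc]; linarith
  have l1 := (c.lo_nonneg (2 * j + 1) (by omega) (by omega)).trans
    (h.crit.adm.lo (2 * j + 1) (by omega))
  have u1 := h.crit.adm.le_one (2 * j + 1) (by omega)
  have u2 := h.adm.le_one (2 * j + 1) (by omega)
  rw [i1] at u1
  rw [i2] at u2
  have := tangent_add_sq_le_cycleLife_sub c.a_pos l1 (h.crit.adm.nonneg (2 * j) (by omega)) u1
    (h.adm.nonneg (2 * j) (by omega)) u2
  rw [h1, h2, i1, i2]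
  have e : ys (2 * j + 1) - y (2 * j + 1) = -q := by linarith
  rw [e] at this
  linarith

theorem objDiff_pairs_le (h : c.Nearby y g ys ω γ p) {α β : ℕ} (hβ : β ≤ c.J)
    (hq : ∀ i, 2 * α ≤ i → i < 2 * β → y (i + 1) - ys (i + 1) = q) :
    c.objDiff y ys (2 * α) (2 * β) ≤
      (∑ i ∈ Finset.Ico (2 * α) (2 * β), (-1) ^ (i + 1) * cycleLifeSlope c.a (y (i + 1))) * q := by
  unfold objDiff
  rcases le_total α β with hab | hab
  · rw [sum_Ico_two_mul _ hab, sum_Ico_two_mul _ hab, Finset.sum_mul]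
    refine Finset.sum_le_sum fun j hj => ?_
    rw [Finset.mem_Ico] at hj
    have h1 := h.pairs_le hβ hq hj.1 hj.2
    have l1 := (c.lo_nonneg (2 * j + 1) (by omega) (by omega)).trans
      (h.crit.adm.lo (2 * j + 1) (by omega))
    have := jerkLower_pos c.a_pos
    have : 0 ≤ jerkLower c.a * inc y (2 * j + 1) / 2 * q ^ 2 := by positivity
    linarith
  · rw [Finset.Ico_eq_empty (by omega)]
    simp

/-- A free group of depths at the end of a block is strongly convex. -/
theorem objDiff_le_of_freeEnd (h : c.Nearby y g ys ω γ p) (hf : c.FreeEnd y a r)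
    (hq : ∀ i, a ≤ i → i < r → y (i + 1) - ys (i + 1) = q) :
    c.objDiff y ys a r ≤
      (∑ i ∈ Finset.Ico a r, (-1) ^ (i + 1) * cycleLifeSlope c.a (y (i + 1))) * q
        - c.convModulus γ / 2 * q ^ 2 := by
  have hlt := hf.lt
  have hle := hf.le
  obtain ⟨β, rfl⟩ : ∃ β, r = 2 * β := ⟨r / 2, by have := hf.even; omega⟩
  rcases Nat.mod_two_eq_zero_or_one a with he | ho
  · obtain ⟨α, rfl⟩ : ∃ α, a = 2 * α := ⟨a / 2, by omega⟩
    have hab : α < β := by omega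
    -- Strong convexity needs one eclipse with a definite increment. If all were below `γ`, they
    -- would vanish for `ys` and hence for `y`; the price would then be at most `2 * c.J * ω ≤ p`,
    -- and time would be cheap.
    have hex : ∃ j, α ≤ j ∧ j < β ∧ γ ≤ inc y (2 * j + 1) := by
      by_contra! hcon
      have hz : ∀ j, α ≤ j → j < β → y (2 * j + 1 + 1) = y (2 * j + 1) := by
        intro j h1 h2
        have h3 : inc ys (2 * j + 1) ≤ 0 := by
          by_contra! hlt
          exact absurd (h.inc_pos (2 * j + 1) (by omega) hlt) (not_le.2 (hcon j h1 h2))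
        have h4 := h.adm.le_succ (i := 2 * j + 1) (by omega) (by omega)
        have q1 := hq (2 * j) (by omega) (by omega)
        have q2 := hq (2 * j + 1) (by omega) (by omega)
        simp only [inc] at h3
        linarith
      have hs : ∑ i ∈ Finset.Ico (2 * α) (2 * β), (-1) ^ (i + 1) * cycleLifeSlope c.a (y (i + 1))
          = 0 := by
        rw [sum_Ico_two_mul _ hab.le]
        refine Finset.sum_eq_zero fun j hj => ?_
        rw [Finset.mem_Ico] at hj
        rw [hz j hj.1 hj.2, pow_succ]
        ring
      have h5 := h.crit.abs_sum_sub_le (a := 2 * α) hf.le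
      rw [hs, zero_sub, abs_neg] at h5
      exact h.not_cheap ((h.crit.cheapTime_of_freeEnd h.time_eq hf).mono
        ((le_abs_self _).trans (h5.trans h.le_p)))
    obtain ⟨j, hj1, hj2, hj⟩ := hex
    have hb : 2 * β ≤ 2 * c.J := hf.le
    unfold objDiff
    rw [sum_Ico_two_mul _ hab.le, sum_Ico_two_mul _ hab.le, Finset.sum_mul]
    have key : ∀ k ∈ Finset.Ico α β,
        (-1) ^ (2 * k + 1) * (cycleLife c.a (y (2 * k + 1)) - cycleLife c.a (ys (2 * k + 1))) +
        (-1) ^ (2 * k + 1 + 1) * (cycleLife c.a (y (2 * k + 1 + 1)) -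
          cycleLife c.a (ys (2 * k + 1 + 1))) ≤
        ((-1) ^ (2 * k + 1) * cycleLifeSlope c.a (y (2 * k + 1)) +
        (-1) ^ (2 * k + 1 + 1) * cycleLifeSlope c.a (y (2 * k + 1 + 1))) * q -
        if k = j then c.convModulus γ / 2 * q ^ 2 else 0 := by
      intro k hk
      rw [Finset.mem_Ico] at hk
      refine (h.pairs_le (by omega) hq hk.1 hk.2).trans (sub_le_sub_left ?_ _)
      have hjp := jerkLower_pos c.a_pos
      have l1 := (c.lo_nonneg (2 * k + 1) (by omega) (by omega)).trans
        (h.crit.adm.lo (2 * k + 1) (by omega))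
      split_ifs with hkj
      · subst hkj
        have h1 : c.convModulus γ ≤ jerkLower c.a * inc y (2 * k + 1) :=
          (min_le_right _ _).trans (mul_le_mul_of_nonneg_left hj hjp.le)
        have := mul_le_mul_of_nonneg_right h1 (sq_nonneg q)
        linarith
      · positivity
    refine (Finset.sum_le_sum key).trans (le_of_eq ?_)
    rw [Finset.sum_sub_distrib, Finset.sum_ite_eq', if_pos (Finset.mem_Ico.2 ⟨hj1, hj2⟩)]
  -- Here the hinge is itself an eclipse: its final depth enters unpaired and is strongly convex on
  -- its own; the remaining pairs need only be convex.
  · obtain ⟨α, rfl⟩ : ∃ α, a = 2 * α + 1 := ⟨a / 2, by omega⟩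
    have h1 := h.objDiff_pairs_le (α := α + 1) (β := β) (q := q) (by omega)
      (fun i h1 h2 => hq i (by omega) h2)
    rw [← objDiff_add (b := 2 * (α + 1)) (by omega) (by omega),
      ← Finset.sum_Ico_consecutive _ (show 2 * α + 1 ≤ 2 * (α + 1) by omega)
        (show 2 * (α + 1) ≤ 2 * β by omega), add_mul]
    have h2 : ((-1 : ℝ)) ^ (2 * α + 1 + 1) = 1 := Even.neg_one_pow ⟨α + 1, by ring⟩
    have e : Finset.Ico (2 * α + 1) (2 * (α + 1)) = {2 * α + 1} := by
      ext i; simp only [Finset.mem_Ico, Finset.mem_singleton]; omega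
    have q1 := hq (2 * α + 1) (by omega) (by omega)
    have h3 := tangent_add_sq_le_cycleLife c.a_pos (h.crit.adm.nonneg (2 * α + 1) (by omega))
      (h.crit.adm.le_one (2 * α + 1) (by omega)) (h.adm.nonneg (2 * α + 1) (by omega))
      (h.adm.le_one (2 * α + 1) (by omega))
    have e2 : ys (2 * α + 1 + 1) - y (2 * α + 1 + 1) = -q := by linarith
    rw [e2] at h3
    have h4 := mul_le_mul_of_nonneg_right
      (min_le_left (curvLower c.a) (jerkLower c.a * γ)) (sq_nonneg q)
    have h5 : c.objDiff y ys (2 * α + 1) (2 * (α + 1)) =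
        cycleLife c.a (y (2 * α + 1 + 1)) - cycleLife c.a (ys (2 * α + 1 + 1)) := by
      unfold objDiff
      rw [e, Finset.sum_singleton, h2, one_mul]
    rw [h5, e, Finset.sum_singleton, h2]
    unfold convModulus
    linarith

/-- The gradient sum is `t` up to `2 * c.J * ω`. The product of this error with `q` is absorbed by
the strong convexity term after completing the square. -/
theorem objDiff_le_of_end (h : c.Nearby y g ys ω γ p) {t : ℝ}
    (ht : ∀ a r, c.FreeEnd y a r → ∑ i ∈ Finset.Ico a r, g (i + 1) = t)
    (har : a < r) (hr : r ≤ 2 * c.J) (hre : r % 2 = 0)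
    (ha : c.Hinge y a) (hcut : r < 2 * c.J → c.hi r < inc y r)
    (hq : ∀ i, a ≤ i → i < r → y (i + 1) - ys (i + 1) = q) :
    c.objDiff y ys a r ≤ c.groupConst γ * ω ^ 2 + t * q := by
  have hγ := h.γ_pos
  have hC := mul_nonneg (c.groupConst_nonneg hγ) (sq_nonneg ω)
  rcases h.bounds_or_eq_zero hr hq with ⟨hpos, hlt⟩ | rfl
  · have hf : c.FreeEnd y a r := ⟨har, hr, hre, ha, hcut, hpos, hlt⟩
    have h1 := h.crit.abs_sum_sub_le (a := a) hr
    rw [ht a r hf] at h1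
    have h2 := h.objDiff_le_of_freeEnd hf hq
    set S := ∑ i ∈ Finset.Ico a r, (-1) ^ (i + 1) * cycleLifeSlope c.a (y (i + 1))
    have hm := c.convModulus_pos hγ
    have h3 : (S - t) ^ 2 ≤ (2 * c.J * ω) ^ 2 := by
      rw [← sq_abs]
      exact pow_le_pow_left₀ (abs_nonneg _) h1 2
    have h4 : (S - t) * q - c.convModulus γ / 2 * q ^ 2 ≤
        (2 * c.J) ^ 2 / (2 * c.convModulus γ) * ω ^ 2 := by
      rw [show (2 * (c.J : ℝ)) ^ 2 / (2 * c.convModulus γ) * ω ^ 2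
        = (2 * c.J * ω) ^ 2 / (2 * c.convModulus γ) by ring, le_div_iff₀ (by positivity)]
      nlinarith [sq_nonneg (S - t - c.convModulus γ * q)]
    have h5 : 0 ≤ (2 * (c.J : ℝ)) ^ 2 / γ * ω ^ 2 := by positivity
    unfold groupConst
    linarith
  · rw [objDiff_eq_zero hq]
    linarith

end Nearby

end Chain

/-! ### Reading a chain from left to right: summation over the groups. -/

namespace Chain

variable {c : Chain} {y g ys : ℕ → ℝ} {ω γ p : ℝ}

/-- Change of the time bought at the first `n` steps. -/
noncomputable def timeDiff (c : Chain) (y ys : ℕ → ℝ) (n : ℕ) : ℝ :=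
  ∑ i ∈ Finset.range n, (min (inc y i) (c.hi i) - min (inc ys i) (c.hi i))

theorem timeDiff_succ (n : ℕ) : c.timeDiff y ys (n + 1) =
    c.timeDiff y ys n + (min (inc y n) (c.hi n) - min (inc ys n) (c.hi n)) :=
  Finset.sum_range_succ _ _

theorem objDiff_succ (n : ℕ) : c.objDiff y ys 0 (n + 1) = c.objDiff y ys 0 n +
    (-1) ^ (n + 1) * (cycleLife c.a (y (n + 1)) - cycleLife c.a (ys (n + 1))) :=
  Finset.sum_Ico_succ_top (Nat.zero_le n) _

/-- `y` and `ys` agree at `n`, and the change of the objective is paid for. -/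
def Settled (c : Chain) (y ys : ℕ → ℝ) (t D : ℝ) (n : ℕ) : Prop :=
  y n = ys n ∧ c.objDiff y ys 0 n ≤ n * D + t * c.timeDiff y ys n

/-- The index `n` belongs to a group of depths that starts after a hinge, and the change of the
objective before this group is paid for. -/
def Running (c : Chain) (y ys : ℕ → ℝ) (t D : ℝ) (n : ℕ) : Prop :=
  ∃ a < n, c.Hinge y a ∧ (∀ i, a ≤ i → i < n → y (i + 1) - ys (i + 1) = y n - ys n) ∧
    c.objDiff y ys 0 a ≤ a * D + t * (c.timeDiff y ys n - (y n - ys n))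

/-- Energy is wasted at an earlier step and the battery is never full afterwards. -/
def AfterCut (c : Chain) (y : ℕ → ℝ) (n : ℕ) : Prop :=
  ∃ a < n, a % 2 = 0 ∧ c.hi a < inc y a ∧ ∀ i, a ≤ i → i < n → 0 < y (i + 1)

/-- The possible states at index `n` when a chain is read from left to right. -/
def State (c : Chain) (y ys : ℕ → ℝ) (t D : ℝ) (n : ℕ) : Prop :=
  c.Settled y ys t D n ∨ c.Running y ys t D n ∨
    (n % 2 = 0 ∧ c.AfterCut y n ∧ c.objDiff y ys 0 n ≤ n * D + t * c.timeDiff y ys n) ∨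
    (n % 2 = 1 ∧ c.AfterCut y n ∧
      c.objDiff y ys 0 (n - 1) ≤ (n - 1 : ℕ) * D + t * c.timeDiff y ys n)

namespace Nearby

variable {t D : ℝ} {n : ℕ}

theorem objDiff_le_of_state_hinge (h : c.Nearby y g ys ω γ p)
    (hD : D = c.groupConst γ * ω ^ 2) (hn : n < 2 * c.J) (hb : c.Hinge y n)
    (hs : c.Settled y ys t D n ∨ c.Running y ys t D n) :
    c.objDiff y ys 0 n ≤ n * D + t * (c.timeDiff y ys n - (y n - ys n)) := by
  rcases hs with ⟨h1, h2⟩ | ⟨a, han, ha, hq, h2⟩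
  · rw [h1, sub_self, sub_zero]
    exact h2
  · have h3 := h.objDiff_le_of_hinge han hn ha hb hq
    rw [← hD] at h3
    rw [← objDiff_add (Nat.zero_le a) han.le]
    have hD0 : 0 ≤ D := hD ▸ mul_nonneg (c.groupConst_nonneg h.γ_pos) (sq_nonneg ω)
    have h4 : ((a : ℝ) + 1) * D ≤ n * D :=
      mul_le_mul_of_nonneg_right (by exact_mod_cast han) hD0
    linarith

theorem objDiff_le_of_state_end (h : c.Nearby y g ys ω γ p)
    (ht : ∀ a r, c.FreeEnd y a r → ∑ i ∈ Finset.Ico a r, g (i + 1) = t)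
    (hD : D = c.groupConst γ * ω ^ 2) (hn : n ≤ 2 * c.J) (hne : n % 2 = 0)
    (hcut : n < 2 * c.J → c.hi n < inc y n) (hs : c.State y ys t D n) :
    c.objDiff y ys 0 n ≤ n * D + t * c.timeDiff y ys n := by
  rcases hs with ⟨h1, h2⟩ | ⟨a, han, ha, hq, h2⟩ | ⟨-, -, h2⟩ | ⟨h1, -, -⟩
  · exact h2
  · have h3 := h.objDiff_le_of_end ht han hn hne ha hcut hq
    rw [← hD] at h3
    rw [← objDiff_add (Nat.zero_le a) han.le]
    have hD0 : 0 ≤ D := hD ▸ mul_nonneg (c.groupConst_nonneg h.γ_pos) (sq_nonneg ω)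
    have h4 : ((a : ℝ) + 1) * D ≤ n * D :=
      mul_le_mul_of_nonneg_right (by exact_mod_cast han) hD0
    linarith
  · exact h2
  · omega

/-- As long as no energy is wasted, each unit of depth buys one unit of time, so the difference of
the two displacements is conserved. This is why `Running` can be stated with the current index `n`.
-/
theorem timeDiff_succ_of_le (h : c.Nearby y g ys ω γ p) (hn : n < 2 * c.J)
    (hle : inc y n ≤ c.hi n) : c.timeDiff y ys (n + 1) - (y (n + 1) - ys (n + 1)) =
      c.timeDiff y ys n - (y n - ys n) := by
  rw [timeDiff_succ, min_eq_left hle, min_eq_left (h.le_hi n hn hle)]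
  simp only [inc]
  ring

theorem state_succ_of_hinge (h : c.Nearby y g ys ω γ p)
    (hD : D = c.groupConst γ * ω ^ 2) (hn : n < 2 * c.J) (hb : c.Hinge y n)
    (hs : c.Settled y ys t D n ∨ c.Running y ys t D n) : c.Running y ys t D (n + 1) := by
  refine ⟨n, by omega, hb, fun i h1 h2 => ?_, ?_⟩
  · obtain rfl : i = n := by omega
    rfl
  · rw [h.timeDiff_succ_of_le hn hb.2.le]
    exact h.objDiff_le_of_state_hinge hD hn hb hs

/-- A step with equal increments passes the displacement on: agreement stays agreement, and a
running group is prolonged. -/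
theorem state_succ_of_link (h : c.Nearby y g ys ω γ p) (hD0 : 0 ≤ D) (hn : n < 2 * c.J)
    (hle : inc y n ≤ c.hi n) (hlink : inc y n = inc ys n)
    (hs : c.Settled y ys t D n ∨ c.Running y ys t D n) :
    c.Settled y ys t D (n + 1) ∨ c.Running y ys t D (n + 1) := by
  have e := h.timeDiff_succ_of_le hn hle
  have e2 : y (n + 1) - ys (n + 1) = y n - ys n := by simp only [inc] at hlink; linarith
  have e3 : c.timeDiff y ys (n + 1) = c.timeDiff y ys n := by linarith
  rcases hs with ⟨h1, h2⟩ | ⟨a, han, ha, hq, h2⟩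
  · left
    rw [h1, sub_self, sub_eq_zero] at e2
    refine ⟨e2, ?_⟩
    rw [objDiff_succ, e2, e3]
    push_cast
    linarith
  · right
    refine ⟨a, by omega, ha, fun i hi hin => ?_, ?_⟩
    · rcases Nat.lt_succ_iff_lt_or_eq.1 hin with h3 | rfl
      · rw [hq i hi h3, e2]
      · rfl
    · rw [e]
      exact h2

theorem settled_of_eq_zero (h : c.Nearby y g ys ω γ p) (hD0 : 0 ≤ D) (hn : n < 2 * c.J)
    (h0 : y (n + 1) = 0) (he : c.timeDiff y ys (n + 1) = c.timeDiff y ys n)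
    (hs : c.objDiff y ys 0 n ≤ n * D + t * c.timeDiff y ys n) : c.Settled y ys t D (n + 1) := by
  have e : y (n + 1) = ys (n + 1) := by rw [h0, h.pos n hn h0]
  refine ⟨e, ?_⟩
  rw [objDiff_succ, e, he]
  push_cast
  linarith

/-- Tight steps prolong a group, hinges close it and open a new one, and cuts close it at the price
`t`. Behind a cut whole eclipses are accounted for at once, until the depth returns to 0, where `y`
and `ys` agree again. -/
theorem state_succ (h : c.Nearby y g ys ω γ p)
    (ht : ∀ a r, c.FreeEnd y a r → ∑ i ∈ Finset.Ico a r, g (i + 1) = t)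
    (ht' : ∀ i < 2 * c.J, i % 2 = 1 → c.lo i < inc y i → cycleLifeSlope c.a (y (i + 1)) ≤ t)
    (hD : D = c.groupConst γ * ω ^ 2) (hn : n < 2 * c.J) (hs : c.State y ys t D n) :
    c.State y ys t D (n + 1) := by
  have hD0 : 0 ≤ D := hD ▸ mul_nonneg (c.groupConst_nonneg h.γ_pos) (sq_nonneg ω)
  have simple : inc y n ≤ c.hi n → (c.Settled y ys t D n ∨ c.Running y ys t D n) →
      c.State y ys t D (n + 1) := by
    intro hle hs'
    have aux : inc y n = inc ys n → c.State y ys t D (n + 1) := fun hl => by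
      rcases h.state_succ_of_link hD0 hn hle hl hs' with h1 | h1
      · exact Or.inl h1
      · exact Or.inr (Or.inl h1)
    rcases (h.crit.adm.lo n hn).eq_or_lt with hlo | hlo
    · exact aux (by rw [h.lo n hn hlo.symm, hlo])
    rcases hle.eq_or_lt with hhi | hhi
    · exact aux (by rw [hhi]; exact le_antisymm (h.hi_le n hn hhi.ge) (h.le_hi n hn hle))
    · exact Or.inr (Or.inl (h.state_succ_of_hinge hD hn ⟨hlo, hhi⟩ hs'))
  rcases Nat.mod_two_eq_zero_or_one n with he | ho
  · rcases lt_or_ge (c.hi n) (inc y n) with hcut | hle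
    · have h1 := h.objDiff_le_of_state_end ht hD hn.le he (fun _ => hcut) hs
      have e : c.timeDiff y ys (n + 1) = c.timeDiff y ys n := by
        rw [timeDiff_succ, min_eq_right hcut.le, min_eq_right (h.hi_le n hn hcut.le)]
        ring
      rcases (h.crit.adm.nonneg n hn).eq_or_lt with h0 | h0
      · exact Or.inl (h.settled_of_eq_zero hD0 hn h0.symm e h1)
      · refine Or.inr (Or.inr (Or.inr ⟨by omega, ⟨n, by omega, he, hcut, fun i h2 h3 => ?_⟩, ?_⟩))
        · obtain rfl : i = n := by omega
          exact h0
        · rw [e]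
          exact h1
    · rcases hs with h1 | h1 | ⟨-, ⟨a, han, ha, hcut, hpos⟩, h2⟩ | ⟨h1, -⟩
      · exact simple hle (Or.inl h1)
      · exact simple hle (Or.inr h1)
      · have h3 := h.crit.hi_le_of_cut h.not_cheap h.le_p han hn ha he hcut hpos
        have h4 := le_antisymm (h.hi_le n hn h3) (h.le_hi n hn hle)
        have e : c.timeDiff y ys (n + 1) = c.timeDiff y ys n := by
          rw [timeDiff_succ, ← h4, le_antisymm hle h3]
          ring
        rcases (h.crit.adm.nonneg n hn).eq_or_lt with h0 | h0
        · exact Or.inl (h.settled_of_eq_zero hD0 hn h0.symm e h2)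
        · refine Or.inr (Or.inr (Or.inr ⟨by omega, ⟨a, by omega, ha, hcut, fun i h5 h6 => ?_⟩, ?_⟩))
          · rcases Nat.lt_succ_iff_lt_or_eq.1 h6 with h7 | rfl
            · exact hpos i h5 h7
            · exact h0
          · rw [e]
            exact h2
      · omega
  · have hle := h.crit.adm.hi n hn ho
    rcases hs with h1 | h1 | ⟨h1, -⟩ | ⟨-, ⟨a, han, ha, hcut, hpos⟩, h2⟩
    · exact simple hle (Or.inl h1)
    · exact simple hle (Or.inr h1)
    · omega
    -- An eclipse behind a cut has increment below `γ` for `y`, hence increment 0 for `ys`, and the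
    -- `ys` terms cancel. What `y` consumes is at most its final slope times the increment, thus at
    -- most `t` times the time gained.
    · obtain ⟨k, rfl⟩ : ∃ k, n = k + 1 := ⟨n - 1, by omega⟩
      have hle' := h.crit.adm.le_succ hn ho
      have hpos' : ∀ i, a ≤ i → i < k + 1 + 1 → 0 < y (i + 1) := by
        intro i h5 h6
        rcases Nat.lt_succ_iff_lt_or_eq.1 h6 with h7 | rfl
        · exact hpos i h5 h7
        · exact (hpos k (by omega) (by omega)).trans_le hle'
      refine Or.inr (Or.inr (Or.inl ⟨by omega, ⟨a, by omega, ha, hcut, hpos'⟩, ?_⟩))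
      have h3 := h.crit.slope_sub_le_of_cut (r := k + 1 + 1) (by omega) ha (by omega) hcut hpos'
        (i := k + 1) (by omega) (by omega) ho
      have y0 := h.crit.adm.nonneg k (by omega)
      have y1 := h.crit.adm.le_one (k + 1) hn
      have h4 := le_slope_sub c.a_pos y0 hle' y1
      have h5 : inc y (k + 1) < γ := by
        by_contra! hge
        have := mul_le_mul_of_nonneg_left hge (curvLower_pos c.a_pos).le
        simp only [inc] at this
        linarith [h.small]
      have h6 : inc ys (k + 1) ≤ 0 := by
        by_contra! hlt
        exact absurd (h.inc_pos (k + 1) hn hlt) (not_le.2 h5)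
      have hles := h.adm.le_succ hn ho
      have h7 : ys (k + 1 + 1) = ys (k + 1) := by simp only [inc] at h6; linarith
      have hz : inc ys (k + 1) = 0 := by simp only [inc]; linarith
      have h8 : cycleLife c.a (y (k + 1 + 1)) - cycleLife c.a (y (k + 1)) ≤
          t * inc y (k + 1) := by
        rcases (h.crit.adm.lo (k + 1) hn).eq_or_lt with hlo | hlo
        · have := c.lo_nonneg (k + 1) hn ho
          have := h.adm.lo (k + 1) hn
          have e : inc y (k + 1) = 0 := by linarith
          have e' : y (k + 1 + 1) = y (k + 1) := by simp only [inc] at e; linarith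
          rw [e, e']
          simp
        · refine (cycleLife_sub_le c.a_pos y0 (hle'.trans y1) (y0.trans hle') y1).trans ?_
          exact mul_le_mul_of_nonneg_right (ht' (k + 1) hn ho hlo) (sub_nonneg.2 hle')
      have e1 : ((-1 : ℝ)) ^ (k + 1) = -1 := Odd.neg_one_pow (by rw [Nat.odd_iff]; omega)
      have e2 : ((-1 : ℝ)) ^ (k + 1 + 1) = 1 := Even.neg_one_pow (by rw [Nat.even_iff]; omega)
      rw [objDiff_succ, objDiff_succ, timeDiff_succ, min_eq_left hle,
        min_eq_left (h.le_hi (k + 1) hn hle), e1, e2, h7, hz]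
      simp only [Nat.add_sub_cancel] at h2
      push_cast
      linarith

/-- At the end of the chain the price multiplies the difference of total times, which is zero. -/
theorem obj_sub_le (h : c.Nearby y g ys ω γ p) (hT : c.time ys = c.T) :
    c.obj y - c.obj ys ≤ 2 * c.J * c.groupConst γ * ω ^ 2 := by
  obtain ⟨t, ht, ht'⟩ := h.crit.exists_price h.time_eq
  have hst : ∀ n ≤ 2 * c.J, c.State y ys t (c.groupConst γ * ω ^ 2) n := by
    intro n
    induction n with
    | zero =>
      intro _
      refine Or.inl ⟨by rw [h.crit.adm.base, h.adm.base], ?_⟩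
      simp [objDiff, timeDiff]
    | succ n ih =>
      intro hn
      exact h.state_succ ht ht' rfl (by omega) (ih (by omega))
  have h1 := h.objDiff_le_of_state_end ht rfl le_rfl (by omega) (fun hlt => absurd hlt (lt_irrefl _))
    (hst (2 * c.J) le_rfl)
  have h2 : c.timeDiff y ys (2 * c.J) = 0 := by
    have : c.timeDiff y ys (2 * c.J) = c.time y - c.time ys := by
      unfold timeDiff time
      rw [← Finset.sum_sub_distrib]
      exact Finset.sum_congr rfl fun i _ => by ring
    rw [this, h.time_eq, hT, sub_self]
  have h3 : c.objDiff y ys 0 (2 * c.J) = c.obj y - c.obj ys := by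
    unfold objDiff obj
    rw [← Finset.sum_sub_distrib, Finset.range_eq_Ico]
    exact Finset.sum_congr rfl fun i _ => by ring
  rw [h2, h3] at h1
  push_cast at h1
  linarith

end Nearby

/-- Łojasiewicz inequality with exponent `1/2` for the objective at almost critical points. -/
theorem IsAdm.exists_obj_sub_le (hys : c.IsAdm ys) (hT : c.time ys = c.T) (hp0 : 0 < p) :
    ∃ ρ > 0, ∃ C ≥ 0, ∀ y g ω, c.NearCrit y g ω → ¬ c.CheapTime y g p → ω ≤ ρ →
      (∀ i < 2 * c.J, |y (i + 1) - ys (i + 1)| ≤ ρ) → c.obj y - c.obj ys ≤ C * ω ^ 2 := by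
  have hloj : ∀ᶠ γ in 𝓝[>] (0 : ℝ), ∀ a ∈ Finset.range (2 * c.J + 1),
      ∀ r ∈ Finset.range (2 * c.J + 1), ∀ q, |q| ≤ γ →
      γ * ∑ i ∈ Finset.Ico a r, (-1) ^ (i + 1) * (cycleLife c.a (ys (i + 1) + q)
        - cycleLife c.a (ys (i + 1))) ≤
      (∑ i ∈ Finset.Ico a r, (-1) ^ (i + 1) * cycleLifeSlope c.a (ys (i + 1) + q)) ^ 2 := by
    rw [Filter.eventually_all_finset]
    intro a _
    rw [Filter.eventually_all_finset]
    intro r _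
    exact eventually_mul_sum_le_sq c.a (Finset.Ico a r) (fun i => (-1) ^ (i + 1))
      (fun i => ys (i + 1))
  -- Depths may move by `γ` and increments by `2 * γ`. Taking `γ` below a third of every positive
  -- slack and every positive increment of `ys` ensures that no new bound becomes active and that
  -- positive increments stay at least `γ`.
  obtain ⟨γ₁, hγ₁⟩ := c.exists_gap ys
  obtain ⟨γ, ⟨h1, h2⟩, h3, hγ0⟩ := ((hloj.and (eventually_le_of_pos (2 * c.J)
    (fun i => inc ys i / 3))).and ((show ∀ᶠ γ in 𝓝[>] (0 : ℝ), γ < γ₁ / 3 from by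
      filter_upwards [Ioo_mem_nhdsGT (show 0 < γ₁ / 3 by linarith [hγ₁.pos])] with γ h using h.2).and
      self_mem_nhdsWithin)).exists
  have hγ0 : 0 < γ := hγ0
  have hm := mul_pos (curvLower_pos c.a_pos) hγ0
  set N : ℝ := 2 * c.J with hN
  have hN0 : 0 ≤ N := by positivity
  set ρ := min γ (min (p / (N + 1)) (curvLower c.a * γ / (N + 1) / 2)) with hρ
  have hρ0 : 0 < ρ := lt_min hγ0 (lt_min (by positivity) (by positivity))
  refine ⟨ρ, hρ0, 2 * c.J * c.groupConst γ,
    mul_nonneg (by positivity) (c.groupConst_nonneg hγ0), fun y g ω h hch hω hcl => ?_⟩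
  have hcl' : ∀ i < 2 * c.J, |y (i + 1) - ys (i + 1)| ≤ γ := fun i hi =>
    (hcl i hi).trans (min_le_left _ _)
  have hcl0 : ∀ i ≤ 2 * c.J, |y i - ys i| ≤ γ := by
    intro i hi
    cases i with
    | zero => rw [h.adm.base, hys.base, sub_self, abs_zero]; exact hγ0.le
    | succ i => exact hcl' i (by omega)
  have hinc : ∀ i < 2 * c.J, |inc y i - inc ys i| ≤ 2 * γ := by
    intro i hi
    have a1 := abs_le.1 (hcl0 i hi.le)
    have a2 := abs_le.1 (hcl' i hi)
    simp only [inc]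
    rw [abs_le]
    constructor <;> linarith [a1.1, a1.2, a2.1, a2.2]
  have hω1 : N * ω ≤ p := by
    have : ω ≤ p / (N + 1) := hω.trans ((min_le_right _ _).trans (min_le_left _ _))
    rw [le_div_iff₀ (by positivity)] at this
    nlinarith [h.ω_nonneg]
  have hω2 : N * ω < curvLower c.a * γ := by
    have : ω ≤ curvLower c.a * γ / (N + 1) / 2 :=
      hω.trans ((min_le_right _ _).trans (min_le_right _ _))
    rw [div_div, le_div_iff₀ (by positivity)] at this
    nlinarith [h.ω_nonneg]
  refine Nearby.obj_sub_le (g := g) (p := p) ⟨h, h.time_eq hch hp0.le, hch, hω1, hys, hγ0, hω2,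
    hcl', fun i hi hz => ?_, fun i hi hz => ?_, fun i hi hz => ?_, fun i hi hz => ?_,
    fun i hi hz => ?_, fun i hi hz => ?_, fun a ha r hr q hq =>
    h1 a (Finset.mem_range.2 (by omega)) r (Finset.mem_range.2 (by omega)) q hq⟩ hT
  · by_contra hne
    have h4 := hγ₁.nonneg i hi (lt_of_le_of_ne (hys.nonneg i hi) (Ne.symm hne))
    linarith [(abs_le.1 (hcl' i hi)).1]
  · by_contra hne
    have h4 := hγ₁.le_one i hi (lt_of_le_of_ne (hys.le_one i hi) hne)
    linarith [(abs_le.1 (hcl' i hi)).2]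
  · by_contra hne
    have h4 := hγ₁.lo i hi (lt_of_le_of_ne (hys.lo i hi) (Ne.symm hne))
    linarith [(abs_le.1 (hinc i hi)).1]
  · by_contra! hlt
    linarith [hγ₁.hi' i hi hlt, (abs_le.1 (hinc i hi)).1]
  · by_contra! hlt
    linarith [hγ₁.hi i hi hlt, (abs_le.1 (hinc i hi)).2]
  · have := h2 i hi (by positivity)
    linarith [(abs_le.1 (hinc i hi)).1]

end Chain

/-! ### Finite length of descent sequences. -/

/-- Finite length of a descent sequence that obeys a Łojasiewicz inequality with exponent `1/2`
near one of its cluster points. Here `A l` is the distance to the cluster point, `b l` the length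
of step `l` and `F l` the excess of the objective. -/
theorem tendsto_zero_of_descent {A b F : ℕ → ℝ} {α C ρ : ℝ} (hα : 0 < α) (hC : 0 ≤ C) (hρ : 0 < ρ)
    (hA : ∀ l, 0 ≤ A l) (hAb : ∀ l, A (l + 1) ≤ A l + b l) (hF : Tendsto F atTop (𝓝 0))
    (hF0 : ∀ l, 0 ≤ F l) (hdec : ∀ l, α * b l ^ 2 ≤ F l - F (l + 1))
    (hKL : ∀ᶠ l in atTop, A (l + 1) ≤ ρ → F (l + 1) ≤ C * (F l - F (l + 1)))
    (hfreq : ∀ ε > 0, ∃ᶠ l in atTop, A l ≤ ε) : Tendsto A atTop (𝓝 0) := by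
  -- While the sequence stays near the cluster point, `F` contracts by the factor `C / (1 + C)`, so
  -- its square root contracts by `r`.
  set r := √(C / (1 + C)) with hr
  have hr0 : 0 ≤ r := Real.sqrt_nonneg _
  have hr1 : r < 1 := by
    rw [hr, Real.sqrt_lt' one_pos, one_pow, div_lt_one (by linarith)]
    linarith
  set s := 1 / √α with hs
  have hs0 : 0 < s := by positivity
  -- The added term bounds the length of all remaining steps by a geometric series. Thus `V` does
  -- not increase near the cluster point, which keeps the sequence there.
  set V : ℕ → ℝ := fun l => A l + s * √(F l) / (1 - r) with hV
  have hr1' : 0 < 1 - r := by linarith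
  have hb : ∀ l, b l ≤ s * √(F l) := by
    intro l
    have h1 : α * b l ^ 2 ≤ F l := by linarith [hdec l, hF0 (l + 1)]
    have h2 : b l ^ 2 ≤ F l / α := by rw [le_div_iff₀ hα]; linarith
    have h3 := Real.le_sqrt_of_sq_le h2
    rw [Real.sqrt_div (hF0 l)] at h3
    rw [hs, one_div_mul_eq_div]
    exact h3
  have hG : Tendsto (fun l => s * √(F l) / (1 - r)) atTop (𝓝 0) := by
    have := ((Real.continuous_sqrt.tendsto 0).comp hF).const_mul s
    have := this.div_const (1 - r)
    simpa using this
  rw [Metric.tendsto_atTop]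
  intro ε hε
  set δ := min ρ (ε / 2) with hδ
  have hδ0 : 0 < δ := lt_min hρ (by linarith)
  obtain ⟨L, hL⟩ := eventually_atTop.1 hKL
  have hev : ∀ᶠ l in atTop, L ≤ l ∧ s * √(F l) / (1 - r) < δ / 2 :=
    (eventually_ge_atTop L).and (hG.eventually (gt_mem_nhds (by linarith)))
  obtain ⟨l₀, h1, h2, h3⟩ := ((hfreq (δ / 2) (by linarith)).and_eventually hev).exists
  have key : ∀ l ≥ l₀, V l ≤ δ := by
    intro l hl
    induction l, hl using Nat.le_induction with
    | base => simp only [hV]; linarith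
    | succ l hl ih =>
      have hsG : 0 ≤ s * √(F l) := by positivity
      have h4 : s * √(F l) ≤ s * √(F l) / (1 - r) := by
        rw [le_div_iff₀ hr1']
        nlinarith
      have h5 : A (l + 1) ≤ ρ := by
        have := hAb l
        have := hb l
        have : V l ≤ ρ := ih.trans (min_le_left _ _)
        simp only [hV] at this
        linarith
      have h6 := hL l (by omega) h5
      have h7 : F (l + 1) ≤ C / (1 + C) * F l := by
        rw [div_mul_eq_mul_div, le_div_iff₀ (by linarith)]
        linarith
      have h8 : √(F (l + 1)) ≤ r * √(F l) := by
        rw [hr, ← Real.sqrt_mul (by positivity)]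
        exact Real.sqrt_le_sqrt h7
      refine le_trans ?_ ih
      simp only [hV]
      have h9 : s * √(F (l + 1)) / (1 - r) ≤ s * (r * √(F l)) / (1 - r) := by gcongr
      have h10 : s * √(F l) + s * (r * √(F l)) / (1 - r) = s * √(F l) / (1 - r) := by
        field_simp
        ring
      linarith [hAb l, hb l]
  refine ⟨l₀, fun l hl => ?_⟩
  rw [Real.dist_eq, sub_zero, abs_of_nonneg (hA l)]
  have h4 := key l hl
  have h5 : 0 ≤ s * √(F l) / (1 - r) := by positivity
  have h6 : δ ≤ ε / 2 := min_le_right _ _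
  simp only [hV] at h4
  linarith

/-! ### The concave-convex procedure on chains. -/

namespace Chain

variable {c : Chain}

/-- The distance of two sequences on the entries that matter. -/
noncomputable def gap (c : Chain) (z y : ℕ → ℝ) : ℝ :=
  ∑ i ∈ Finset.range (2 * c.J), |y (i + 1) - z (i + 1)|

/-- The gradient at `y` of the surrogate built at `z`. -/
noncomputable def surrogateGrad (c : Chain) (z y : ℕ → ℝ) (i : ℕ) : ℝ :=
  if i % 2 = 0 then cycleLifeSlope c.a (y i) else -cycleLifeSlope c.a (z i)

/-- `y` is feasible. -/
def IsFeasible (c : Chain) (y : ℕ → ℝ) : Prop := c.IsAdm y ∧ c.T ≤ c.time y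

/-- First order optimality of `y` for the surrogate built at `z`. -/
def IsSurrogateCrit (c : Chain) (z y : ℕ → ℝ) : Prop :=
  c.IsFeasible y ∧ ∀ y', c.IsFeasible y' → 0 ≤ c.lin (c.surrogateGrad z y) y y'

variable {z y : ℕ → ℝ}

theorem gap_nonneg (c : Chain) (z y : ℕ → ℝ) : 0 ≤ c.gap z y :=
  Finset.sum_nonneg fun _ _ => abs_nonneg _

theorem abs_sub_le_gap {i : ℕ} (hi : i < 2 * c.J) : |y (i + 1) - z (i + 1)| ≤ c.gap z y :=
  Finset.single_le_sum (f := fun i => |y (i + 1) - z (i + 1)|) (fun _ _ => abs_nonneg _)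
    (Finset.mem_range.2 hi)

/-- The surrogate gradient is exact at the ends of eclipses and taken at the previous iterate at
their starts, so the criticality error is controlled by the step length. -/
theorem IsSurrogateCrit.nearCrit (h : c.IsSurrogateCrit z y) (hz : c.IsFeasible z) :
    c.NearCrit y (c.surrogateGrad z y) (curvUpper c.a * c.gap z y) where
  adm := h.1.1
  time_ge := h.1.2
  vi y' h1 h2 := h.2 y' ⟨h1, h2⟩
  ω_nonneg := mul_nonneg (curvUpper_pos c.a_pos).le (c.gap_nonneg z y)
  odd_step i hi ho := by
    unfold surrogateGrad
    rw [if_pos (by omega)]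
  even_step i hi he := by
    unfold surrogateGrad
    rw [if_neg (by omega), neg_add_eq_sub]
    refine (abs_slope_sub_le c.a_pos (hz.1.nonneg i hi) (hz.1.le_one i hi) (h.1.1.nonneg i hi)
      (h.1.1.le_one i hi)).trans ?_
    exact mul_le_mul_of_nonneg_left (abs_sub_le_gap hi) (curvUpper_pos c.a_pos).le

/-- The constant in the sufficient decrease condition. -/
noncomputable def decreaseConst (c : Chain) : ℝ := curvLower c.a / 2 / (2 * c.J + 1)

theorem decreaseConst_pos : 0 < c.decreaseConst := by
  have := curvLower_pos c.a_pos
  unfold decreaseConst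
  positivity

/-- At eclipse ends the strong convexity of the convex part is used at the new point; at eclipse
starts that of the subtracted part is used at the old point. -/
theorem IsSurrogateCrit.decrease (h : c.IsSurrogateCrit z y) (hz : c.IsFeasible z) :
    c.decreaseConst * c.gap z y ^ 2 ≤ c.obj z - c.obj y := by
  have h0 := h.2 z hz
  have h1 : c.gap z y ^ 2 ≤ (2 * c.J + 1) *
      ∑ i ∈ Finset.range (2 * c.J), (y (i + 1) - z (i + 1)) ^ 2 := by
    have := sq_sum_le_card_mul_sum_sq (s := Finset.range (2 * c.J))
      (f := fun i => |y (i + 1) - z (i + 1)|)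
    simp only [Finset.card_range, sq_abs] at this
    push_cast at this
    refine this.trans (mul_le_mul_of_nonneg_right (by linarith) ?_)
    exact Finset.sum_nonneg fun _ _ => sq_nonneg _
  have h2 : curvLower c.a / 2 * ∑ i ∈ Finset.range (2 * c.J), (y (i + 1) - z (i + 1)) ^ 2 +
      c.lin (c.surrogateGrad z y) y z ≤ c.obj z - c.obj y := by
    unfold lin obj
    rw [Finset.mul_sum, ← Finset.sum_add_distrib, ← Finset.sum_sub_distrib]
    refine Finset.sum_le_sum fun i hi => ?_
    rw [Finset.mem_range] at hi
    have y0 := h.1.1.nonneg i hi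
    have y1 := h.1.1.le_one i hi
    have z0 := hz.1.nonneg i hi
    have z1 := hz.1.le_one i hi
    unfold surrogateGrad
    rcases Nat.mod_two_eq_zero_or_one i with he | ho
    · rw [if_neg (by omega), Odd.neg_one_pow (by rw [Nat.odd_iff]; omega)]
      have := tangent_add_sq_le_cycleLife c.a_pos z0 z1 y0 y1
      linarith
    · rw [if_pos (by omega), Even.neg_one_pow (by rw [Nat.even_iff]; omega)]
      have := tangent_add_sq_le_cycleLife c.a_pos y0 y1 z0 z1
      linarith
  have h3 : c.decreaseConst * c.gap z y ^ 2 ≤ curvLower c.a / 2 *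
      ∑ i ∈ Finset.range (2 * c.J), (y (i + 1) - z (i + 1)) ^ 2 := by
    refine (mul_le_mul_of_nonneg_left h1 c.decreaseConst_pos.le).trans (le_of_eq ?_)
    unfold decreaseConst
    field_simp
  linarith

theorem continuous_obj (c : Chain) : Continuous c.obj := by
  refine continuous_finsetSum _ fun i _ => continuous_const.mul ?_
  exact (continuous_cycleLife c.a).comp (continuous_apply (i + 1))

theorem continuous_inc (i : ℕ) : Continuous fun y : ℕ → ℝ => inc y i :=
  (continuous_apply (i + 1)).sub (continuous_apply i)

theorem continuous_time (c : Chain) : Continuous c.time :=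
  continuous_finsetSum _ fun i _ => ((continuous_inc i).min continuous_const).sub continuous_const

theorem isClosed_isFeasible (c : Chain) : IsClosed {y | c.IsFeasible y} := by
  have : {y | c.IsFeasible y} = {y | y 0 = c.base} ∩ (⋂ i, ⋂ _ : i < 2 * c.J, {y | c.lo i ≤ inc y i})
      ∩ (⋂ i, ⋂ _ : i < 2 * c.J, ⋂ _ : i % 2 = 1, {y | inc y i ≤ c.hi i})
      ∩ (⋂ i, ⋂ _ : i < 2 * c.J, {y | 0 ≤ y (i + 1)})
      ∩ (⋂ i, ⋂ _ : i < 2 * c.J, {y | y (i + 1) ≤ 1}) ∩ {y | c.T ≤ c.time y} := by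
    ext y
    simp only [Set.mem_ofPred_eq, Set.mem_inter_iff, Set.mem_iInter]
    exact ⟨fun h => ⟨⟨⟨⟨⟨h.1.base, h.1.lo⟩, h.1.hi⟩, h.1.nonneg⟩, h.1.le_one⟩, h.2⟩,
      fun h => ⟨⟨h.1.1.1.1.1, h.1.1.1.1.2, h.1.1.1.2, h.1.1.2, h.1.2⟩, h.2⟩⟩
  rw [this]
  refine ((((?_ : IsClosed _).inter ?_).inter ?_).inter ?_).inter ?_ |>.inter ?_
  · exact isClosed_eq (continuous_apply 0) continuous_const
  · exact isClosed_iInter fun i => isClosed_iInter fun _ =>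
      isClosed_le continuous_const (continuous_inc i)
  · exact isClosed_iInter fun i => isClosed_iInter fun _ => isClosed_iInter fun _ =>
      isClosed_le (continuous_inc i) continuous_const
  · exact isClosed_iInter fun i => isClosed_iInter fun _ =>
      isClosed_le continuous_const (continuous_apply (i + 1))
  · exact isClosed_iInter fun i => isClosed_iInter fun _ =>
      isClosed_le (continuous_apply (i + 1)) continuous_const
  · exact isClosed_le continuous_const c.continuous_time

/-- Entries beyond `2 * c.J` are fixed to zero because sequences carry the product topology. The
initial depth is not confined to the unit interval, so the box is enlarged to contain it. -/
theorem isCompact_feasible (c : Chain) :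
    IsCompact {y | c.IsFeasible y ∧ ∀ i, 2 * c.J < i → y i = 0} := by
  have hK : IsCompact (Set.pi Set.univ fun _ : ℕ => Set.Icc (min 0 c.base) (max 1 c.base)) :=
    isCompact_univ_pi fun _ => isCompact_Icc
  refine hK.of_isClosed_subset ?_ ?_
  · refine c.isClosed_isFeasible.inter (?_ : IsClosed {y : ℕ → ℝ | ∀ i, 2 * c.J < i → y i = 0})
    simp only [Set.ofPred_forall]
    exact isClosed_iInter fun i => isClosed_iInter fun _ =>
      isClosed_eq (continuous_apply i) continuous_const
  · rintro y ⟨⟨h, -⟩, h0⟩ i -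
    rcases Nat.eq_zero_or_pos i with rfl | hpos
    · rw [h.base]
      exact ⟨min_le_right _ _, le_max_right _ _⟩
    · rcases lt_or_ge (2 * c.J) i with hi | hi
      · rw [h0 i hi]
        exact ⟨min_le_left _ _, le_max_of_le_left zero_le_one⟩
      · exact ⟨(min_le_left _ _).trans (h.nonneg' hi hpos.ne'),
          (h.le_one' hi hpos.ne').trans (le_max_left _ _)⟩

/-- A run of the concave-convex procedure on chains has a cluster point, the objective converges
to its value there, and the steps tend to zero. -/
theorem exists_cluster (c : Chain) (y : ℕ → ℕ → ℝ) (h0 : c.IsFeasible (y 0))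
    (hy : ∀ l, c.IsSurrogateCrit (y l) (y (l + 1))) (hz : ∀ l i, 2 * c.J < i → y l i = 0) :
    ∃ ys, c.IsFeasible ys ∧ (∀ i, 2 * c.J < i → ys i = 0) ∧
      (∃ φ : ℕ → ℕ, StrictMono φ ∧ Tendsto (y ∘ φ) atTop (𝓝 ys)) ∧
      Antitone (fun l => c.obj (y l) - c.obj ys) ∧
      Tendsto (fun l => c.obj (y l) - c.obj ys) atTop (𝓝 0) ∧
      Tendsto (fun l => c.gap (y l) (y (l + 1))) atTop (𝓝 0) := by
  have hfeas : ∀ l, c.IsFeasible (y l) := fun l => by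
    cases l with
    | zero => exact h0
    | succ l => exact (hy l).1
  have hdec : ∀ l, c.decreaseConst * c.gap (y l) (y (l + 1)) ^ 2 ≤
      c.obj (y l) - c.obj (y (l + 1)) := fun l => (hy l).decrease (hfeas l)
  have hα := c.decreaseConst_pos
  obtain ⟨ys, ⟨hys, hys0⟩, φ, hφ, hlim⟩ :=
    c.isCompact_feasible.tendsto_subseq (fun l => ⟨hfeas l, hz l⟩ :
      ∀ l, y l ∈ {y | c.IsFeasible y ∧ ∀ i, 2 * c.J < i → y i = 0})
  set F : ℕ → ℝ := fun l => c.obj (y l) - c.obj ys with hF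
  have hanti : Antitone F := antitone_nat_of_succ_le fun l => by
    have := hdec l
    have : 0 ≤ c.decreaseConst * c.gap (y l) (y (l + 1)) ^ 2 := by positivity
    simp only [hF]
    linarith
  have hFlim : Tendsto F atTop (𝓝 0) := by
    rw [tendsto_iff_tendsto_subseq_of_antitone hanti hφ.tendsto_atTop]
    have := ((c.continuous_obj.tendsto ys).comp hlim).sub_const (c.obj ys)
    rw [sub_self] at this
    exact this
  have hb : Tendsto (fun l => c.gap (y l) (y (l + 1))) atTop (𝓝 0) := by
    have h1 : Tendsto (fun l => c.gap (y l) (y (l + 1)) ^ 2) atTop (𝓝 0) := by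
      have h2 : Tendsto (fun l => (F l - F (l + 1)) / c.decreaseConst) atTop (𝓝 0) := by
        have := (hFlim.sub (hFlim.comp (tendsto_add_atTop_nat 1))).div_const c.decreaseConst
        simpa using this
      refine squeeze_zero (fun l => sq_nonneg _) (fun l => ?_) h2
      rw [le_div_iff₀ hα, mul_comm]
      simp only [hF]
      linarith [hdec l]
    have h3 := (Real.continuous_sqrt.tendsto 0).comp h1
    rw [Real.sqrt_zero] at h3
    refine h3.congr fun l => ?_
    exact Real.sqrt_sq (c.gap_nonneg _ _)
  exact ⟨ys, hys, hys0, ⟨φ, hφ, hlim⟩, hanti, hFlim, hb⟩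

/-- Convergence of the concave-convex procedure on chains. -/
theorem exists_tendsto (c : Chain) (y : ℕ → ℕ → ℝ) (h0 : c.IsFeasible (y 0))
    (hy : ∀ l, c.IsSurrogateCrit (y l) (y (l + 1))) (hz : ∀ l i, 2 * c.J < i → y l i = 0)
    (hmove : ∀ l, 0 < c.gap (y l) (y (l + 1))) :
    ∃ ys, Tendsto y atTop (𝓝 ys) ∧ ∀ᶠ l in atTop, c.time (y l) = c.T := by
  have hfeas : ∀ l, c.IsFeasible (y l) := fun l => by
    cases l with
    | zero => exact h0
    | succ l => exact (hy l).1
  have hdec : ∀ l, c.decreaseConst * c.gap (y l) (y (l + 1)) ^ 2 ≤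
      c.obj (y l) - c.obj (y (l + 1)) := fun l => (hy l).decrease (hfeas l)
  have hα := c.decreaseConst_pos
  have hM := curvUpper_pos c.a_pos
  have hcrit := fun l => (hy l).nearCrit (hfeas l)
  obtain ⟨ys, hys, hys0, ⟨φ, hφ, hlim⟩, hanti, hFlim, hb⟩ := c.exists_cluster y h0 hy hz
  set F : ℕ → ℝ := fun l => c.obj (y l) - c.obj ys with hF
  have hF0 : ∀ l, 0 ≤ F l := fun l => hanti.le_of_tendsto hFlim l
  have hω : Tendsto (fun l => curvUpper c.a * c.gap (y l) (y (l + 1))) atTop (𝓝 0) := by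
    simpa using hb.const_mul (curvUpper c.a)
  obtain ⟨p, hp0, hp⟩ := c.exists_isGlobalMin_of_cheapTime
  have hnotcheap : ∀ᶠ l in atTop,
      ¬ c.CheapTime (y (l + 1)) (c.surrogateGrad (y l) (y (l + 1))) p := by
    have h1 : Tendsto (fun l => 2 * c.J * (curvUpper c.a * c.gap (y l) (y (l + 1)))) atTop
        (𝓝 0) := by
      simpa using hω.const_mul (2 * (c.J : ℝ))
    -- Cheap time would make `y (l + 1)` a global minimizer, but the next step strictly decreases
    -- the objective since it moves.
    filter_upwards [h1.eventually (gt_mem_nhds hp0)] with l hl hcheap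
    have h2 := hp _ _ _ (hcrit l) hl.le hcheap _ (hfeas (l + 2)).1
    have h3 := hdec (l + 1)
    have h4 := hmove (l + 1)
    have h5 : 0 < c.decreaseConst * c.gap (y (l + 1)) (y (l + 1 + 1)) ^ 2 := by positivity
    rw [show l + 2 = l + 1 + 1 by ring] at h2
    linarith
  have htime : ∀ᶠ l in atTop, c.time (y l) = c.T := by
    obtain ⟨L, hL⟩ := eventually_atTop.1 hnotcheap
    filter_upwards [eventually_ge_atTop (L + 1)] with l hl
    obtain ⟨k, rfl⟩ := Nat.exists_eq_succ_of_ne_zero (show l ≠ 0 by omega)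
    exact (hcrit k).time_eq (hL k (by omega)) hp0.le
  have hTs : c.time ys = c.T := by
    refine tendsto_nhds_unique ((c.continuous_time.tendsto ys).comp hlim) ?_
    refine tendsto_const_nhds.congr' ?_
    filter_upwards [hφ.tendsto_atTop.eventually htime] with l hl using hl.symm
  obtain ⟨ρ, hρ, C, hC, hKL⟩ := hys.1.exists_obj_sub_le hTs hp0
  refine ⟨ys, ?_, htime⟩
  have hA : Tendsto (fun l => c.gap ys (y l)) atTop (𝓝 0) := by
    refine tendsto_zero_of_descent (b := fun l => c.gap (y l) (y (l + 1))) (F := F)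
      (C := C * curvUpper c.a ^ 2 / c.decreaseConst) hα (by positivity) hρ
      (fun l => c.gap_nonneg _ _) (fun l => ?_) hFlim hF0
      (fun l => by simp only [hF]; linarith [hdec l]) ?_ (fun ε hε => ?_)
    · unfold gap
      rw [← Finset.sum_add_distrib]
      refine Finset.sum_le_sum fun i _ => ?_
      linarith [abs_sub_le (y (l + 1) (i + 1)) (y l (i + 1)) (ys (i + 1))]
    · filter_upwards [hnotcheap, hω.eventually (gt_mem_nhds hρ)] with l h1 h2 h3
      have h4 := hKL _ _ _ (hcrit l) h1 h2.le fun i hi => (abs_sub_le_gap hi).trans h3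
      refine h4.trans ?_
      have h5 := mul_le_mul_of_nonneg_left (hdec l)
        (show 0 ≤ C * curvUpper c.a ^ 2 / c.decreaseConst by positivity)
      have e : C * curvUpper c.a ^ 2 / c.decreaseConst *
          (c.decreaseConst * c.gap (y l) (y (l + 1)) ^ 2) =
          C * (curvUpper c.a * c.gap (y l) (y (l + 1))) ^ 2 := by
        field_simp
      rw [e] at h5
      simp only [hF]
      rw [sub_sub_sub_cancel_right]
      exact h5
    · have hc : Continuous fun y => c.gap ys y :=
        continuous_finsetSum _ fun i _ => ((continuous_apply (i + 1)).sub continuous_const).abs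
      have h1 := (hc.tendsto ys).comp hlim
      have h2 : c.gap ys ys = 0 := by simp [gap]
      rw [h2] at h1
      exact hφ.tendsto_atTop.frequently
        ((h1.eventually (gt_mem_nhds hε)).frequently.mono fun l hl => le_of_lt hl)
  rw [tendsto_pi_nhds]
  intro i
  rcases Nat.eq_zero_or_pos i with rfl | hpos
  · simp only [(hfeas _).1.base, hys.1.base]
    exact tendsto_const_nhds
  rcases lt_or_ge (2 * c.J) i with hi | hi
  · simp only [hz _ i hi, hys0 i hi]
    exact tendsto_const_nhds
  · obtain ⟨k, rfl⟩ := Nat.exists_eq_succ_of_ne_zero hpos.ne'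
    rw [tendsto_iff_dist_tendsto_zero]
    exact squeeze_zero (fun _ => dist_nonneg)
      (fun l => by rw [Real.dist_eq]; exact abs_sub_le_gap (by omega)) hA

end Chain

/-! ### The scheduling problem: compactness, convexity and stationarity. -/

variable {J : ℕ}

/-- Extend a vector by zero to a sequence. -/
def extendZero (f : Fin J → ℝ) (k : ℕ) : ℝ := if h : k < J then f ⟨k, h⟩ else 0

theorem extendZero_apply (f : Fin J → ℝ) (j : Fin J) : extendZero f j = f j := by
  simp [extendZero]

namespace SatVar

@[fun_prop] theorem continuous_tauS (j : Fin J) : Continuous fun x : SatVar J => x.tauS j := by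
  unfold tauS; fun_prop

@[fun_prop] theorem continuous_tauE (j : Fin J) : Continuous fun x : SatVar J => x.tauE j := by
  unfold tauE; fun_prop

@[fun_prop] theorem continuous_bE (j : Fin J) : Continuous fun x : SatVar J => x.bE j := by
  unfold bE; fun_prop

@[fun_prop] theorem continuous_bSnext (j : Fin J) :
    Continuous fun x : SatVar J => x.bSnext j := by
  unfold bSnext; fun_prop

@[fun_prop] theorem continuous_dE (j : Fin J) : Continuous fun x : SatVar J => x.dE j := by
  unfold dE; fun_prop

@[fun_prop] theorem continuous_dHat (j : Fin J) : Continuous fun x : SatVar J => x.dHat j := by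
  unfold dHat; fun_prop

theorem continuous_dVec : Continuous fun x : SatVar J => x.dVec :=
  (PiLp.continuous_toLp 2 _).comp (continuous_pi fun j => continuous_dE j)

end SatVar

namespace SatData

variable (p : SatData J)

theorem continuous_bS (j : Fin J) : Continuous fun x : SatVar J => p.bS x j := by
  unfold bS
  split_ifs
  · exact continuous_const
  · exact SatVar.continuous_bSnext _

theorem isClosed_feasibleSet : IsClosed p.feasibleSet := by
  have hb := p.continuous_bS
  have : p.feasibleSet =
      (⋂ j, {x : SatVar J | x.bSnext j = x.bE j - p.EdE j - p.Pc * x.tauE j}) ∩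
      (⋂ j, {x : SatVar J |
        x.bE j ≤ min (p.bS x j + p.EhS j - p.EdS j - p.Pc * x.tauS j) p.Bmax}) ∩
      (⋂ j, {x : SatVar J | 0 ≤ p.EhS j - p.EdS j - p.Pc * x.tauS j}) ∩
      (⋂ j, {x : SatVar J | x.dE j = (p.Bmax - x.bE j) / p.Bmax}) ∩
      (⋂ j, {x : SatVar J | x.dHat j = (p.Bmax - x.bSnext j) / p.Bmax}) ∩
      {x : SatVar J | ∑ j, (x.tauS j + x.tauE j) = p.Tc} ∩
      (⋂ j, {x : SatVar J | 0 ≤ x.tauS j} ∩ {x | x.tauS j ≤ p.tE j - p.tS j.castSucc}) ∩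
      (⋂ j, {x : SatVar J | 0 ≤ x.tauE j} ∩ {x | x.tauE j ≤ p.tS j.succ - p.tE j}) ∩
      (⋂ j, {x : SatVar J | 0 ≤ x.bSnext j} ∩ {x | x.bSnext j ≤ p.Bmax}) ∩
      (⋂ j, {x : SatVar J | 0 ≤ x.bE j} ∩ {x | x.bE j ≤ p.Bmax}) := by
    ext x
    simp only [Set.mem_inter_iff, Set.mem_iInter, Set.mem_ofPred_eq]
    constructor
    · rintro ⟨h1, h2, h3, h4, h5, h6, h7, h8, h9, h10⟩
      exact ⟨⟨⟨⟨⟨⟨⟨⟨⟨h1, h2⟩, h3⟩, h4⟩, h5⟩, h6⟩, h7⟩, h8⟩, h9⟩, h10⟩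
    · rintro ⟨⟨⟨⟨⟨⟨⟨⟨⟨h1, h2⟩, h3⟩, h4⟩, h5⟩, h6⟩, h7⟩, h8⟩, h9⟩, h10⟩
      exact ⟨h1, h2, h3, h4, h5, h6, h7, h8, h9, h10⟩
  rw [this]
  refine (((((((((isClosed_iInter fun j => ?_).inter (isClosed_iInter fun j => ?_)).inter
    (isClosed_iInter fun j => ?_)).inter (isClosed_iInter fun j => ?_)).inter
    (isClosed_iInter fun j => ?_)).inter ?_).inter (isClosed_iInter fun j => ?_)).inter
    (isClosed_iInter fun j => ?_)).inter (isClosed_iInter fun j => ?_)).inter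
    (isClosed_iInter fun j => ?_)
  · exact isClosed_eq (by fun_prop) (by fun_prop)
  · refine isClosed_le (by fun_prop) (Continuous.min ?_ continuous_const)
    exact (((hb j).add continuous_const).sub continuous_const).sub (by fun_prop)
  · exact isClosed_le (by fun_prop) (by fun_prop)
  · exact isClosed_eq (by fun_prop) (by fun_prop)
  · exact isClosed_eq (by fun_prop) (by fun_prop)
  · exact isClosed_eq (by fun_prop) (by fun_prop)
  all_goals
    exact IsClosed.inter (isClosed_le (by fun_prop) (by fun_prop))
      (isClosed_le (by fun_prop) (by fun_prop))

variable {p}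

theorem IsFeasible.dE_mem {x : SatVar J} (h : p.IsFeasible x) (j : Fin J) :
    0 ≤ x.dE j ∧ x.dE j ≤ 1 := by
  have hB := p.Bmax_pos
  rw [h.dod_start j]
  exact ⟨div_nonneg (by linarith [(h.level_start j).2]) hB.le,
    (div_le_one hB).2 (by linarith [(h.level_start j).1])⟩

theorem IsFeasible.dHat_mem {x : SatVar J} (h : p.IsFeasible x) (j : Fin J) :
    0 ≤ x.dHat j ∧ x.dHat j ≤ 1 := by
  have hB := p.Bmax_pos
  rw [h.dod_end j]
  exact ⟨div_nonneg (by linarith [(h.level_end j).2]) hB.le,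
    (div_le_one hB).2 (by linarith [(h.level_end j).1])⟩

variable (p)

theorem isCompact_feasibleSet : IsCompact p.feasibleSet := by
  set U : Fin 6 × Fin J → ℝ := fun k => ![p.tE k.2 - p.tS k.2.castSucc, p.tS k.2.succ - p.tE k.2,
    p.Bmax, p.Bmax, 1, 1] k.1 with hU
  have hK : IsCompact ((WithLp.toLp 2 : (Fin 6 × Fin J → ℝ) → SatVar J) ''
      Set.pi Set.univ fun k => Set.Icc 0 (U k)) :=
    (isCompact_univ_pi fun _ => isCompact_Icc).image (PiLp.continuous_toLp 2 _)
  refine hK.of_isClosed_subset p.isClosed_feasibleSet fun x hx => ?_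
  have hx : p.IsFeasible x := hx
  refine ⟨fun k => x k, ?_, rfl⟩
  rintro ⟨k, j⟩ -
  fin_cases k
  · exact hx.time_sun j
  · exact hx.time_ecl j
  · exact hx.level_start j
  · exact hx.level_end j
  · exact hx.dE_mem j
  · exact hx.dHat_mem j

theorem convex_feasibleSet : Convex ℝ p.feasibleSet := by
  intro x hx y hy s t hs ht hst
  have hx : p.IsFeasible x := hx
  have hy : p.IsFeasible y := hy
  obtain rfl : t = 1 - s := by linarith
  have hB := p.Bmax_pos
  have hbS : ∀ j, p.bS (s • x + (1 - s) • y) j = s * p.bS x j + (1 - s) * p.bS y j := by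
    intro j
    unfold bS
    split_ifs
    · ring
    · simp [SatVar.bSnext]
  have m : ∀ {a b : ℝ}, 0 ≤ a → 0 ≤ b → 0 ≤ s * a + (1 - s) * b := fun h1 h2 =>
    add_nonneg (mul_nonneg hs h1) (mul_nonneg ht h2)
  have e0 : ∀ j, (s • x + (1 - s) • y).tauS j = s * x.tauS j + (1 - s) * y.tauS j := fun j => by
    simp [SatVar.tauS]
  have e1 : ∀ j, (s • x + (1 - s) • y).tauE j = s * x.tauE j + (1 - s) * y.tauE j := fun j => by
    simp [SatVar.tauE]
  have e2 : ∀ j, (s • x + (1 - s) • y).bE j = s * x.bE j + (1 - s) * y.bE j := fun j => by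
    simp [SatVar.bE]
  have e3 : ∀ j, (s • x + (1 - s) • y).bSnext j = s * x.bSnext j + (1 - s) * y.bSnext j :=
    fun j => by simp [SatVar.bSnext]
  have e4 : ∀ j, (s • x + (1 - s) • y).dE j = s * x.dE j + (1 - s) * y.dE j := fun j => by
    simp [SatVar.dE]
  have e5 : ∀ j, (s • x + (1 - s) • y).dHat j = s * x.dHat j + (1 - s) * y.dHat j := fun j => by
    simp [SatVar.dHat]
  refine ⟨fun j => ?_, fun j => ?_, fun j => ?_, fun j => ?_, fun j => ?_, ?_, fun j => ?_,
    fun j => ?_, fun j => ?_, fun j => ?_⟩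
  · rw [e1, e2, e3, hx.eclipse, hy.eclipse]; ring
  · rw [hbS, e0, e2]
    obtain ⟨a1, a2⟩ := le_min_iff.1 (hx.sunlight j)
    obtain ⟨b1, b2⟩ := le_min_iff.1 (hy.sunlight j)
    refine le_min ?_ ?_
    · linarith [m (sub_nonneg.2 a1) (sub_nonneg.2 b1)]
    · linarith [m (sub_nonneg.2 a2) (sub_nonneg.2 b2)]
  · rw [e0]
    linarith [m (hx.no_discharge j) (hy.no_discharge j)]
  · rw [e4, e2, hx.dod_start, hy.dod_start]; ring
  · rw [e5, e3, hx.dod_end, hy.dod_end]; ring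
  · have : ∑ j, ((s • x + (1 - s) • y).tauS j + (s • x + (1 - s) • y).tauE j) =
        s * ∑ j, (x.tauS j + x.tauE j) + (1 - s) * ∑ j, (y.tauS j + y.tauE j) := by
      rw [Finset.mul_sum, Finset.mul_sum, ← Finset.sum_add_distrib]
      refine Finset.sum_congr rfl fun j _ => ?_
      rw [e0, e1]
      ring
    rw [this, hx.total_time, hy.total_time]
    ring
  · rw [e0]
    have a := hx.time_sun j
    have b := hy.time_sun j
    exact ⟨m a.1 b.1, by linarith [m (sub_nonneg.2 a.2) (sub_nonneg.2 b.2)]⟩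
  · rw [e1]
    have a := hx.time_ecl j
    have b := hy.time_ecl j
    exact ⟨m a.1 b.1, by linarith [m (sub_nonneg.2 a.2) (sub_nonneg.2 b.2)]⟩
  · rw [e3]
    have a := hx.level_end j
    have b := hy.level_end j
    exact ⟨m a.1 b.1, by linarith [m (sub_nonneg.2 a.2) (sub_nonneg.2 b.2)]⟩
  · rw [e2]
    have a := hx.level_start j
    have b := hy.level_start j
    exact ⟨m a.1 b.1, by linarith [m (sub_nonneg.2 a.2) (sub_nonneg.2 b.2)]⟩

/-- The derivative at `x` of the surrogate built at `z`. -/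
noncomputable def surrogateDeriv (z x : SatVar J) : SatVar J →L[ℝ] ℝ :=
  ∑ j, cycleLifeSlope p.a (x.dHat j) • (EuclideanSpace.proj (5, j) : SatVar J →L[ℝ] ℝ) -
    ∑ j, cycleLifeSlope p.a (z.dE j) • (EuclideanSpace.proj (4, j) : SatVar J →L[ℝ] ℝ)

theorem surrogateDeriv_apply (z x v : SatVar J) : p.surrogateDeriv z x v =
    ∑ j, cycleLifeSlope p.a (x.dHat j) * v.dHat j - ∑ j, cycleLifeSlope p.a (z.dE j) * v.dE j := by
  simp [surrogateDeriv, SatVar.dHat, SatVar.dE]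

theorem hasFDerivAt_dHat (x : SatVar J) (j : Fin J) : HasFDerivAt (fun x : SatVar J => x.dHat j)
    (EuclideanSpace.proj (5, j) : SatVar J →L[ℝ] ℝ) x :=
  (EuclideanSpace.proj (5, j) : SatVar J →L[ℝ] ℝ).hasFDerivAt

theorem hasFDerivAt_dE (x : SatVar J) (j : Fin J) : HasFDerivAt (fun x : SatVar J => x.dE j)
    (EuclideanSpace.proj (4, j) : SatVar J →L[ℝ] ℝ) x :=
  (EuclideanSpace.proj (4, j) : SatVar J →L[ℝ] ℝ).hasFDerivAt

theorem hasFDerivAt_u (x : SatVar J) : HasFDerivAt p.u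
    (∑ j, cycleLifeSlope p.a (x.dHat j) • (EuclideanSpace.proj (5, j) : SatVar J →L[ℝ] ℝ)) x := by
  refine HasFDerivAt.fun_sum fun j _ => ?_
  exact (hasDerivAt_cycleLife p.a (x.dHat j)).comp_hasFDerivAt x (hasFDerivAt_dHat x j)

theorem hasFDerivAt_surrogate (z x : SatVar J) :
    HasFDerivAt (p.surrogate z) (p.surrogateDeriv z x) x := by
  refine (p.hasFDerivAt_u x).sub (HasFDerivAt.fun_sum fun j _ => ?_)
  exact (hasFDerivAt_dE x j).mul_const _

theorem hasFDerivAt_objective (x : SatVar J) :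
    HasFDerivAt p.objective (p.surrogateDeriv x x) x := by
  refine (p.hasFDerivAt_u x).sub (HasFDerivAt.fun_sum fun j _ => ?_)
  exact (hasDerivAt_cycleLife p.a (x.dE j)).comp_hasFDerivAt x
    (hasFDerivAt_dE x j)

theorem isStationary_iff {x : SatVar J} : p.IsStationary x ↔
    x ∈ p.feasibleSet ∧ ∀ y ∈ p.feasibleSet, 0 ≤ p.surrogateDeriv x x (y - x) := by
  unfold IsStationary
  rw [(p.hasFDerivAt_objective x).fderiv]

variable {p}

theorem deriv_nonneg_of_isMinOn {f : SatVar J → ℝ} {f' : SatVar J →L[ℝ] ℝ} {x : SatVar J}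
    (hf : HasFDerivAt f f' x) (hx : x ∈ p.feasibleSet) (hmin : IsMinOn f p.feasibleSet x)
    {y : SatVar J} (hy : y ∈ p.feasibleSet) : 0 ≤ f' (y - x) :=
  hmin.localize.hasFDerivWithinAt_nonneg hf.hasFDerivWithinAt
    (sub_mem_posTangentConeAt_of_segment_subset (p.convex_feasibleSet.segment_subset hx hy))

theorem IsSurrogateOptimal.deriv_nonneg {z x y : SatVar J} (h : p.IsSurrogateOptimal z x)
    (hy : y ∈ p.feasibleSet) : 0 ≤ p.surrogateDeriv z x (y - x) :=
  deriv_nonneg_of_isMinOn (p.hasFDerivAt_surrogate z x) h.1 (fun y hy => h.2 y hy) hy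

theorem surrogateDeriv_congr {z z' : SatVar J} (h : z.dVec = z'.dVec) (x : SatVar J) :
    p.surrogateDeriv z x = p.surrogateDeriv z' x := by
  have : ∀ j, z.dE j = z'.dE j := fun j => congrArg (fun v : EuclideanSpace ℝ (Fin J) => v j) h
  simp only [surrogateDeriv, this]

/-- The surrogate depends on `z` only through its eclipse-start depths; if these agree with those of
`x`, its gradient at `x` is that of the objective. -/
theorem IsSurrogateOptimal.isStationary {z x : SatVar J} (h : p.IsSurrogateOptimal z x)
    (hd : z.dVec = x.dVec) : p.IsStationary x :=
  p.isStationary_iff.2 ⟨h.1, fun y hy => by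
    rw [← surrogateDeriv_congr hd]
    exact h.deriv_nonneg hy⟩

theorem exists_isStationary (h : p.feasibleSet.Nonempty) : ∃ x, p.IsStationary x := by
  obtain ⟨x, hx, hmin⟩ := p.isCompact_feasibleSet.exists_isMinOn h
    (fun x _ => (p.hasFDerivAt_objective x).continuousAt.continuousWithinAt)
  exact ⟨x, p.isStationary_iff.2 ⟨hx, fun y hy =>
    deriv_nonneg_of_isMinOn (p.hasFDerivAt_objective x) hx hmin hy⟩⟩

variable (p)

theorem continuous_surrogate : Continuous fun q : SatVar J × SatVar J => p.surrogate q.1 q.2 := by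
  have h1 := continuous_cycleLife p.a
  have h2 := continuous_cycleLifeSlope p.a
  unfold surrogate u
  refine (continuous_finsetSum _ fun j _ => ?_).sub (continuous_finsetSum _ fun j _ => ?_)
  · exact h1.comp ((SatVar.continuous_dHat j).comp continuous_snd)
  · exact ((SatVar.continuous_dE j).comp continuous_snd).mul
      (h2.comp ((SatVar.continuous_dE j).comp continuous_fst))

variable {p}

theorem IsSurrogateOptimal.of_tendsto {z x : ℕ → SatVar J} {zbar xbar : SatVar J}
    (h : ∀ᶠ l in atTop, p.IsSurrogateOptimal (z l) (x l)) (hz : Tendsto z atTop (𝓝 zbar))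
    (hx : Tendsto x atTop (𝓝 xbar)) : p.IsSurrogateOptimal zbar xbar := by
  refine ⟨p.isClosed_feasibleSet.mem_of_tendsto hx (h.mono fun l hl => hl.1), fun y hy => ?_⟩
  have hc := p.continuous_surrogate
  refine le_of_tendsto_of_tendsto ((hc.tendsto (zbar, xbar)).comp (hz.prodMk_nhds hx))
    ((hc.tendsto (zbar, y)).comp (hz.prodMk_nhds tendsto_const_nhds)) ?_
  exact h.mono fun l hl => hl.2 y hy

/-- Approximate fixed points of the procedure are close to stationary points. -/
theorem exists_infDist_lt (p : SatData J) {η : ℝ} (hη : 0 < η) : ∃ ε > 0, ∀ z x : SatVar J,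
    z ∈ p.feasibleSet → p.IsSurrogateOptimal z x → ‖x.dVec - z.dVec‖ ≤ ε →
      Metric.infDist x {x | p.IsStationary x} < η := by
  by_contra! hcon
  -- Counterexamples for tolerances tending to zero would accumulate at a pair with equal depth
  -- vectors whose second entry is stationary, yet stay away from the stationary points.
  choose z x hz hx hd hfar using fun n : ℕ => hcon (1 / ((n : ℝ) + 1)) (by positivity)
  obtain ⟨⟨zbar, xbar⟩, -, φ, hφ, hlim⟩ :=
    (p.isCompact_feasibleSet.prod p.isCompact_feasibleSet).tendsto_subseq
      (x := fun n => (z n, x n)) (fun n => ⟨hz n, (hx n).1⟩)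
  have hlz : Tendsto (z ∘ φ) atTop (𝓝 zbar) := (continuous_fst.tendsto _).comp hlim
  have hlx : Tendsto (x ∘ φ) atTop (𝓝 xbar) := (continuous_snd.tendsto _).comp hlim
  have hopt := IsSurrogateOptimal.of_tendsto (Eventually.of_forall fun n => hx (φ n)) hlz hlx
  have hdv : zbar.dVec = xbar.dVec := by
    have h1 : Tendsto (fun n => ‖(x (φ n)).dVec - (z (φ n)).dVec‖) atTop
        (𝓝 ‖xbar.dVec - zbar.dVec‖) :=
      (((SatVar.continuous_dVec.tendsto _).comp hlx).sub
        ((SatVar.continuous_dVec.tendsto _).comp hlz)).norm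
    have h2 : Tendsto (fun n => 1 / (((φ n : ℕ) : ℝ) + 1)) atTop (𝓝 0) :=
      tendsto_one_div_add_atTop_nhds_zero_nat.comp hφ.tendsto_atTop
    have h3 := le_of_tendsto_of_tendsto' h1 h2 fun n => hd (φ n)
    exact (sub_eq_zero.1 (norm_le_zero_iff.1 h3)).symm
  have hst := hopt.isStationary hdv
  have h4 : Tendsto (fun n => dist (x (φ n)) xbar) atTop (𝓝 0) :=
    tendsto_iff_dist_tendsto_zero.1 hlx
  obtain ⟨n, hn⟩ := (h4.eventually (gt_mem_nhds hη)).exists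
  exact absurd ((Metric.infDist_le_dist_of_mem (by exact hst)).trans_lt hn)
    (not_lt.2 (hfar (φ n)))

end SatData

/-! ### Translation between schedules and chains. -/

namespace Chain

variable {c : Chain} {y : ℕ → ℝ}

/-- The time bought in the eclipses. -/
noncomputable def eclipseTime (c : Chain) (y : ℕ → ℝ) : ℝ :=
  ∑ j ∈ Finset.range c.J, (inc y (2 * j + 1) - c.lo (2 * j + 1))

theorem time_eq_add (h : c.IsAdm y) : c.time y = c.eclipseTime y +
    ∑ j ∈ Finset.range c.J, (min (inc y (2 * j)) (c.hi (2 * j)) - c.lo (2 * j)) := by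
  unfold time eclipseTime
  rw [sum_range_two_mul, ← Finset.sum_add_distrib]
  refine Finset.sum_congr rfl fun j hj => ?_
  rw [Finset.mem_range] at hj
  rw [min_eq_left (h.hi (2 * j + 1) (by omega) (by omega))]
  ring

theorem IsAdm.cap_nonneg (h : c.IsAdm y) {i : ℕ} (hi : i < 2 * c.J) :
    0 ≤ min (inc y i) (c.hi i) - c.lo i :=
  sub_nonneg.2 (le_min (h.lo i hi) (c.lo_le_hi i hi))

theorem IsAdm.eclipseTime_le (h : c.IsAdm y) : c.eclipseTime y ≤ c.time y := by
  rw [time_eq_add h]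
  refine le_add_of_nonneg_right (Finset.sum_nonneg fun j hj => h.cap_nonneg ?_)
  rw [Finset.mem_range] at hj
  omega

/-- Training in the eclipses can be reduced to what is needed, which lowers the depths at the
ends of the eclipses. -/
theorem IsFeasible.exists_eclipseTime_le (h : c.IsFeasible y) (hT : 0 ≤ c.T) :
    ∃ y', c.IsFeasible y' ∧ c.eclipseTime y' ≤ c.T ∧
      (∀ j < c.J, y' (2 * j + 1) = y (2 * j + 1)) ∧ ∀ j < c.J, y' (2 * j + 2) ≤ y (2 * j + 2) := by
  rcases le_or_gt (c.eclipseTime y) c.T with hE | hE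
  · exact ⟨y, h, hE, fun _ _ => rfl, fun _ _ => le_rfl⟩
  obtain ⟨hy, -⟩ := h
  -- Scaling all eclipse training by `θ` makes it equal to the required time. Start depths are kept,
  -- so the sunlight increments can only grow.
  set θ := c.T / c.eclipseTime y with hθ
  have hEpos : 0 < c.eclipseTime y := hT.trans_lt hE
  have hθ0 : 0 ≤ θ := by positivity
  have hθ1 : θ ≤ 1 := (div_le_one hEpos).2 hE.le
  set y' : ℕ → ℝ := fun i => if i = 0 then y 0 else if i % 2 = 1 then y i else
    y (i - 1) + c.lo (i - 1) + θ * (inc y (i - 1) - c.lo (i - 1)) with hy'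
  have v0 : y' 0 = y 0 := if_pos rfl
  have v1 : ∀ j, y' (2 * j + 1) = y (2 * j + 1) := fun j => by
    simp only [hy']
    rw [if_neg (by omega), if_pos (by omega)]
  have v2 : ∀ j, y' (2 * j + 2) = y (2 * j + 1) + c.lo (2 * j + 1) +
      θ * (inc y (2 * j + 1) - c.lo (2 * j + 1)) := fun j => by
    simp only [hy']
    rw [if_neg (by omega), if_neg (by omega)]
    rfl
  have i1 : ∀ j, inc y' (2 * j + 1) = c.lo (2 * j + 1) +
      θ * (inc y (2 * j + 1) - c.lo (2 * j + 1)) := fun j => by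
    have := v2 j
    simp only [inc, show 2 * j + 1 + 1 = 2 * j + 2 by ring] at this ⊢
    rw [this, v1]
    ring
  have g0 : ∀ j < c.J, 0 ≤ inc y (2 * j + 1) - c.lo (2 * j + 1) := fun j hj =>
    sub_nonneg.2 (hy.lo _ (by omega))
  have g1 : ∀ j < c.J, inc y' (2 * j + 1) ≤ inc y (2 * j + 1) := fun j hj => by
    rw [i1]
    nlinarith [g0 j hj]
  have le2 : ∀ j < c.J, y' (2 * j + 2) ≤ y (2 * j + 2) := fun j hj => by
    have := g1 j hj
    simp only [inc, show 2 * j + 1 + 1 = 2 * j + 2 by ring, v1] at this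
    linarith
  have i0 : ∀ j < c.J, inc y (2 * j) ≤ inc y' (2 * j) := fun j hj => by
    simp only [inc]
    rw [v1]
    cases j with
    | zero => simp [v0]
    | succ j =>
      have := le2 j (by omega)
      rw [show 2 * (j + 1) = 2 * j + 2 by ring]
      linarith
  have hpar : ∀ i < 2 * c.J, ∃ j < c.J, i = 2 * j ∨ i = 2 * j + 1 := fun i hi =>
    ⟨i / 2, by omega, by omega⟩
  have hadm : c.IsAdm y' := by
    refine ⟨by rw [v0, hy.base], fun i hi => ?_, fun i hi ho => ?_, fun i hi => ?_, fun i hi => ?_⟩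
    · obtain ⟨j, hj, rfl | rfl⟩ := hpar i hi
      · exact (hy.lo _ hi).trans (i0 j hj)
      · rw [i1]
        exact le_add_of_nonneg_right (mul_nonneg hθ0 (g0 j hj))
    · obtain ⟨j, hj, rfl | rfl⟩ := hpar i hi
      · omega
      · exact (g1 j hj).trans (hy.hi _ hi ho)
    · obtain ⟨j, hj, rfl | rfl⟩ := hpar i hi
      · rw [v1]
        exact hy.nonneg _ hi
      · rw [show 2 * j + 1 + 1 = 2 * j + 2 by ring, v2]
        have := hy.nonneg (2 * j) (by omega)
        have := c.lo_nonneg (2 * j + 1) hi (by omega)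
        have := mul_nonneg hθ0 (g0 j hj)
        linarith
    · obtain ⟨j, hj, rfl | rfl⟩ := hpar i hi
      · rw [v1]
        exact hy.le_one _ hi
      · exact (le2 j hj).trans (hy.le_one _ hi)
  have hE' : c.eclipseTime y' = c.T := by
    have : c.eclipseTime y' = θ * c.eclipseTime y := by
      unfold eclipseTime
      rw [Finset.mul_sum]
      refine Finset.sum_congr rfl fun j _ => ?_
      rw [i1]
      ring
    rw [this, hθ, div_mul_cancel₀ _ hEpos.ne']
  exact ⟨y', ⟨hadm, hE' ▸ hadm.eclipseTime_le⟩, hE'.le, fun j _ => v1 j, le2⟩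

end Chain

namespace SatData

variable (p : SatData J)

/-- The least increments of the depth of discharge. -/
noncomputable def chainLo (i : ℕ) : ℝ :=
  if i % 2 = 0 then extendZero (fun j => -(p.EhS j - p.EdS j) / p.Bmax) (i / 2)
  else extendZero (fun j => p.EdE j / p.Bmax) (i / 2)

/-- The increments of the depth of discharge that correspond to the maximal training times. -/
noncomputable def chainHi (i : ℕ) : ℝ :=
  if i % 2 = 0 then extendZero (fun j => min (-(p.EhS j - p.EdS j) / p.Bmax +
    p.Pc * (p.tE j - p.tS j.castSucc) / p.Bmax) 0) (i / 2)
  else extendZero (fun j => p.EdE j / p.Bmax + p.Pc * (p.tS j.succ - p.tE j) / p.Bmax) (i / 2)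

/-- The depths of discharge in temporal order. -/
noncomputable def depths (x : SatVar J) (i : ℕ) : ℝ :=
  if i = 0 then 1 - p.B0 / p.Bmax else if i % 2 = 1 then extendZero x.dE (i / 2)
  else extendZero x.dHat (i / 2 - 1)

variable {p}

theorem two_mul_add_one_div (j : ℕ) : (2 * j + 1) / 2 = j := by omega

theorem chainLo_even (j : Fin J) : p.chainLo (2 * j) = -(p.EhS j - p.EdS j) / p.Bmax := by
  unfold chainLo
  rw [if_pos (by omega), Nat.mul_div_cancel_left _ (by norm_num), extendZero_apply]

theorem chainLo_odd (j : Fin J) : p.chainLo (2 * j + 1) = p.EdE j / p.Bmax := by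
  unfold chainLo
  rw [if_neg (by omega), two_mul_add_one_div, extendZero_apply]

theorem chainHi_even (j : Fin J) : p.chainHi (2 * j) = min (-(p.EhS j - p.EdS j) / p.Bmax +
    p.Pc * (p.tE j - p.tS j.castSucc) / p.Bmax) 0 := by
  unfold chainHi
  rw [if_pos (by omega), Nat.mul_div_cancel_left _ (by norm_num), extendZero_apply]

theorem chainHi_odd (j : Fin J) : p.chainHi (2 * j + 1) =
    p.EdE j / p.Bmax + p.Pc * (p.tS j.succ - p.tE j) / p.Bmax := by
  unfold chainHi
  rw [if_neg (by omega), two_mul_add_one_div, extendZero_apply]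

theorem depths_zero (x : SatVar J) : p.depths x 0 = 1 - p.B0 / p.Bmax := if_pos rfl

theorem depths_odd (x : SatVar J) (j : Fin J) : p.depths x (2 * j + 1) = x.dE j := by
  unfold depths
  rw [if_neg (by omega), if_pos (by omega), two_mul_add_one_div, extendZero_apply]

theorem depths_even (x : SatVar J) (j : Fin J) : p.depths x (2 * j + 1 + 1) = x.dHat j := by
  unfold depths
  rw [if_neg (by omega), if_neg (by omega), show (2 * (j : ℕ) + 1 + 1) / 2 - 1 = j by omega,
    extendZero_apply]

theorem depths_of_lt (x : SatVar J) {i : ℕ} (hi : 2 * J < i) : p.depths x i = 0 := by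
  unfold depths extendZero
  rw [if_neg (by omega)]
  split_ifs <;> first | rfl | omega

theorem exists_fin_of_lt {i : ℕ} (hi : i < 2 * J) : ∃ j : Fin J, i = 2 * j ∨ i = 2 * j + 1 :=
  ⟨⟨i / 2, by omega⟩, by simp only; omega⟩

theorem bS_eq {x : SatVar J} {y : ℕ → ℝ} (h0 : y 0 = 1 - p.B0 / p.Bmax)
    (h : ∀ j : Fin J, x.bSnext j = p.Bmax * (1 - y (2 * j + 1 + 1))) (j : Fin J) :
    p.bS x j = p.Bmax * (1 - y (2 * j)) := by
  have hB := p.Bmax_pos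
  unfold bS
  split_ifs with hj
  · rw [hj, mul_zero, h0]
    field_simp
    ring
  · rw [h]
    simp only
    rw [show 2 * ((j : ℕ) - 1) + 1 + 1 = 2 * j by omega]

variable {x : SatVar J}

theorem IsFeasible.bE_eq (h : p.IsFeasible x) (j : Fin J) : x.bE j = p.Bmax * (1 - x.dE j) := by
  have hB := p.Bmax_pos
  rw [h.dod_start]
  field_simp
  ring

theorem IsFeasible.bSnext_eq (h : p.IsFeasible x) (j : Fin J) :
    x.bSnext j = p.Bmax * (1 - x.dHat j) := by
  have hB := p.Bmax_pos
  rw [h.dod_end]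
  field_simp
  ring

/-- Only an inequality, in contrast to `inc_odd`: surplus sunlight energy need not be stored. -/
theorem IsFeasible.inc_even (h : p.IsFeasible x) (j : Fin J) :
    p.chainLo (2 * j) + p.Pc * x.tauS j / p.Bmax ≤ inc (p.depths x) (2 * j) := by
  have hB := p.Bmax_pos
  have h1 := bS_eq (y := p.depths x) (depths_zero x)
    (fun j => by rw [depths_even, h.bSnext_eq]) j
  have h2 := (le_min_iff.1 (h.sunlight j)).1
  rw [h.bE_eq, h1] at h2
  rw [chainLo_even]
  simp only [inc, depths_odd]
  rw [← add_div, div_le_iff₀ hB]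
  linarith

theorem IsFeasible.inc_odd (h : p.IsFeasible x) (j : Fin J) :
    inc (p.depths x) (2 * j + 1) = p.chainLo (2 * j + 1) + p.Pc * x.tauE j / p.Bmax := by
  have hB := p.Bmax_pos
  have h2 := h.eclipse j
  rw [h.bE_eq, h.bSnext_eq] at h2
  rw [chainLo_odd]
  simp only [inc, depths_odd, depths_even]
  rw [← add_div, eq_div_iff hB.ne']
  linarith

/-- The two entries of the minimum in `chainHi` stand for the length of the sunlight period and for
the constraint that training must not discharge the battery. -/
theorem IsFeasible.tauS_le_hi (h : p.IsFeasible x) (j : Fin J) :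
    p.chainLo (2 * j) + p.Pc * x.tauS j / p.Bmax ≤ p.chainHi (2 * j) := by
  have hB := p.Bmax_pos
  have h1 := h.no_discharge j
  rw [chainLo_even, chainHi_even]
  refine le_min ?_ ?_
  · have := mul_le_mul_of_nonneg_left (h.time_sun j).2 p.Pc_pos.le
    have := div_le_div_of_nonneg_right this hB.le
    linarith
  · rw [← add_div]
    exact div_nonpos_of_nonpos_of_nonneg (by linarith) hB.le

theorem IsFeasible.chainLo_le_chainHi (h : p.IsFeasible x) (i : ℕ) (hi : i < 2 * J) :
    p.chainLo i ≤ p.chainHi i := by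
  have hB := p.Bmax_pos
  have hP := p.Pc_pos
  obtain ⟨j, rfl | rfl⟩ := exists_fin_of_lt hi
  · refine le_trans ?_ (h.tauS_le_hi j)
    have := (h.time_sun j).1
    exact le_add_of_nonneg_right (by positivity)
  · rw [chainLo_odd, chainHi_odd]
    have h1 := h.time_ecl j
    have : 0 ≤ p.tS j.succ - p.tE j := h1.1.trans h1.2
    exact le_add_of_nonneg_right (by positivity)

/-- The chain of a nonempty scheduling problem. -/
noncomputable def toChain (p : SatData J) (h : ∀ i < 2 * J, p.chainLo i ≤ p.chainHi i) : Chain where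
  J := J
  a := p.a
  base := 1 - p.B0 / p.Bmax
  lo := p.chainLo
  hi := p.chainHi
  T := p.Pc * p.Tc / p.Bmax
  a_pos := p.a_pos
  lo_nonneg i hi ho := by
    obtain ⟨j, rfl | rfl⟩ := exists_fin_of_lt hi
    · omega
    · rw [chainLo_odd]
      exact div_nonneg (p.EdE_nonneg j) p.Bmax_pos.le
  lo_le_hi := h

variable {hlh : ∀ i < 2 * J, p.chainLo i ≤ p.chainHi i}

theorem IsFeasible.isAdm (h : p.IsFeasible x) : (p.toChain hlh).IsAdm (p.depths x) := by
  have hB := p.Bmax_pos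
  have hP := p.Pc_pos
  refine ⟨depths_zero x, fun i hi => ?_, fun i hi ho => ?_, fun i hi => ?_, fun i hi => ?_⟩
  · obtain ⟨j, rfl | rfl⟩ := exists_fin_of_lt (J := J) hi
    · refine le_trans ?_ (h.inc_even j)
      have := (h.time_sun j).1
      exact le_add_of_nonneg_right (by positivity)
    · rw [h.inc_odd]
      have := (h.time_ecl j).1
      exact le_add_of_nonneg_right (by positivity)
  · obtain ⟨j, rfl | rfl⟩ := exists_fin_of_lt (J := J) hi
    · omega
    · rw [h.inc_odd]
      simp only [toChain]
      rw [chainHi_odd, chainLo_odd]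
      have := (h.time_ecl j).2
      gcongr
  · obtain ⟨j, rfl | rfl⟩ := exists_fin_of_lt (J := J) hi
    · rw [depths_odd]; exact (h.dE_mem j).1
    · rw [depths_even]; exact (h.dHat_mem j).1
  · obtain ⟨j, rfl | rfl⟩ := exists_fin_of_lt (J := J) hi
    · rw [depths_odd]; exact (h.dE_mem j).2
    · rw [depths_even]; exact (h.dHat_mem j).2

theorem IsFeasible.tauS_le (h : p.IsFeasible x) (j : Fin J) : p.Pc * x.tauS j / p.Bmax ≤
    min (inc (p.depths x) (2 * j)) (p.chainHi (2 * j)) - p.chainLo (2 * j) := by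
  have := le_min (h.inc_even j) (h.tauS_le_hi j)
  linarith

theorem IsFeasible.T_eq (h : p.IsFeasible x) : p.Pc * p.Tc / p.Bmax =
    (p.toChain hlh).eclipseTime (p.depths x) + ∑ j, p.Pc * x.tauS j / p.Bmax := by
  rw [← h.total_time, Finset.sum_add_distrib, mul_add, add_div, add_comm]
  congr 1
  · unfold Chain.eclipseTime
    rw [Finset.sum_range, Finset.mul_sum, Finset.sum_div]
    refine Finset.sum_congr rfl fun j _ => ?_
    rw [h.inc_odd]
    simp only [toChain]
    ring
  · rw [Finset.mul_sum, Finset.sum_div]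

theorem IsFeasible.time_eq (h : p.IsFeasible x) : (p.toChain hlh).time (p.depths x) =
    (p.toChain hlh).eclipseTime (p.depths x) +
      ∑ j : Fin J, (min (inc (p.depths x) (2 * j)) (p.chainHi (2 * j)) - p.chainLo (2 * j)) := by
  rw [Chain.time_eq_add h.isAdm, Finset.sum_range]
  rfl

theorem IsFeasible.isFeasible (h : p.IsFeasible x) : (p.toChain hlh).IsFeasible (p.depths x) := by
  refine ⟨h.isAdm, ?_⟩
  rw [h.time_eq, show (p.toChain hlh).T = p.Pc * p.Tc / p.Bmax from rfl, h.T_eq (hlh := hlh)]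
  exact add_le_add_right (Finset.sum_le_sum fun j _ => h.tauS_le j) _

/-- If the time constraint of the chain is active, the training times are determined. -/
theorem IsFeasible.tauS_eq (h : p.IsFeasible x)
    (hT : (p.toChain hlh).time (p.depths x) = (p.toChain hlh).T) (j : Fin J) :
    p.Pc * x.tauS j / p.Bmax =
      min (inc (p.depths x) (2 * j)) (p.chainHi (2 * j)) - p.chainLo (2 * j) := by
  rw [h.time_eq, show (p.toChain hlh).T = p.Pc * p.Tc / p.Bmax from rfl, h.T_eq (hlh := hlh)] at hT
  -- Termwise inequalities with equal sums are equalities.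
  exact (Finset.sum_eq_sum_iff_of_le fun j _ => h.tauS_le j).1 (add_left_cancel hT).symm j
    (Finset.mem_univ j)

/-- Schedules for feasible chains. -/
theorem exists_isFeasible_depths {y : ℕ → ℝ} (hy : (p.toChain hlh).IsFeasible y)
    (hE : (p.toChain hlh).eclipseTime y ≤ (p.toChain hlh).T) :
    ∃ x, p.IsFeasible x ∧ (∀ j : Fin J, x.dE j = y (2 * j + 1)) ∧
      ∀ j : Fin J, x.dHat j = y (2 * j + 1 + 1) := by
  have hB := p.Bmax_pos
  have hP := p.Pc_pos
  obtain ⟨hadm, hT⟩ := hy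
  have hadm0 : y 0 = 1 - p.B0 / p.Bmax := hadm.base
  have hlo : ∀ i < 2 * J, p.chainLo i ≤ inc y i := hadm.lo
  have hhi : ∀ i < 2 * J, i % 2 = 1 → inc y i ≤ p.chainHi i := hadm.hi
  have hnn : ∀ i < 2 * J, 0 ≤ y (i + 1) := hadm.nonneg
  have hle : ∀ i < 2 * J, y (i + 1) ≤ 1 := hadm.le_one
  set cap : Fin J → ℝ := fun j => min (inc y (2 * j)) (p.chainHi (2 * j)) - p.chainLo (2 * j)
    with hcap
  have hcap0 : ∀ j, 0 ≤ cap j := fun j =>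
    sub_nonneg.2 (le_min (hlo _ (by omega)) (hlh _ (by omega)))
  set E := (p.toChain hlh).eclipseTime y with hEdef
  have hTdef : (p.toChain hlh).T = p.Pc * p.Tc / p.Bmax := rfl
  have htime : (p.toChain hlh).time y = E + ∑ j, cap j := by
    rw [Chain.time_eq_add hadm, Finset.sum_range]
    rfl
  have hEsum : E = ∑ j : Fin J, (inc y (2 * j + 1) - p.chainLo (2 * j + 1)) := by
    rw [hEdef]
    unfold Chain.eclipseTime
    rw [Finset.sum_range]
    rfl
  rw [htime] at hT
  set T := (p.toChain hlh).T with hTT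
  have hcs : 0 ≤ ∑ j, cap j := Finset.sum_nonneg fun j _ => hcap0 j
  -- A chain may buy more time than needed, while the schedule must train exactly the total time.
  -- Eclipse training is dictated by the depths, so the sunlight capacities are scaled down by a
  -- common factor.
  obtain ⟨θ, hθ0, hθ1, hθ⟩ : ∃ θ : ℝ, 0 ≤ θ ∧ θ ≤ 1 ∧ θ * ∑ j, cap j = T - E := by
    rcases hcs.eq_or_lt with h0 | hpos
    · refine ⟨0, le_rfl, zero_le_one, ?_⟩
      rw [zero_mul]
      linarith
    · exact ⟨(T - E) / ∑ j, cap j, div_nonneg (by linarith) hcs,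
        (div_le_one hpos).2 (by linarith), div_mul_cancel₀ _ hpos.ne'⟩
  set s : Fin J → ℝ := fun j => θ * cap j with hs
  have hs0 : ∀ j, 0 ≤ s j := fun j => mul_nonneg hθ0 (hcap0 j)
  have hs1 : ∀ j, s j ≤ cap j := fun j => by
    have := mul_le_mul_of_nonneg_right hθ1 (hcap0 j)
    simp only [hs]
    linarith
  set e : Fin J → ℝ := fun j => inc y (2 * j + 1) - p.chainLo (2 * j + 1) with he
  set x : SatVar J := WithLp.toLp 2 fun k => ![s k.2 * p.Bmax / p.Pc, e k.2 * p.Bmax / p.Pc,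
    p.Bmax * (1 - y (2 * k.2 + 1)), p.Bmax * (1 - y (2 * k.2 + 1 + 1)), y (2 * k.2 + 1),
    y (2 * k.2 + 1 + 1)] k.1 with hx
  have x0 : ∀ j, x.tauS j = s j * p.Bmax / p.Pc := fun j => rfl
  have x1 : ∀ j, x.tauE j = e j * p.Bmax / p.Pc := fun j => rfl
  have x2 : ∀ j, x.bE j = p.Bmax * (1 - y (2 * j + 1)) := fun j => rfl
  have x3 : ∀ j, x.bSnext j = p.Bmax * (1 - y (2 * j + 1 + 1)) := fun j => rfl
  have x4 : ∀ j, x.dE j = y (2 * j + 1) := fun j => rfl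
  have x5 : ∀ j, x.dHat j = y (2 * j + 1 + 1) := fun j => rfl
  have p0 : ∀ j, p.Pc * x.tauS j = s j * p.Bmax := fun j => by rw [x0]; field_simp
  have p1 : ∀ j, p.Pc * x.tauE j = e j * p.Bmax := fun j => by rw [x1]; field_simp
  have hbS := bS_eq (p := p) (x := x) (y := y) hadm0 x3
  have hH : ∀ j : Fin J, p.chainLo (2 * j) * p.Bmax = -(p.EhS j - p.EdS j) := fun j => by
    rw [chainLo_even, div_mul_cancel₀ _ hB.ne']
  have hD : ∀ j : Fin J, p.chainLo (2 * j + 1) * p.Bmax = p.EdE j := fun j => by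
    rw [chainLo_odd, div_mul_cancel₀ _ hB.ne']
  have hsinc : ∀ j : Fin J, s j * p.Bmax ≤ (inc y (2 * j) - p.chainLo (2 * j)) * p.Bmax :=
    fun j => mul_le_mul_of_nonneg_right
      ((hs1 j).trans (sub_le_sub_right (min_le_left _ _) _)) hB.le
  have hshi : ∀ j : Fin J, s j ≤ p.chainHi (2 * j) - p.chainLo (2 * j) :=
    fun j => (hs1 j).trans (sub_le_sub_right (min_le_right _ _) _)
  refine ⟨x, ⟨fun j => ?_, fun j => ?_, fun j => ?_, fun j => ?_, fun j => ?_, ?_, fun j => ?_,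
    fun j => ?_, fun j => ?_, fun j => ?_⟩, x4, x5⟩
  · rw [p1, x2, x3]
    have := hD j
    simp only [he, inc]
    linarith
  · rw [p0, x2, hbS]
    have h1 := hsinc j
    have h2 := hH j
    simp only [inc] at h1
    refine le_min (by linarith) ?_
    have := mul_nonneg hB.le (hnn (2 * j) (by omega))
    linarith
  · rw [p0]
    have h2 := hH j
    have h3 : s j ≤ 0 - p.chainLo (2 * j) := by
      have := hshi j
      rw [chainHi_even] at this
      exact this.trans (sub_le_sub_right (min_le_right _ _) _)
    have := mul_le_mul_of_nonneg_right h3 hB.le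
    linarith
  · rw [x4, x2]; field_simp; ring
  · rw [x5, x3]; field_simp; ring
  · have h1 : ∑ j, (x.tauS j + x.tauE j) = (∑ j, s j + ∑ j, e j) * p.Bmax / p.Pc := by
      rw [← Finset.sum_add_distrib, Finset.sum_mul, Finset.sum_div]
      refine Finset.sum_congr rfl fun j _ => ?_
      rw [x0, x1]
      ring
    have h2 : ∑ j, s j = T - E := by rw [← hθ, Finset.mul_sum]
    rw [h1, h2, ← hEsum, sub_add_cancel, hTdef]
    field_simp
  · rw [x0]
    refine ⟨div_nonneg (mul_nonneg (hs0 j) hB.le) hP.le, ?_⟩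
    have h3 : s j ≤ p.Pc * (p.tE j - p.tS j.castSucc) / p.Bmax := by
      have := hshi j
      rw [chainHi_even, chainLo_even] at this
      have h4 := this.trans (sub_le_sub_right (min_le_left _ _) _)
      linarith
    rw [le_div_iff₀ hB] at h3
    rw [div_le_iff₀ hP]
    linarith
  · rw [x1]
    refine ⟨div_nonneg (mul_nonneg (sub_nonneg.2 (hlo _ (by omega))) hB.le) hP.le, ?_⟩
    have h3 : e j ≤ p.Pc * (p.tS j.succ - p.tE j) / p.Bmax := by
      have := hhi (2 * j + 1) (by omega) (by omega)
      rw [chainHi_odd, ← chainLo_odd] at this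
      simp only [he]
      linarith
    rw [le_div_iff₀ hB] at h3
    rw [div_le_iff₀ hP]
    linarith
  · rw [x3]
    have h1 := mul_nonneg hB.le (hnn (2 * j + 1) (by omega))
    have h2 := mul_nonneg hB.le (sub_nonneg.2 (hle (2 * j + 1) (by omega)))
    exact ⟨h2, by linarith⟩
  · rw [x2]
    have h1 := mul_nonneg hB.le (hnn (2 * j) (by omega))
    have h2 := mul_nonneg hB.le (sub_nonneg.2 (hle (2 * j) (by omega)))
    exact ⟨h2, by linarith⟩

/-- A feasible chain with too much eclipse training has no schedule. It is first replaced by one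
with less, which keeps start depths and lowers end depths; this cannot raise the linear form because
the slopes at the ends are positive. -/
theorem IsSurrogateOptimal.isSurrogateCrit {z x : SatVar J} (h : p.IsSurrogateOptimal z x) :
    (p.toChain hlh).IsSurrogateCrit (p.depths z) (p.depths x) := by
  have hx : p.IsFeasible x := h.1
  refine ⟨hx.isFeasible, fun y' hy' => ?_⟩
  have hT : 0 ≤ (p.toChain hlh).T := by
    have hB := p.Bmax_pos
    have hP := p.Pc_pos
    have : 0 ≤ p.Tc := by
      rw [← hx.total_time]
      exact Finset.sum_nonneg fun j _ => add_nonneg (hx.time_sun j).1 (hx.time_ecl j).1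
    show 0 ≤ p.Pc * p.Tc / p.Bmax
    positivity
  obtain ⟨y'', h1, h2, h3, h4⟩ := hy'.exists_eclipseTime_le hT
  obtain ⟨w, hw, hw1, hw2⟩ := exists_isFeasible_depths h1 h2
  have key := h.deriv_nonneg (y := w) hw
  rw [surrogateDeriv_apply, ← Finset.sum_sub_distrib] at key
  refine key.trans ?_
  unfold Chain.lin
  rw [sum_range_two_mul, Finset.sum_range]
  refine Finset.sum_le_sum fun j _ => ?_
  have e1 : (w - x).dHat j = w.dHat j - x.dHat j := rfl
  have e2 : (w - x).dE j = w.dE j - x.dE j := rfl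
  have g1 : (p.toChain hlh).surrogateGrad (p.depths z) (p.depths x) (2 * (j : ℕ) + 1) =
      -cycleLifeSlope p.a (z.dE j) := by
    unfold Chain.surrogateGrad
    rw [if_neg (by omega), depths_odd]
    rfl
  have g2 : (p.toChain hlh).surrogateGrad (p.depths z) (p.depths x) (2 * (j : ℕ) + 1 + 1) =
      cycleLifeSlope p.a (x.dHat j) := by
    unfold Chain.surrogateGrad
    rw [if_pos (by omega), depths_even]
    rfl
  have hj : (j : ℕ) < (p.toChain hlh).J := j.2
  rw [e1, e2, g1, g2, depths_odd, depths_even, hw1, hw2, h3 j hj]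
  have h5 := mul_le_mul_of_nonneg_left (h4 j hj) (slope_pos p.a_pos (hx.dHat_mem j).1).le
  rw [show 2 * (j : ℕ) + 2 = 2 * j + 1 + 1 by ring] at h5
  linarith

/-- This transfers two facts: vanishing steps of the chain trigger the stopping test, and a change
of the depth vector means that the chain moves. -/
theorem norm_dVec_sub_le (z x : SatVar J) :
    ‖x.dVec - z.dVec‖ ≤ (p.toChain hlh).gap (p.depths z) (p.depths x) := by
  have h1 : ‖x.dVec - z.dVec‖ ≤ ∑ j, |x.dE j - z.dE j| := by
    have h0 : 0 ≤ ∑ j, |x.dE j - z.dE j| := Finset.sum_nonneg fun _ _ => abs_nonneg _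
    rw [EuclideanSpace.norm_eq]
    refine Real.sqrt_le_iff.2 ⟨h0, ?_⟩
    exact Finset.sum_sq_le_sq_sum_of_nonneg fun j _ => abs_nonneg _
  refine h1.trans ?_
  unfold Chain.gap
  rw [sum_range_two_mul, Finset.sum_range]
  refine Finset.sum_le_sum fun j _ => ?_
  rw [depths_odd, depths_odd]
  exact le_add_of_nonneg_right (abs_nonneg _)

/-- An infinite run of the procedure. -/
theorem tendsto_norm_dVec_sub {x : ℕ → SatVar J} (h0 : x 0 ∈ p.feasibleSet)
    (hx : ∀ l, p.IsSurrogateOptimal (x l) (x (l + 1))) :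
    Tendsto (fun l => ‖(x (l + 1)).dVec - (x l).dVec‖) atTop (𝓝 0) := by
  have h0' : p.IsFeasible (x 0) := h0
  obtain ⟨-, -, -, -, -, -, h⟩ := (p.toChain h0'.chainLo_le_chainHi).exists_cluster
    (fun l => p.depths (x l)) h0'.isFeasible (fun l => (hx l).isSurrogateCrit)
    (fun l i hi => depths_of_lt _ hi)
  exact squeeze_zero (fun _ => norm_nonneg _) (fun l => norm_dVec_sub_le _ _) h

/-- An infinite run in which the depths of discharge change in every step converges. -/
theorem exists_tendsto_of_run {x : ℕ → SatVar J} (h0 : x 0 ∈ p.feasibleSet)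
    (hx : ∀ l, p.IsSurrogateOptimal (x l) (x (l + 1)))
    (hmove : ∀ l, 0 < ‖(x (l + 1)).dVec - (x l).dVec‖) :
    ∃ xbar, Tendsto x atTop (𝓝 xbar) := by
  have h0' : p.IsFeasible (x 0) := h0
  have hfeas : ∀ l, p.IsFeasible (x l) := fun l => by
    cases l with
    | zero => exact h0
    | succ l => exact (hx l).1
  have hB := p.Bmax_pos
  have hP := p.Pc_pos
  obtain ⟨ys, hys, hT⟩ := (p.toChain h0'.chainLo_le_chainHi).exists_tendsto
    (fun l => p.depths (x l)) h0'.isFeasible (fun l => (hx l).isSurrogateCrit)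
    (fun l i hi => depths_of_lt _ hi) (fun l => (hmove l).trans_le (norm_dVec_sub_le _ _))
  rw [tendsto_pi_nhds] at hys
  have t4 : ∀ j, Tendsto (fun l => (x l).dE j) atTop (𝓝 (ys (2 * j + 1))) := fun j =>
    (hys (2 * j + 1)).congr fun l => depths_odd _ j
  have t5 : ∀ j, Tendsto (fun l => (x l).dHat j) atTop (𝓝 (ys (2 * j + 1 + 1))) := fun j =>
    (hys (2 * j + 1 + 1)).congr fun l => depths_even _ j
  have tinc : ∀ i, Tendsto (fun l => inc (p.depths (x l)) i) atTop (𝓝 (inc ys i)) := fun i =>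
    (hys (i + 1)).sub (hys i)
  have hlim : ∀ k : Fin 6 × Fin J, ∃ t, Tendsto (fun l => x l k) atTop (𝓝 t) := by
    rintro ⟨k, j⟩
    fin_cases k
    -- The sunlight training times are the only coordinates that the depths alone do not determine;
    -- here the active time constraint is needed.
    · refine ⟨_, (((tinc (2 * j)).min (tendsto_const_nhds (x := p.chainHi (2 * j)))).sub_const
        (p.chainLo (2 * j))).mul_const (p.Bmax / p.Pc) |>.congr' ?_⟩
      filter_upwards [hT] with l hl
      rw [← (hfeas l).tauS_eq hl j]
      show _ = (x l).tauS j
      field_simp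
    · refine ⟨_, ((tinc (2 * j + 1)).sub_const (p.chainLo (2 * j + 1))).mul_const
        (p.Bmax / p.Pc) |>.congr fun l => ?_⟩
      rw [(hfeas l).inc_odd]
      show _ = (x l).tauE j
      field_simp
      ring
    · exact ⟨_, ((t4 j).const_sub 1).const_mul p.Bmax |>.congr fun l => ((hfeas l).bE_eq j).symm⟩
    · exact ⟨_, ((t5 j).const_sub 1).const_mul p.Bmax |>.congr fun l =>
        ((hfeas l).bSnext_eq j).symm⟩
    · exact ⟨_, t4 j⟩
    · exact ⟨_, t5 j⟩
  choose t ht using hlim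
  exact ⟨WithLp.toLp 2 t, ((PiLp.continuous_toLp 2 _).tendsto t).comp (tendsto_pi_nhds.2 ht)⟩

end SatData

/-! ### The accuracy function and the runs of the algorithm. -/

namespace SatData

variable (p : SatData J)

/-- Distances to the stationary points of the approximate fixed points of the procedure. -/
def stationaryDists (ε : ℝ) : Set ℝ :=
  {r | ∃ z x : SatVar J, z ∈ p.feasibleSet ∧ p.IsSurrogateOptimal z x ∧
    ‖x.dVec - z.dVec‖ ≤ ε ∧ r = Metric.infDist x {x | p.IsStationary x}}

/-- The accuracy that the procedure with tolerance `ε` achieves. -/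
noncomputable def accuracy (ε : ℝ) : ℝ := 2 * ε + sSup (p.stationaryDists ε)

theorem stationaryDists_nonneg {ε r : ℝ} (hr : r ∈ p.stationaryDists ε) : 0 ≤ r := by
  obtain ⟨z, x, -, -, -, rfl⟩ := hr
  exact Metric.infDist_nonneg

theorem bddAbove_stationaryDists (ε : ℝ) : BddAbove (p.stationaryDists ε) := by
  refine (p.isCompact_feasibleSet.bddAbove_image
    (Metric.continuous_infDist_pt {x | p.IsStationary x}).continuousOn).mono ?_
  rintro r ⟨z, x, -, hx, -, rfl⟩
  exact ⟨x, hx.1, rfl⟩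

theorem lt_accuracy {ε : ℝ} (hε : 0 < ε) : ε < p.accuracy ε := by
  -- An empty feasible set does no harm, since the supremum of the empty set is 0 by convention.
  have : 0 ≤ sSup (p.stationaryDists ε) := Real.sSup_nonneg fun _ => p.stationaryDists_nonneg
  unfold accuracy
  linarith

theorem tendsto_accuracy : Tendsto p.accuracy (𝓝[>] 0) (𝓝 0) := by
  have h1 : Tendsto (fun ε : ℝ => 2 * ε) (𝓝[>] 0) (𝓝 0) := by
    have : Tendsto (fun ε : ℝ => 2 * ε) (𝓝 0) (𝓝 (2 * 0)) := tendsto_id.const_mul 2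
    rw [mul_zero] at this
    exact this.mono_left nhdsWithin_le_nhds
  have h2 : Tendsto (fun ε => sSup (p.stationaryDists ε)) (𝓝[>] 0) (𝓝 0) := by
    rw [Metric.tendsto_nhds]
    intro η hη
    obtain ⟨ε₀, hε₀, h⟩ := p.exists_infDist_lt (show 0 < η / 2 by linarith)
    filter_upwards [Ioo_mem_nhdsGT hε₀] with ε hε
    have h3 : 0 ≤ sSup (p.stationaryDists ε) := Real.sSup_nonneg fun _ => p.stationaryDists_nonneg
    have h4 : sSup (p.stationaryDists ε) ≤ η / 2 := by
      refine Real.sSup_le ?_ (by linarith)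
      rintro r ⟨z, x, hz, hx, hd, rfl⟩
      exact (h z x hz hx (hd.trans hε.2.le)).le
    rw [Real.dist_eq, sub_zero, abs_of_nonneg h3]
    linarith
  have h3 := h1.add h2
  rw [add_zero] at h3
  exact h3

theorem exists_norm_sub_le_accuracy {ε : ℝ} (hε : 0 < ε) {z x : SatVar J} (hz : z ∈ p.feasibleSet)
    (hx : p.IsSurrogateOptimal z x) (hd : ‖x.dVec - z.dVec‖ ≤ ε) :
    ∃ xstar, p.IsStationary xstar ∧ ‖xstar - x‖ ≤ p.accuracy ε := by
  have h1 : Metric.infDist x {x | p.IsStationary x} ≤ sSup (p.stationaryDists ε) :=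
    le_csSup (p.bddAbove_stationaryDists ε) ⟨z, x, hz, hx, hd, rfl⟩
  -- The term `2 * ε` makes the inequality strict, so some stationary point realizes the bound.
  have h2 : Metric.infDist x {x | p.IsStationary x} < p.accuracy ε := by
    unfold accuracy
    linarith
  obtain ⟨y, hy, hxy⟩ := (Metric.infDist_lt_iff (exists_isStationary ⟨x, hx.1⟩)).1 h2
  refine ⟨y, hy, ?_⟩
  rw [← dist_eq_norm, dist_comm]
  exact hxy.le

variable {p} {ε : ℝ} {x : ℕ → SatVar J} {N : ℕ∞}

theorem IsRun.mem_feasibleSet (h : p.IsRun ε x N) {l : ℕ} (hl : (l : ℕ∞) ≤ N) :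
    x l ∈ p.feasibleSet := by
  cases l with
  | zero => exact h.init
  | succ l => exact (h.step l (lt_of_lt_of_le (by exact_mod_cast Nat.lt_succ_self l) hl)).1

/-- The last step of a finite run. -/
theorem IsRun.exists_last {L : ℕ} (h : p.IsRun ε x L) : ∃ k, L = k + 1 ∧ x k ∈ p.feasibleSet ∧
    p.IsSurrogateOptimal (x k) (x L) ∧ ‖(x L).dVec - (x k).dVec‖ ≤ ε := by
  have hL : 1 ≤ L := by exact_mod_cast h.one_le
  obtain ⟨k, rfl⟩ := Nat.exists_eq_succ_of_ne_zero (show L ≠ 0 by omega)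
  have hk : (k : ℕ∞) < ((k + 1 : ℕ) : ℕ∞) := by exact_mod_cast Nat.lt_succ_self k
  exact ⟨k, rfl, h.mem_feasibleSet hk.le, h.step k hk, (h.stop_iff k hk).2 rfl⟩

theorem IsRun.lt_norm (h : p.IsRun ε x ⊤) (l : ℕ) : ε < ‖(x (l + 1)).dVec - (x l).dVec‖ := by
  by_contra! hle
  exact ENat.top_ne_natCast _ ((h.stop_iff l (ENat.natCast_lt_top l)).1 hle)

theorem IsRun.lt_top (h : p.IsRun ε x N) (hε : 0 < ε) : N < ⊤ := by
  rw [lt_top_iff_ne_top]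
  rintro rfl
  have h1 := tendsto_norm_dVec_sub h.init fun l => h.step l (ENat.natCast_lt_top l)
  obtain ⟨l, hl⟩ := (h1.eventually (gt_mem_nhds hε)).exists
  exact lt_asymm hl (h.lt_norm l)

/-- The limit of an infinite run is stationary. -/
theorem IsRun.isStationary_of_tendsto (h : p.IsRun ε x ⊤) {xbar : SatVar J}
    (hx : Tendsto x atTop (𝓝 xbar)) : p.IsStationary xbar :=
  (IsSurrogateOptimal.of_tendsto (Eventually.of_forall fun l => h.step l (ENat.natCast_lt_top l)) hx
    (hx.comp (tendsto_add_atTop_nat 1))).isStationary rfl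

end SatData

theorem mainTheorem1 {J : ℕ} (p : SatData J) :
    ∃ δ : ℝ → ℝ, Tendsto δ (𝓝[>] 0) (𝓝 0) ∧ (∀ ε : ℝ, 0 < ε → ε < δ ε) ∧
      ∀ ε : ℝ, 0 ≤ ε → ∀ (x : ℕ → SatVar J) (N : ℕ∞), p.IsRun ε x N →
        ∃ xbar : SatVar J, RunConvergesTo x N xbar ∧
          (ε = 0 → p.IsStationary xbar) ∧
          (0 < ε → N < ⊤ ∧ ∃ xstar : SatVar J, p.IsStationary xstar ∧ ‖xstar - xbar‖ ≤ δ ε) := by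
  refine ⟨p.accuracy, p.tendsto_accuracy, fun ε hε => p.lt_accuracy hε, fun ε hε x N h => ?_⟩
  induction N using ENat.recTopCoe with
  | top =>
    -- A positive tolerance is met eventually because the steps tend to zero. In an infinite run the
    -- failing test moreover says that the depths change in every step.
    have hε0 : ε = 0 := le_antisymm (not_lt.1 fun hpos => lt_irrefl _ (h.lt_top hpos)) hε
    obtain ⟨xbar, hx⟩ := SatData.exists_tendsto_of_run h.init
      (fun l => h.step l (ENat.natCast_lt_top l)) (fun l => hε.trans_lt (h.lt_norm l))
    exact ⟨xbar, Or.inr ⟨rfl, hx⟩, fun _ => h.isStationary_of_tendsto hx,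
      fun hpos => absurd hpos (by rw [hε0]; exact lt_irrefl 0)⟩
  | coe L =>
    obtain ⟨k, -, hk, hopt, hd⟩ := h.exists_last
    refine ⟨x L, Or.inl ⟨L, rfl, rfl⟩, fun h0 => ?_, fun hpos => ⟨ENat.natCast_lt_top L,
      p.exists_norm_sub_le_accuracy hpos hk hopt hd⟩⟩
    rw [h0] at hd
    exact hopt.isStationary (sub_eq_zero.1 (norm_le_zero_iff.1 hd)).symm
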